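/- **Conventions.** Let $(V,\mathbf 1,\omega,Y)$ be a conformal vertex algebra over $\mathbb C$, $V=\bigoplus_{n\ge 0}V_n$ with $\dim V_n<\infty$, $Y(a,z)b=\sum_k a_{(k)}b\,z^{-k-1}$, $L_m=\omega_{(m+1)}$, $L_0=n$ on $V_n$. For $\tau\in\mathbb H$ let $g_{2k}(\tau)=2\sum_{n\ge1}n^{-2k}+\frac{2(2\pi i)^{2k}}{(2k-1)!}\sum_{n\ge1}\sigma_{2k-1}(n)e^{2\pi i n\tau}$ ($k\ge1$), let $\wp_k(t,\tau)$ be the meromorphic function with Laurent expansion $t^{-k}+(-1)^k\sum_{n\ge1}\binom{2n+1}{k-1}g_{2n+2}(\tau)t^{2n+2-k}$ at $t=0$ (so $\wp_1,\wp_2$ are the Weierstrass $\zeta$- and $\wp$-functions of $\mathbb Z+\mathbb Z\tau$), $\zeta(t,\tau)=\wp_1(t,\tau)-g_2(\tau)t$, $\overline\wp_2=\wp_2+g_2$ and $\overline\wp_k=\wp_k$ for $k\ge3$. Let $\mathcal F_m$ be the space of meromorphic functions $f(t_1,\dots,t_m,\tau)$ on $\mathbb C^m\times\mathbb H$, with periods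 $1$ and $\tau$ in each $t_i$, and with poles only along $t_i-t_j\in\mathbb Z+\mathbb Z\tau$, $i\ne j$. Let $\mathbb J^m_k\subset\mathcal F_m$ consist of those $f$ with $f\big(\tfrac{t}{c\tau+d},\tfrac{a\tau+b}{c\tau+d}\big)=(c\tau+d)^kf(t,\tau)$ for all $\left(\begin{smallmatrix}a&b\\c&d\end{smallmatrix}\right)\in SL(2,\mathbb Z)$ that are holomorphic at the cusp (for fixed $t$ with $t_i-t_j\notin\mathbb Z$, $i\neq j$, $f(t,\tau)$ is bounded as $\operatorname{Im}\tau\to\infty$), and $\mathbb J^m_*=\bigoplus_{k\ge0}\mathbb J^m_k$. For $n\ge1$ consider $$V^{\otimes(n+2)}\otimes\mathbb J^{n+2}_*\xrightarrow{d_2}V^{\otimes(n+1)}\otimes\mathbb J^{n+1}_*\xrightarrow{d_1}V^{\otimes n}\otimes\mathbb J^n_* ,$$ $$d_1(a_0\otimes\dots\otimes a_n\otimes f(t_0,\dots,t_n))=\sum_{i=1}^n\sum_k a_1\otimes\cdots a_{0(k)}a_i\cdots\otimes a_n\otimes f_{ik},\qquad f=\sum_k f_{ik}(t_0-t_i)^k,$$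 $$d_2(a\otimes b\otimes a_1\otimes\dots\otimes a_n\otimes f(u,v,t_1,\dots,t_n))=\sum_{i,k} a\otimes\cdots b_{(k)}a_i\cdots\otimes f_{1ik}-\sum_{i,k} b\otimes\cdots a_{(k)}a_i\cdots\otimes f_{0ik}-\sum_k a_{(k)}b\otimes a_1\otimes\cdots\otimes f_{00k},$$ where $f_{0ik},f_{1ik},f_{00k}$ are the coefficients of $(u-t_i)^k,(v-t_i)^k,(u-v)^k$. Let $C^n_1$ be the quotient of $V^{\otimes (n+1)}\otimes\mathbb J^{n+1}_*$ by the image of $L_{-1}^{(0)}+\partial_{t_0}$ (a superscript $(j)$ denotes the action on the factor $a_j$), and $Z^n_1=\ker d_1\subset C^n_1$. If $a_i\in V_{\Delta_i}$ and $f\in\mathbb J^{n+1}_k$, then $a_0\otimes\dots\otimes a_n\otimes f$ has *conformal degree* $k+\sum_{i=0}^n\Delta_i$; this induces a grading of $Z^n_1$. Put $D_\tau=2\pi i\,\partial_\tau+\sum_i\zeta(t_n-t_i,\tau)\partial_{t_i}$, where the sum is over all variables $t_i$ other than the last one, $t_n$. On cycles put $$\nabla_\tau(a_0\otimes\dots\otimes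 a_n\otimes f)=a_0\otimes\dots\otimes a_n\otimes\big(D_\tau f+\overline\wp_2(t_n-t_0)f\big)+\omega_{(-1)}^{(n)}(a_0\otimes\cdots\otimes f)-\sum_{k\ge1}g_{2k}\,\omega_{(2k-1)}^{(n)}(a_0\otimes\cdots\otimes f)-\sum_{i=0}^{n-1}\sum_{m\ge0}\overline\wp_{m+2}(t_n-t_i)\,\omega^{(i)}_{(m+1)}(a_0\otimes\cdots\otimes f);$$ this is a cycle with coefficients in $\mathbb C[g_2]$. A system $S=\{S^n\}_{n\ge1}$ of $\mathbb J^n_*$-linear maps $S^n:Z^n_1\to\mathcal F_n$ ($\mathbb J^n_*$ acts on chains through the variables $t_1,\dots,t_n,\tau$) has the *genus-one property* if for all $n$: 1. $S^n\circ d_2=0$; $\partial_{t_j}S^n(\alpha)=S^n((L_{-1}^{(j)}+\partial_{t_j})\alpha)$ for $1\le j\le n$; and $D_\tau S^n(\alpha)=S^n(\nabla_\tau\alpha)$, where $S^n$ is extended $\mathbb C[g_2]$-linearly; 2. $S^n(\mathbf 1\otimes a_1\otimes\dots\otimes a_n\otimes f)=0$; 3. $S^n(\pi\alpha;t_{\pi(1)},\dots,t_{\pi(n)})=S^n(\alpha;t_1,\dots,t_n)$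 for every permutation $\pi$ of $\{1,\dots,n\}$, where $\pi(a_0\otimes\dots\otimes a_n\otimes f)=a_0\otimes a_{\pi(1)}\otimes\dots\otimes a_{\pi(n)}\otimes g$ with $g(t_0,t_{\pi(1)},\dots,t_{\pi(n)})=f(t_0,t_1,\dots,t_n)$; 4. for every cycle $\beta=a_0\otimes b\otimes a_1\otimes\dots\otimes a_n\otimes f(u,v,t_1,\dots,t_n,\tau)\in Z_1^{n+1}$ (or a sum of such), with $c_{i,s}=\sum_k a_0\otimes\cdots b_{(k)}a_i\cdots\otimes a_n\otimes f_{1i,k-s}\in Z^n_1$, $$\begin{aligned}S^{n+1}(\beta;v,t_1,\dots,t_n,\tau)&=\sum_{i=1}^n\Big[S^n(c_{i,0})\zeta(v-t_i)+S^n(c_{i,1})(\wp_2(v-t_i)+g_2)+\sum_{m\ge0}S^n(c_{i,m+2})\wp_{m+3}(v-t_i)\Big]\\&\quad-\sum_{i=1}^{n-1}\Big[S^n(c_{i,0})\zeta(t_n-t_i)+S^n(c_{i,1})(\wp_2(t_n-t_i)+g_2)+\sum_{m\ge0}S^n(c_{i,m+2})\wp_{m+3}(t_n-t_i)\Big]\\&\quad+S^n(c_{n,-1})-\sum_{j\ge1}S^n(c_{n,2j-1})\,g_{2j}(\tau).\end{aligned}$$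 The vector space of these systems is the space of *degree-1 conformal blocks on the torus*. **Theorem.** Let $S$ have the genus-one property and let $\sigma=\left(\begin{smallmatrix}a&b\\c&d\end{smallmatrix}\right)\in SL(2,\mathbb Z)$. There is a unique system $\sigma(S)$ of linear maps $\sigma(S)^n:Z^n_1\to\mathcal F_n$ with $$\sigma(S)^n(\alpha;t_1,\dots,t_n,\tau)=(c\tau+d)^{1-p}\,S^n\Big(\alpha;\frac{t_1}{c\tau+d},\dots,\frac{t_n}{c\tau+d},\frac{a\tau+b}{c\tau+d}\Big)$$ for all $n$ and all cycles $\alpha\in Z^n_1$ of conformal degree $p$ (so $p=k+\sum_{i=0}^n\Delta_i$ for $\alpha=a_0\otimes\dots\otimes a_n\otimes f$ with $a_i\in V_{\Delta_i}$, $f\in\mathbb J^{n+1}_k$), and $\sigma(S)$ again has the genus-one property. The operators $S\mapsto\sigma(S)$ define a linear right action of $SL(2,\mathbb Z)$ on the space of degree-1 conformal blocks. -/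

import Mathlib

open Filter Topology
open scoped TensorProduct

noncomputable section

namespace ChiralTorus

/-! ### Conformal vertex algebras -/

/-- A conformal vertex algebra (vertex operator algebra) over `ℂ`, graded by `ℕ` with
finite-dimensional graded pieces. `nprod n a b` is the `n`-th product `a₍ₙ₎b`, so that
`Y(a,z)b = ∑ₙ (a₍ₙ₎b) z⁻ⁿ⁻¹`. -/
structure ConformalVertexAlgebra (V : Type*) [AddCommGroup V] [Module ℂ V] where
  /-- the `n`-th products -/
  nprod : ℤ → V →ₗ[ℂ] V →ₗ[ℂ] V
  /-- the vacuum vector -/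
  vac : V
  /-- the conformal vector -/
  conf : V
  /-- the central charge -/
  charge : ℂ
  /-- the graded pieces `V_n` -/
  piece : ℕ → Submodule ℂ V
  truncation : ∀ a b, ∃ N : ℤ, ∀ n, N ≤ n → nprod n a b = 0
  /-- `Y(1,z) = id` -/
  vacuum : ∀ n b, nprod n vac b = if n = -1 then b else 0
  /-- `a₍ₙ₋₁₎1 = δ_{n,0} a` for `n ≥ 0` -/
  creation : ∀ (n : ℕ) a, nprod ((n : ℤ) - 1) a vac = if n = 0 then a else 0
  /-- The Borcherds identity for the functions `zᵐ wⁿ (z-w)ˡ`, which is equivalent to the identity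
  for all functions in `ℂ[[z,w]][z⁻¹,w⁻¹,(z-w)⁻¹]`; only finitely many terms of each sum are
  nonzero. -/
  borcherds : ∀ (l m n : ℤ) (a b c : V),
    ∑ᶠ j : ℕ, ((Ring.choose m j : ℤ) : ℂ) • nprod (m + n - j) (nprod (l + j) a b) c =
      ∑ᶠ j : ℕ, ((-1 : ℂ) ^ j * ((Ring.choose l j : ℤ) : ℂ)) •
        (nprod (m + l - j) a (nprod (n + j) b c) -
          (-1 : ℂ) ^ l • nprod (n + l - j) b (nprod (m + j) a c))
  /-- the Virasoro relations for `L_n = ω₍ₙ₊₁₎` -/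
  virasoro : ∀ (m n : ℤ) (v : V),
    nprod (m + 1) conf (nprod (n + 1) conf v) - nprod (n + 1) conf (nprod (m + 1) conf v) =
      ((m : ℂ) - n) • nprod (m + n + 1) conf v +
        (if m = -n then (charge / 12 * ((m : ℂ) ^ 3 - m)) • v else 0)
  /-- `L_{-1} a = a₍₋₂₎1` -/
  translation : ∀ a, nprod 0 conf a = nprod (-2) a vac
  /-- `V = ⨁ₙ V_n` -/
  decomposition : DirectSum.IsInternal piece
  /-- `L_0 = n` on `V_n` -/
  weight : ∀ (n : ℕ), ∀ a ∈ piece n, nprod 1 conf a = (n : ℂ) • a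
  finiteDimensional : ∀ n, FiniteDimensional ℂ (piece n)

/-! ### Eisenstein series and Weierstrass functions -/

/-- `g_{2k}(τ) = 2 ∑_{n≥1} n^{-2k} + 2 (2πi)^{2k} / (2k-1)! ∑_{n≥1} σ_{2k-1}(n) qⁿ`,
`q = e^{2πiτ}`, for `k ≥ 1`. -/
def eis (k : ℕ) (τ : ℂ) : ℂ :=
  2 * ∑' n : ℕ, 1 / ((n : ℂ) + 1) ^ (2 * k) +
    2 * (2 * Real.pi * Complex.I) ^ (2 * k) / (Nat.factorial (2 * k - 1) : ℂ) *
      ∑' n : ℕ, (ArithmeticFunction.sigma (2 * k - 1) (n + 1) : ℂ) *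
        Complex.exp (2 * Real.pi * Complex.I * τ) ^ (n + 1)

/-- The Weierstrass functions `℘_k(t,τ)`, `k ≥ 1`, of the lattice `ℤ + ℤτ`, as lattice sums:
the meromorphic functions with Laurent expansion
`t⁻ᵏ + (-1)ᵏ ∑_{n≥1} (2n+1 choose k-1) g_{2n+2}(τ) t^{2n+2-k}` at `t = 0`. In particular `℘_1` is the
Weierstrass zeta function and `℘_2` the Weierstrass `℘`-function. -/
def wp (k : ℕ) (t τ : ℂ) : ℂ :=
  match k with
  | 0 => 0
  | 1 => 1 / t + ∑' w : {w : ℤ × ℤ // w ≠ 0},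
      (1 / (t - (w.1.1 + w.1.2 * τ)) + 1 / (w.1.1 + w.1.2 * τ) + t / (w.1.1 + w.1.2 * τ) ^ 2)
  | 2 => 1 / t ^ 2 + ∑' w : {w : ℤ × ℤ // w ≠ 0},
      (1 / (t - (w.1.1 + w.1.2 * τ)) ^ 2 - 1 / (w.1.1 + w.1.2 * τ) ^ 2)
  | k + 3 => ∑' w : ℤ × ℤ, 1 / (t - (w.1 + w.2 * τ)) ^ (k + 3)

/-- `ζ(t,τ) = ℘_1(t,τ) - g_2(τ) t`. -/
def zetaW (t τ : ℂ) : ℂ := wp 1 t τ - eis 1 τ * t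

/-- The normalized functions for `k ≥ 2`: `℘_2 + g_2` for `k = 2`, and `℘_k` for `k ≥ 3`. -/
def wpBar (k : ℕ) (t τ : ℂ) : ℂ := if k = 2 then wp 2 t τ + eis 1 τ else wp k t τ

/-! ### Elliptic functions of several variables -/

/-- Points `(t_1, …, t_m, τ)`. -/
abbrev Pt (m : ℕ) : Type := (Fin m → ℂ) × ℂ

/-- The lattice `ℤ + ℤτ`. -/
def lat (τ : ℂ) : Set ℂ := {z | ∃ a b : ℤ, z = a + b * τ}

/-- Points with `τ` in the upper half plane and `t_i - t_j ∉ ℤ + ℤτ` for `i ≠ j`. -/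
def Conf (m : ℕ) : Set (Pt m) :=
  {P | 0 < P.2.im ∧ ∀ i j, i ≠ j → P.1 i - P.1 j ∉ lat P.2}

/-- `f` has a pole of order at most `N` along each of the divisors `t_i = t_j`: near each point of
`t_i = t_j` which lies on no other component of the polar divisor, `(t_i - t_j)^N f` extends
holomorphically. (Other components `t_i = t_j + a + bτ` are translates of these for elliptic `f`, and
by Hartogs' theorem `f` is then meromorphic also at the intersections of components, which have
codimension two.) -/
def PoleOrderLE {m : ℕ} (f : Pt m → ℂ) (N : ℕ) : Prop :=
  ∀ i j : Fin m, i ≠ j → ∀ P : Pt m, 0 < P.2.im → P.1 i = P.1 j →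
    (∀ k l, k ≠ i → l ≠ i → k ≠ l → P.1 k - P.1 l ∉ lat P.2) →
    ∃ g : Pt m → ℂ, AnalyticAt ℂ g P ∧
      ∀ᶠ Q in 𝓝 P, Q ∈ Conf m → (Q.1 i - Q.1 j) ^ N * f Q = g Q

/-- The space `𝓕_m` of meromorphic functions `f(t_1, …, t_m, τ)` on `ℂᵐ × ℍ`, with periods `1` and
`τ` in each `t_i`, whose poles lie on `t_i - t_j ∈ ℤ + ℤτ`, `i ≠ j`. A function is represented by
its restriction to `Conf m`, where it is holomorphic, extended by zero to all of `Pt m`. -/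
def Ell (m : ℕ) : Submodule ℂ (Pt m → ℂ) where
  carrier := {f | (∀ P, P ∉ Conf m → f P = 0) ∧ (∀ P ∈ Conf m, DifferentiableAt ℂ f P) ∧
    (∀ P : Pt m, 0 < P.2.im → ∀ (i : Fin m) (a b : ℤ),
      f (Function.update P.1 i (P.1 i + a + b * P.2), P.2) = f P) ∧
    ∃ N, PoleOrderLE f N}
  zero_mem' := ⟨fun _ _ => rfl, fun _ _ => differentiableAt_const 0, fun _ _ _ _ _ => rfl,
    0, fun _ _ _ _ _ _ _ => ⟨0, analyticAt_const, by simp⟩⟩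
  add_mem' := by
    rintro f f' ⟨h1, h2, h3, N, h4⟩ ⟨h1', h2', h3', N', h4'⟩
    refine ⟨fun P hP => by simp [h1 P hP, h1' P hP], fun P hP => (h2 P hP).add (h2' P hP),
      fun P hP i a b => by simp [h3 P hP, h3' P hP], N + N', fun i j hij P hP he ho => ?_⟩
    obtain ⟨g, hg, hg1⟩ := h4 i j hij P hP he ho
    obtain ⟨g', hg', hg1'⟩ := h4' i j hij P hP he ho
    have han : AnalyticAt ℂ (fun Q : Pt m => Q.1 i - Q.1 j) P := by
      have : (fun Q : Pt m => Q.1 i - Q.1 j) =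
          ((ContinuousLinearMap.proj (R := ℂ) (φ := fun _ : Fin m => ℂ) i -
            ContinuousLinearMap.proj (R := ℂ) (φ := fun _ : Fin m => ℂ) j).comp
            (ContinuousLinearMap.fst ℂ (Fin m → ℂ) ℂ)) := rfl
      rw [this]
      exact ContinuousLinearMap.analyticAt _ _
    refine ⟨fun Q => (Q.1 i - Q.1 j) ^ N' * g Q + (Q.1 i - Q.1 j) ^ N * g' Q,
      ((han.pow N').mul hg).add ((han.pow N).mul hg'), ?_⟩
    filter_upwards [hg1, hg1'] with Q hQ hQ' hc
    rw [← hQ hc, ← hQ' hc, Pi.add_apply]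
    ring
  smul_mem' := by
    rintro c f ⟨h1, h2, h3, N, h4⟩
    refine ⟨fun P hP => by simp [h1 P hP], fun P hP => (h2 P hP).const_smul c,
      fun P hP i a b => by simp [h3 P hP], N, fun i j hij P hP he ho => ?_⟩
    obtain ⟨g, hg, hg1⟩ := h4 i j hij P hP he ho
    refine ⟨fun Q => c * g Q, analyticAt_const.mul hg, ?_⟩
    filter_upwards [hg1] with Q hQ hc
    rw [← hQ hc, Pi.smul_apply, smul_eq_mul]
    ring

/-- The factor `cτ + d`. -/
def autFactor (γ : Matrix.SpecialLinearGroup (Fin 2) ℤ) (τ : ℂ) : ℂ := γ 1 0 * τ + γ 1 1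

/-- `(t, τ) ↦ (t / (cτ+d), (aτ+b) / (cτ+d))`. -/
def modPt {m : ℕ} (γ : Matrix.SpecialLinearGroup (Fin 2) ℤ) (P : Pt m) : Pt m :=
  (fun i => P.1 i / autFactor γ P.2, (γ 0 0 * P.2 + γ 0 1) / autFactor γ P.2)

/-- `f` is a weak Jacobi form of index `0` and weight `k` in the variables `t_1, …, t_m, τ`, i.e.
`f ∈ 𝕁ᵐ_k`: it is elliptic and modular of weight `k`, and holomorphic at the cusp (for fixed `t`
it is bounded as `Im τ → ∞`; for `m = 1` this is the usual notion of a modular form). -/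
def IsJacobi {m : ℕ} (k : ℕ) (f : Ell m) : Prop :=
  (∀ (γ : Matrix.SpecialLinearGroup (Fin 2) ℤ) (P : Pt m), 0 < P.2.im →
    f.1 (modPt γ P) = autFactor γ P.2 ^ k * f.1 P) ∧
  ∀ t : Fin m → ℂ, (∀ i j, i ≠ j → ∀ a : ℤ, t i - t j ≠ a) →
    BoundedAtFilter (comap Complex.im atTop) (fun τ : ℂ => f.1 (t, τ))

/-! ### Laurent expansions and derivatives -/

/-- The coefficient of `xᵏ` in the Laurent expansion of `φ` at `0`, as an integral over small
circles. -/
def laurentCoeff (φ : ℂ → ℂ) (k : ℤ) : ℂ :=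
  limUnder (𝓝[>] (0 : ℝ)) fun r =>
    (2 * Real.pi * Complex.I)⁻¹ * ∮ x in C(0, r), φ x * x ^ (-k - 1)

theorem laurentCoeff_eq {φ g : ℂ → ℂ} {N : ℕ} (hg : AnalyticAt ℂ g 0)
    (h : ∀ᶠ x in 𝓝[≠] (0 : ℂ), x ^ N * φ x = g x) (k : ℤ) :
    laurentCoeff φ k = if 0 ≤ k + N then
      (Nat.factorial (k + N).toNat : ℂ)⁻¹ * iteratedDeriv (k + N).toNat g 0 else 0 := by
  refine Tendsto.limUnder_eq (tendsto_const_nhds.congr' ?_)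
  rw [eventually_nhdsWithin_iff] at h
  obtain ⟨ε, hε, hb⟩ := Metric.eventually_nhds_iff_ball.1 (hg.eventually_analyticAt.and h)
  filter_upwards [Ioo_mem_nhdsGT hε] with r hr
  have hd : DifferentiableOn ℂ g (Metric.closedBall 0 r) := fun x hx =>
    (hb x (Metric.closedBall_subset_ball hr.2 hx)).1.differentiableAt.differentiableWithinAt
  have hne : ∀ x ∈ Metric.sphere (0 : ℂ) r, x ≠ 0 := by
    rintro x hx rfl
    simp at hx
    exact hr.1.ne hx
  have hφ : ∀ x ∈ Metric.sphere (0 : ℂ) r, φ x * x ^ (-k - 1) = g x * x ^ (-(k + N) - 1) := by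
    intro x hx
    have h0 := hne x hx
    rw [← (hb x (Metric.closedBall_subset_ball hr.2
      (Metric.sphere_subset_closedBall hx))).2 h0, ← zpow_natCast, mul_comm (x ^ (N : ℤ)), mul_assoc,
      ← zpow_add₀ h0]
    congr 2
    ring
  rw [circleIntegral.integral_congr hr.1.le hφ]
  split_ifs with hk
  · obtain ⟨n, hn⟩ := Int.eq_ofNat_of_zero_le hk
    have e : ∀ x : ℂ, g x * x ^ (-(k + N) - 1) = (1 / (x - 0) ^ (n + 1)) • g x := by
      intro x
      rw [hn, sub_zero, smul_eq_mul, mul_comm, one_div, ← zpow_natCast, ← zpow_neg]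
      congr 2
      push_cast
      simp
      ring
    simp only [e]
    rw [hd.circleIntegral_one_div_sub_center_pow_smul hr.1, hn]
    simp only [Int.toNat_natCast, smul_eq_mul]
    have := Complex.two_pi_I_ne_zero
    field_simp
  · obtain ⟨n, hn⟩ := Int.eq_ofNat_of_zero_le (show 0 ≤ -(k + N) - 1 by omega)
    have e : ∀ x : ℂ, g x * x ^ (-(k + N) - 1) = g x * x ^ n := by
      intro x
      rw [hn]
      simp
    simp only [e]
    have h2 : DifferentiableOn ℂ (fun x => g x * x ^ n) (Metric.closedBall 0 r) :=
      hd.mul (by fun_prop)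
    rw [((h2.mono Metric.closure_ball_subset_closedBall).diffContOnCl).circleIntegral_eq_zero hr.1.le,
      mul_zero]

theorem lat_avoid (z : ℂ) {τ : ℂ} (hτ : 0 < τ.im) : ∀ᶠ x in 𝓝[≠] (0 : ℂ), z + x ∉ lat τ := by
  let L : PeriodPair := ⟨1, τ, by
    rw [LinearIndependent.pair_iff]
    intro s t h
    have h1 := congrArg Complex.im h
    have h2 := congrArg Complex.re h
    simp at h1 h2
    rcases h1 with h1 | h1
    · subst h1
      simpa using h2
    · exact absurd h1 hτ.ne'⟩
  have hs : lat τ ⊆ L.lattice := by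
    rintro _ ⟨a, b, rfl⟩
    refine L.mem_lattice.2 ⟨a, b, ?_⟩
    simp [L]
  have h := L.compl_lattice_sdiff_singleton_mem_nhds z
  have hc : Tendsto (fun x : ℂ => z + x) (𝓝 0) (𝓝 z) := by
    have : Continuous fun x : ℂ => z + x := by fun_prop
    simpa using this.tendsto 0
  rw [eventually_nhdsWithin_iff]
  filter_upwards [hc h] with x hx hx0 hm
  refine hx ⟨hs hm, ?_⟩
  simpa using hx0

/-- Insert the coordinate `t_q + x` at the position `p` in `(t, τ)`. -/
def insertAt {m : ℕ} (p : Fin (m + 1)) (q : Fin m) (P : Pt m) (x : ℂ) : Pt (m + 1) :=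
  (p.insertNth (α := fun _ => ℂ) (P.1 q + x) P.1, P.2)

theorem insertAt_mem {m : ℕ} (p : Fin (m + 1)) (q : Fin m) {P : Pt m} (hP : P ∈ Conf m) :
    ∀ᶠ x in 𝓝[≠] (0 : ℂ), insertAt p q P x ∈ Conf (m + 1) := by
  have h1 : ∀ᶠ x in 𝓝[≠] (0 : ℂ), ∀ r, P.1 q - P.1 r + x ∉ lat P.2 :=
    Filter.eventually_all.2 fun r => lat_avoid _ hP.1
  filter_upwards [h1] with x hx
  refine ⟨hP.1, fun i j hij => ?_⟩
  have hsymm : ∀ z, -z ∈ lat P.2 → z ∈ lat P.2 := by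
    rintro z ⟨a, b, h⟩
    refine ⟨-a, -b, ?_⟩
    push_cast
    linear_combination -h
  cases i using p.succAboveCases with
  | x =>
    cases j using p.succAboveCases with
    | x => exact absurd rfl hij
    | p r =>
      simp only [insertAt, Fin.insertNth_apply_same, Fin.insertNth_apply_succAbove]
      have h := hx r
      rwa [sub_add_eq_add_sub] at h
  | p s =>
    cases j using p.succAboveCases with
    | x =>
      simp only [insertAt, Fin.insertNth_apply_same, Fin.insertNth_apply_succAbove]
      intro h
      apply hx s
      apply hsymm
      convert h using 1
      ring
    | p r =>
      simp only [insertAt, Fin.insertNth_apply_succAbove]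
      exact hP.2 s r fun h => hij (by rw [h])

theorem slice_order {m : ℕ} (p : Fin (m + 1)) (q : Fin m) {f : Pt (m + 1) → ℂ} {N : ℕ}
    (hf : PoleOrderLE f N) {P : Pt m} (hP : P ∈ Conf m) :
    ∃ g : ℂ → ℂ, AnalyticAt ℂ g 0 ∧
      ∀ᶠ x in 𝓝[≠] (0 : ℂ), x ^ N * f (insertAt p q P x) = g x := by
  obtain ⟨g, hg, h⟩ := hf p (p.succAbove q) (Fin.succAbove_ne p q).symm (insertAt p q P 0) hP.1
    (by simp [insertAt]) (by
      intro k l hk hl hkl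
      obtain ⟨r, rfl⟩ := Fin.exists_succAbove_eq hk
      obtain ⟨s, rfl⟩ := Fin.exists_succAbove_eq hl
      simp only [insertAt, Fin.insertNth_apply_succAbove]
      exact hP.2 r s fun h => hkl (by rw [h]))
  have ha : AnalyticAt ℂ (insertAt p q P) 0 := by
    refine AnalyticAt.prod ?_ analyticAt_const
    rw [analyticAt_pi_iff]
    intro i
    cases i using p.succAboveCases with
    | x =>
      have : AnalyticAt ℂ (fun x : ℂ => P.1 q + x) 0 := by fun_prop
      simpa using this
    | p r => simpa using analyticAt_const
  refine ⟨fun x => g (insertAt p q P x), hg.comp ha, ?_⟩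
  have h' := (ha.continuousAt.tendsto.eventually h).filter_mono
    (nhdsWithin_le_nhds (s := {0}ᶜ))
  filter_upwards [h', insertAt_mem p q hP] with x hx hx'
  show _ = g (insertAt p q P x)
  rw [← hx hx']
  simp [insertAt]

/-- The map `f ↦ f_k`, where `f = ∑_k f_k (t_p - t_q)^k` is the Laurent expansion of a function of
`m + 1` points at `t_p = t_q`, and `f_k` is a function of the `m` points other than `t_p`. The index
`q : Fin m` is the position of `t_q` among these `m` points. -/
def laurent {m : ℕ} (p : Fin (m + 1)) (q : Fin m) (k : ℤ) : Ell (m + 1) →ₗ[ℂ] (Pt m → ℂ) where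
  toFun f := (Conf m).indicator fun P => laurentCoeff (fun x => f.1 (insertAt p q P x)) k
  map_add' := by
    rintro ⟨f, hf⟩ ⟨f', hf'⟩
    obtain ⟨N, hN⟩ := hf.2.2.2
    obtain ⟨N', hN'⟩ := hf'.2.2.2
    funext P
    by_cases hP : P ∈ Conf m
    · obtain ⟨g, hg, h⟩ := slice_order p q hN hP
      obtain ⟨g', hg', h'⟩ := slice_order p q hN' hP
      have hG : AnalyticAt ℂ (fun x => x ^ N' * g x) 0 := by fun_prop
      have hG' : AnalyticAt ℂ (fun x => x ^ N * g' x) 0 := by fun_prop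
      have e : ∀ᶠ x in 𝓝[≠] (0 : ℂ),
          x ^ (N + N') * f (insertAt p q P x) = x ^ N' * g x := by
        filter_upwards [h] with x hx
        rw [← hx]; ring
      have e' : ∀ᶠ x in 𝓝[≠] (0 : ℂ),
          x ^ (N + N') * f' (insertAt p q P x) = x ^ N * g' x := by
        filter_upwards [h'] with x hx
        rw [← hx]; ring
      have e'' : ∀ᶠ x in 𝓝[≠] (0 : ℂ),
          x ^ (N + N') * (f (insertAt p q P x) + f' (insertAt p q P x)) =
            ((fun x => x ^ N' * g x) + fun x => x ^ N * g' x) x := by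
        filter_upwards [e, e'] with x hx hx'
        rw [Pi.add_apply, ← hx, ← hx']; ring
      simp only [Set.indicator_of_mem hP, Pi.add_apply, Submodule.coe_add]
      rw [laurentCoeff_eq hG e, laurentCoeff_eq hG' e', laurentCoeff_eq (hG.add hG') e'']
      split_ifs
      · rw [iteratedDeriv_add hG.contDiffAt hG'.contDiffAt, mul_add]
      · simp
    · simp [hP]
  map_smul' := by
    rintro c ⟨f, hf⟩
    obtain ⟨N, hN⟩ := hf.2.2.2
    funext P
    by_cases hP : P ∈ Conf m
    · obtain ⟨g, hg, h⟩ := slice_order p q hN hP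
      have e : ∀ᶠ x in 𝓝[≠] (0 : ℂ),
          x ^ N * (c * f (insertAt p q P x)) = (fun x => c * g x) x := by
        filter_upwards [h] with x hx
        rw [← hx]; ring
      simp only [Set.indicator_of_mem hP, Pi.smul_apply, Submodule.coe_smul, smul_eq_mul,
        RingHom.id_apply]
      rw [laurentCoeff_eq hg h, laurentCoeff_eq (g := fun x => c * g x) (by fun_prop) e]
      split_ifs
      · rw [iteratedDeriv_const_mul_field]; ring
      · simp
    · simp [hP]

theorem laurent_eventually_zero {m : ℕ} (p : Fin (m + 1)) (q : Fin m) (f : Ell (m + 1)) :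
    ∃ K : ℤ, ∀ k < K, laurent p q k f = 0 := by
  obtain ⟨N, hN⟩ := f.2.2.2.2
  refine ⟨-N, fun k hk => ?_⟩
  funext P
  by_cases hP : P ∈ Conf m
  · obtain ⟨g, hg, h⟩ := slice_order p q hN hP
    simp only [laurent, LinearMap.coe_mk, AddHom.coe_mk, Set.indicator_of_mem hP, Pi.zero_apply]
    rw [laurentCoeff_eq hg h, if_neg (by omega)]
  · simp [laurent, hP]

/-- `∂/∂t_j`. -/
def pd {m : ℕ} (j : Fin m) : Ell m →ₗ[ℂ] (Pt m → ℂ) where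
  toFun f := (Conf m).indicator fun P => fderiv ℂ f.1 P (Pi.single j 1, 0)
  map_add' f f' := by
    funext P
    by_cases hP : P ∈ Conf m
    · simp [hP, fderiv_add (f.2.2.1 P hP) (f'.2.2.1 P hP)]
    · simp [hP]
  map_smul' c f := by
    funext P
    by_cases hP : P ∈ Conf m
    · simp [hP, fderiv_const_smul (f.2.2.1 P hP)]
    · simp [hP]

/-- `∂/∂τ`. -/
def pdTau {m : ℕ} : Ell m →ₗ[ℂ] (Pt m → ℂ) where
  toFun f := (Conf m).indicator fun P => fderiv ℂ f.1 P (0, 1)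
  map_add' f f' := by
    funext P
    by_cases hP : P ∈ Conf m
    · simp [hP, fderiv_add (f.2.2.1 P hP) (f'.2.2.1 P hP)]
    · simp [hP]
  map_smul' c f := by
    funext P
    by_cases hP : P ∈ Conf m
    · simp [hP, fderiv_const_smul (f.2.2.1 P hP)]
    · simp [hP]

/-- Multiplication by the function `h`. -/
def mulFun {m : ℕ} (h : Pt m → ℂ) : (Pt m → ℂ) →ₗ[ℂ] (Pt m → ℂ) := LinearMap.mulLeft ℂ h

/-- The derivation `2πi ∂/∂τ + ∑ ζ(t_last - t_i) ∂/∂t_i`, the sum being over all points `t_i` other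
than the last point `t_last`. -/
def dTau {m : ℕ} : Ell (m + 1) →ₗ[ℂ] (Pt (m + 1) → ℂ) :=
  (2 * Real.pi * Complex.I : ℂ) • pdTau +
    ∑ i : Fin m, mulFun (fun P => zetaW (P.1 (Fin.last m) - P.1 i.castSucc) P.2) ∘ₗ pd i.castSucc

/-! ### Tensor powers -/

/-- Sum of a locally finite family of linear maps. -/
def locSum {ι P Q : Type*} [AddCommGroup P] [Module ℂ P] [AddCommGroup Q] [Module ℂ Q]
    (A : ι → P →ₗ[ℂ] Q) (hA : ∀ x, (Function.support fun k => A k x).Finite) : P →ₗ[ℂ] Q where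
  toFun x := ∑ᶠ k, A k x
  map_add' x y := by
    simp only [map_add]
    exact finsum_add_distrib (hA x) (hA y)
  map_smul' c x := by
    simp only [map_smul, RingHom.id_apply]
    exact (smul_finsum' c (hA x)).symm

section tensor

variable {V : Type*} [AddCommGroup V] [Module ℂ V]

/-- The operator `φ` acting on the `i`-th tensor factor. -/
def actAt {m : ℕ} (i : Fin m) (φ : V →ₗ[ℂ] V) : (⨂[ℂ]^m V) →ₗ[ℂ] (⨂[ℂ]^m V) :=
  PiTensorProduct.map (Function.update (fun _ => LinearMap.id) i φ)

/-- `x_1 ⊗ … ⊗ x_m ↦ v ⊗ x_1 ⊗ … ⊗ x_m`. -/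
def prepend {m : ℕ} (v : V) : (⨂[ℂ]^m V) →ₗ[ℂ] (⨂[ℂ]^(m + 1) V) :=
  PiTensorProduct.lift ((PiTensorProduct.tprod ℂ (s := fun _ : Fin (m + 1) => V)).curryLeft v)

/-- The contraction `V^{⊗(m+1)} → V^{⊗m}` which removes the `p`-th factor `a` and replaces the factor
`b` at position `q` among the remaining ones by `a₍ₖ₎b`. -/
def contract {m : ℕ} (Y : ConformalVertexAlgebra V) (p : Fin (m + 1)) (q : Fin m) (k : ℤ) :
    (⨂[ℂ]^(m + 1) V) →ₗ[ℂ] (⨂[ℂ]^m V) :=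
  PiTensorProduct.lift
    (MultilinearMap.mk' (fun a : Fin (m + 1) → V => PiTensorProduct.tprod ℂ
        (Function.update (fun r => a (p.succAbove r)) q
          (Y.nprod k (a p) (a (p.succAbove q)))))
      (by
        intro a i x y
        cases i using p.succAboveCases with
        | x => simp
        | p r =>
          have key : ∀ z, (fun s => Function.update a (p.succAbove r) z (p.succAbove s)) =
              Function.update (fun s => a (p.succAbove s)) r z := by
            intro z
            funext s
            by_cases hs : s = r
            · subst hs; simp
            · simp [hs]
          simp only [key, Function.update_of_ne (Fin.succAbove_ne p r).symm]
          by_cases hr : q = r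
          · subst hr; simp
          · have hr' : p.succAbove q ≠ p.succAbove r :=
              fun h => hr (Fin.succAbove_right_injective h)
            simp only [Function.update_of_ne hr', Function.update_comm (Ne.symm hr)]
            simp)
      (by
        intro a i c x
        cases i using p.succAboveCases with
        | x => simp
        | p r =>
          have key : ∀ z, (fun s => Function.update a (p.succAbove r) z (p.succAbove s)) =
              Function.update (fun s => a (p.succAbove s)) r z := by
            intro z
            funext s
            by_cases hs : s = r
            · subst hs; simp
            · simp [hs]
          simp only [key, Function.update_of_ne (Fin.succAbove_ne p r).symm]
          by_cases hr : q = r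
          · subst hr; simp
          · have hr' : p.succAbove q ≠ p.succAbove r :=
              fun h => hr (Fin.succAbove_right_injective h)
            simp only [Function.update_of_ne hr', Function.update_comm (Ne.symm hr)]
            simp))

theorem contract_tprod {m : ℕ} (Y : ConformalVertexAlgebra V) (p : Fin (m + 1)) (q : Fin m) (k : ℤ)
    (a : Fin (m + 1) → V) :
    contract Y p q k (PiTensorProduct.tprod ℂ a) = PiTensorProduct.tprod ℂ
      (Function.update (fun r => a (p.succAbove r)) q (Y.nprod k (a p) (a (p.succAbove q)))) := by
  simp [contract]

theorem contract_eventually_zero {m : ℕ} (Y : ConformalVertexAlgebra V) (p : Fin (m + 1))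
    (q : Fin m) (x : ⨂[ℂ]^(m + 1) V) : ∃ K : ℤ, ∀ k, K ≤ k → contract Y p q k x = 0 := by
  induction x using PiTensorProduct.induction_on with
  | smul_tprod r a =>
    obtain ⟨K, hK⟩ := Y.truncation (a p) (a (p.succAbove q))
    refine ⟨K, fun k hk => ?_⟩
    rw [map_smul, contract_tprod, hK k hk,
      MultilinearMap.map_coord_zero _ q (by simp), smul_zero]
  | add x y hx hy =>
    obtain ⟨K, hK⟩ := hx
    obtain ⟨L, hL⟩ := hy
    exact ⟨max K L, fun k hk => by
      rw [map_add, hK k (le_of_max_le_left hk), hL k (le_of_max_le_right hk), add_zero]⟩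

theorem actAt_eventually_zero {m : ℕ} (Y : ConformalVertexAlgebra V) (i : Fin m) (v : V)
    (x : ⨂[ℂ]^m V) : ∃ K : ℤ, ∀ k, K ≤ k → actAt i (Y.nprod k v) x = 0 := by
  induction x using PiTensorProduct.induction_on with
  | smul_tprod r a =>
    obtain ⟨K, hK⟩ := Y.truncation v (a i)
    refine ⟨K, fun k hk => ?_⟩
    rw [map_smul, actAt, PiTensorProduct.map_tprod,
      MultilinearMap.map_coord_zero _ i (by simp [hK k hk]), smul_zero]
  | add x y hx hy =>
    obtain ⟨K, hK⟩ := hx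
    obtain ⟨L, hL⟩ := hy
    exact ⟨max K L, fun k hk => by
      rw [map_add, hK k (le_of_max_le_left hk), hL k (le_of_max_le_right hk), add_zero]⟩

theorem support_finite_of_tmul {ι X M X' M' : Type*} [AddCommGroup X] [Module ℂ X]
    [AddCommGroup M] [Module ℂ M] [AddCommGroup X'] [Module ℂ X'] [AddCommGroup M'] [Module ℂ M']
    (A : ι → X ⊗[ℂ] M →ₗ[ℂ] X' ⊗[ℂ] M')
    (h : ∀ x f, (Function.support fun k => A k (x ⊗ₜ f)).Finite) (z : X ⊗[ℂ] M) :
    (Function.support fun k => A k z).Finite := by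
  induction z using TensorProduct.induction_on with
  | zero => simp
  | tmul x f => exact h x f
  | add x y hx hy =>
    refine (hx.union hy).subset fun k hk => ?_
    by_contra hc
    simp only [Set.mem_union, Function.mem_support, not_or, not_not] at hc
    exact hk (by simp only [map_add, hc.1, hc.2, add_zero])

variable (V) in
/-- `V^{⊗m} ⊗ 𝓕_m`. -/
abbrev Chain (m : ℕ) : Type _ := (⨂[ℂ]^m V) ⊗[ℂ] Ell m

variable (V) in
/-- `V^{⊗m} ⊗ {functions of (t_1, …, t_m, τ)}`, which contains `V^{⊗m} ⊗ 𝓕_m`. -/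
abbrev Amb (m : ℕ) : Type _ := (⨂[ℂ]^m V) ⊗[ℂ] (Pt m → ℂ)

/-- The inclusion of `V^{⊗m} ⊗ 𝓕_m` into `V^{⊗m} ⊗ {functions}`. -/
def incl {m : ℕ} : Chain V m →ₗ[ℂ] Amb V m := LinearMap.lTensor _ (Ell m).subtype

/-- The operation `∑_k a₍ₖ₎ f_{k-s}`: for `x = a_0 ⊗ … ⊗ a_m ⊗ f` and the Laurent expansion
`f = ∑_k f_k (t_p - t_q)^k`, the element `∑_k (… (a_p)₍ₖ₎ a_q …) ⊗ f_{k-s}`, in which the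
factor `a_p` and the variable `t_p` have been removed. Here `q : Fin m` is the position among the
remaining factors and variables. -/
def resid {m : ℕ} (Y : ConformalVertexAlgebra V) (p : Fin (m + 1)) (q : Fin m) (s : ℤ) :
    Chain V (m + 1) →ₗ[ℂ] Amb V m :=
  locSum (fun k : ℤ => TensorProduct.map (contract Y p q k) (laurent p q (k - s)))
    (support_finite_of_tmul _ fun x f => by
      obtain ⟨K, hK⟩ := contract_eventually_zero Y p q x
      obtain ⟨L, hL⟩ := laurent_eventually_zero p q f
      refine (Set.finite_Ico (L + s) K).subset fun k hk => ?_
      rw [Function.mem_support, TensorProduct.map_tmul] at hk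
      constructor
      · by_contra hc
        exact hk (by rw [hL _ (by omega), TensorProduct.tmul_zero])
      · by_contra hc
        exact hk (by rw [hK _ (by omega), TensorProduct.zero_tmul]))

/-- The operator `∑_{k ≥ 0} v₍ₑ₎ ⊗ h_k`, `e = e(k)`, where the mode `v₍ₑ₎` acts on the `i`-th tensor
factor and `h_k` by multiplication. -/
def modeSum {m : ℕ} (Y : ConformalVertexAlgebra V) (v : V) (i : Fin m) (e : ℕ → ℕ)
    (he : StrictMono e) (h : ℕ → Pt m → ℂ) : Chain V m →ₗ[ℂ] Amb V m :=
  locSum (fun k : ℕ => TensorProduct.map (actAt i (Y.nprod (e k) v)) (mulFun (h k) ∘ₗ (Ell m).subtype))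
    (support_finite_of_tmul _ fun x f => by
      obtain ⟨K, hK⟩ := actAt_eventually_zero Y i v x
      refine (Set.finite_Iio K.toNat).subset fun k hk => ?_
      rw [Function.mem_support, TensorProduct.map_tmul] at hk
      by_contra hc
      have := he.le_apply (x := k)
      exact hk (by rw [hK _ (by simp at hc; omega), TensorProduct.zero_tmul]))

theorem resid_eventually_zero {m : ℕ} (Y : ConformalVertexAlgebra V) (p : Fin (m + 1)) (q : Fin m)
    (z : Chain V (m + 1)) : ∃ M : ℤ, ∀ s, M ≤ s → resid Y p q s z = 0 := by
  induction z using TensorProduct.induction_on with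
  | zero => exact ⟨0, fun _ _ => map_zero _⟩
  | tmul x f =>
    obtain ⟨K, hK⟩ := contract_eventually_zero Y p q x
    obtain ⟨L, hL⟩ := laurent_eventually_zero p q f
    refine ⟨K - L + 1, fun s hs => ?_⟩
    refine finsum_eq_zero_of_forall_eq_zero fun k => ?_
    rw [TensorProduct.map_tmul]
    by_cases hk : K ≤ k
    · rw [hK k hk, TensorProduct.zero_tmul]
    · rw [hL (k - s) (by omega), TensorProduct.tmul_zero]
  | add x y hx hy =>
    obtain ⟨K, hK⟩ := hx
    obtain ⟨L, hL⟩ := hy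
    exact ⟨max K L, fun k hk => by
      rw [map_add, hK k (le_of_max_le_left hk), hL k (le_of_max_le_right hk), add_zero]⟩

theorem incl_injective {m : ℕ} : Function.Injective (incl : Chain V m →ₗ[ℂ] Amb V m) :=
  Module.Flat.lTensor_preserves_injective_linearMap _ (Submodule.injective_subtype _)

/-! ### The chiral complex

For `n` marked points, chains of degree `1` are represented by elements
`a_0 ⊗ a_1 ⊗ … ⊗ a_n ⊗ f(t_0, …, t_n, τ)` of `V^{⊗(n+1)} ⊗ 𝕁^{n+1}_*`, and those of degree `2` by
elements `a ⊗ b ⊗ a_1 ⊗ … ⊗ a_n ⊗ f(u, v, t_1, …, t_n, τ)` of `V^{⊗(n+2)} ⊗ 𝕁^{n+2}_*`. -/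

variable (V) in
/-- `V^{⊗m} ⊗ 𝕁ᵐ_*`, where `𝕁ᵐ_* = ⨁_{k ≥ 0} 𝕁ᵐ_k`. -/
def JChain (m : ℕ) : Submodule ℂ (Chain V m) :=
  Submodule.span ℂ {z | ∃ (x : ⨂[ℂ]^m V) (f : Ell m) (k : ℕ), IsJacobi k f ∧ z = x ⊗ₜ f}

/-- The elements of conformal degree `p` in `V^{⊗m} ⊗ 𝕁ᵐ_*`: the span of `a_1 ⊗ … ⊗ a_m ⊗ f` with
`a_i ∈ V_{Δ_i}`, `f ∈ 𝕁ᵐ_k` and `k + ∑ Δ_i = p`. -/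
def JChainDeg (Y : ConformalVertexAlgebra V) (m p : ℕ) : Submodule ℂ (Chain V m) :=
  Submodule.span ℂ {z | ∃ (a : Fin m → V) (Δ : Fin m → ℕ) (f : Ell m) (k : ℕ),
    (∀ i, a i ∈ Y.piece (Δ i)) ∧ IsJacobi k f ∧ k + ∑ i, Δ i = p ∧
      z = PiTensorProduct.tprod ℂ a ⊗ₜ f}

/-- `d_1 (a_0 ⊗ … ⊗ a_n ⊗ f) = ∑_i ∑_k a_1 ⊗ … ⊗ a_{0(k)}a_i ⊗ … ⊗ a_n ⊗ f_{ik}`, where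
`f = ∑_k f_{ik} (t_0 - t_i)^k`. -/
def d1 (Y : ConformalVertexAlgebra V) (n : ℕ) : Chain V (n + 1) →ₗ[ℂ] Amb V n :=
  ∑ i : Fin n, resid Y 0 i 0

/-- `d_2 (a ⊗ b ⊗ a_1 ⊗ … ⊗ a_n ⊗ f)` is
`∑_i ∑_k a ⊗ … b₍ₖ₎a_i … ⊗ f_{1ik} - ∑_i ∑_k b ⊗ … a₍ₖ₎a_i … ⊗ f_{0ik} - ∑_k a₍ₖ₎b ⊗ … ⊗ f_{00k}`,
where `f_{1ik}`, `f_{0ik}` and `f_{00k}` are the coefficients of `(v - t_i)^k`, `(u - t_i)^k` and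
`(u - v)^k`. (The last two sums are over the factors following `a`.) -/
def d2 (Y : ConformalVertexAlgebra V) (n : ℕ) : Chain V (n + 2) →ₗ[ℂ] Amb V (n + 1) :=
  ∑ i : Fin n, resid Y 1 i.succ 0 - ∑ q : Fin (n + 1), resid Y 0 q 0

/-- `L_{-1}^{(j)} + ∂/∂t_j`. -/
def transl (Y : ConformalVertexAlgebra V) {m : ℕ} (j : Fin m) : Chain V m →ₗ[ℂ] Amb V m :=
  TensorProduct.map (actAt j (Y.nprod 0 Y.conf)) (Ell m).subtype + LinearMap.lTensor _ (pd j)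

/-- Representatives in `V^{⊗(n+1)} ⊗ 𝕁^{n+1}_*` of the cycles of degree `1`. The space of cycles
itself is the quotient by the image of `L_{-1}^{(0)} + ∂/∂t_0`. -/
def Cyc (Y : ConformalVertexAlgebra V) (n : ℕ) : Submodule ℂ (Chain V (n + 1)) :=
  JChain V (n + 1) ⊓ LinearMap.ker (d1 Y n)

/-- Multiplication by a function of `(t_1, …, t_n, τ)` on `V^{⊗(n+1)} ⊗ {functions of
(t_0, …, t_n, τ)}`. -/
def mulTail {n : ℕ} (φ : Pt n → ℂ) : Amb V (n + 1) →ₗ[ℂ] Amb V (n + 1) :=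
  LinearMap.lTensor _ (mulFun fun P => φ (Fin.tail P.1, P.2))

/-- The connection `∇_τ` on chains `a_0 ⊗ … ⊗ a_n ⊗ f` of degree `1`, where `n = m + 1`: the sum of
* `a_0 ⊗ … ⊗ a_n ⊗ D f`;
* `a_0 ⊗ … ⊗ ω₍₋₁₎a_n ⊗ f - ∑_{k ≥ 1} a_0 ⊗ … ⊗ ω₍₂ₖ₋₁₎a_n ⊗ g_{2k}(τ) f`;
* `a_0 ⊗ … ⊗ a_n ⊗ (℘_2(t_n - t_0) + g_2(τ)) f`;
* `- ∑_{i=0}^{n-1} ∑_{k ≥ 0} a_0 ⊗ … ω₍ₖ₊₁₎a_i … ⊗ a_n ⊗ wpBar_{k+2}(t_n - t_i) f`;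
* `- ω ⊗ d_1(a_0 ⊗ … ⊗ a_n ⊗ f) ζ(t_0 - t_n)`, which vanishes on cycles. -/
def nabla (Y : ConformalVertexAlgebra V) (m : ℕ) : Chain V (m + 2) →ₗ[ℂ] Amb V (m + 2) :=
  LinearMap.lTensor _ dTau +
  TensorProduct.map (actAt (Fin.last (m + 1)) (Y.nprod (-1) Y.conf)) (Ell (m + 2)).subtype -
  modeSum Y Y.conf (Fin.last (m + 1)) (fun k => 2 * k + 1) (fun _ _ h => by simpa using h)
    (fun k P => eis (k + 1) P.2) +
  LinearMap.lTensor _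
    (mulFun (fun P => wpBar 2 (P.1 (Fin.last (m + 1)) - P.1 0) P.2) ∘ₗ (Ell (m + 2)).subtype) -
  ∑ i : Fin (m + 1), modeSum Y Y.conf i.castSucc (fun k => k + 1) (fun _ _ h => by simpa using h)
    (fun k P => wpBar (k + 2) (P.1 (Fin.last (m + 1)) - P.1 i.castSucc) P.2) -
  TensorProduct.map (prepend Y.conf)
    (mulFun (fun P : Pt (m + 2) => zetaW (P.1 0 - P.1 (Fin.last (m + 1))) P.2) ∘ₗ
      LinearMap.funLeft ℂ ℂ (fun P : Pt (m + 2) => ((Fin.tail P.1, P.2) : Pt (m + 1)))) ∘ₗ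
    d1 Y (m + 1)

/-- The permutation of `0, 1, …, n` which fixes `0` and permutes `1, …, n` by `σ`. -/
def fixZero {n : ℕ} (σ : Equiv.Perm (Fin n)) : Equiv.Perm (Fin (n + 1)) where
  toFun := Fin.cases 0 fun i => (σ i).succ
  invFun := Fin.cases 0 fun i => (σ.symm i).succ
  left_inv i := by cases i using Fin.cases <;> simp
  right_inv i := by cases i using Fin.cases <;> simp

/-- The action of a permutation `σ` of the `n` marked points: it takes `a_0 ⊗ a_1 ⊗ … ⊗ a_n ⊗ f` to
`a_0 ⊗ a_{σ(1)} ⊗ … ⊗ a_{σ(n)} ⊗ g`, where `g(t_0, t_{σ(1)}, …, t_{σ(n)}) = f(t_0, t_1, …, t_n)`. -/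
def permChain {n : ℕ} (σ : Equiv.Perm (Fin n)) : Chain V (n + 1) →ₗ[ℂ] Amb V (n + 1) :=
  TensorProduct.map
    (PiTensorProduct.reindex ℂ (fun _ : Fin (n + 1) => V) (fixZero σ).symm).toLinearMap
    (LinearMap.funLeft ℂ ℂ
      (fun P : Pt (n + 1) => ((fun i => P.1 ((fixZero σ).symm i), P.2) : Pt (n + 1))) ∘ₗ
      (Ell (n + 1)).subtype)

theorem permChain_tmul {n : ℕ} (σ : Equiv.Perm (Fin n)) (a : Fin (n + 1) → V) (f : Ell (n + 1)) :
    permChain σ (PiTensorProduct.tprod ℂ a ⊗ₜ f) =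
      PiTensorProduct.tprod ℂ (fun i => a (fixZero σ i)) ⊗ₜ
        fun P : Pt (n + 1) => f.1 (fun i => P.1 ((fixZero σ).symm i), P.2) := by
  simp only [permChain, TensorProduct.map_tmul]
  erw [PiTensorProduct.reindex_tprod]
  rfl

/-! ### Conformal blocks of degree one -/

/-- Systems of linear maps `S^n` from (representatives of) cycles of degree `1` to `𝓕_n`, for all
`n ≥ 1`; here `S m` is the map `S^n` with `n = m + 1`. -/
abbrev Family (Y : ConformalVertexAlgebra V) : Type _ :=
  ∀ m : ℕ, Cyc Y (m + 1) →ₗ[ℂ] Ell (m + 1)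

/-- The genus-one property of a system `S`. -/
structure GenusOne (Y : ConformalVertexAlgebra V) (S : Family Y) : Prop where
  /-- `S^n` is linear over `𝕁ⁿ_*`. -/
  jacobiLinear : ∀ (m k : ℕ) (φ : Ell (m + 1)), IsJacobi k φ → ∀ z w : Cyc Y (m + 1),
    incl w.1 = mulTail φ.1 (incl z.1) → (S m w).1 = mulFun φ.1 (S m z).1
  /-- `S^n` descends to the quotient by the elements `(L_{-1}^{(0)} + ∂/∂t_0)(a_0 ⊗ … ⊗ a_n ⊗ f)`. -/
  relation : ∀ m, ∀ y ∈ JChain V (m + 2), ∀ z : Cyc Y (m + 1),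
    incl z.1 = transl Y 0 y → S m z = 0
  /-- `S^n` vanishes on boundaries. -/
  boundary : ∀ m, ∀ y ∈ JChain V (m + 3), ∀ z : Cyc Y (m + 1),
    incl z.1 = d2 Y (m + 1) y → S m z = 0
  /-- `S^n` is flat with respect to moving the marked points `t_1, …, t_n`. -/
  flatPoints : ∀ m (j : Fin (m + 1)) (z w : Cyc Y (m + 1)),
    incl w.1 = transl Y j.succ z.1 → pd j (S m z) = (S m w).1
  /-- `S^n` is flat with respect to `∇_τ`: `D_τ S(z) = S(∇_τ z)`. Here `∇_τ z` is a combination of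
  cycles whose coefficients are polynomials in `g_2`, and `S` is extended to these linearly over
  `ℂ[g_2]`. -/
  flatTau : ∀ m (z : Cyc Y (m + 1)) (w : ℕ →₀ Cyc Y (m + 1)),
    nabla Y m z.1 = (w.sum fun j y =>
      LinearMap.lTensor _ (mulFun fun P : Pt (m + 2) => eis 1 P.2 ^ j) (incl y.1)) →
    dTau (S m z) = w.sum fun j y => mulFun (fun P => eis 1 P.2 ^ j) (S m y).1
  /-- `S^n(1, a_1, …, a_n, f) = 0`. -/
  vacuum : ∀ m (a : Fin (m + 1) → V) (f : Ell (m + 2)) (k : ℕ), IsJacobi k f →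
    ∀ z : Cyc Y (m + 1),
      z.1 = PiTensorProduct.tprod ℂ (Fin.cons Y.vac a : Fin (m + 2) → V) ⊗ₜ f → S m z = 0
  /-- `S^n(σ(z); t_{σ(1)}, …, t_{σ(n)}) = S^n(z; t_1, …, t_n)`. -/
  symmetry : ∀ m (σ : Equiv.Perm (Fin (m + 1))) (z w : Cyc Y (m + 1)), incl w.1 = permChain σ z.1 →
    ∀ P : Pt (m + 1), (S m w).1 (fun i => P.1 (σ i), P.2) = (S m z).1 P
  /-- The insertion formula, for a cycle `z = a_0 ⊗ b ⊗ a_1 ⊗ … ⊗ a_n ⊗ f(u, v, t_1, …, t_n, τ)`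
  (or a sum of such) for `n + 1` points. Here `c i s` is the cycle
  `∑_k a_0 ⊗ a_1 ⊗ … b₍ₖ₎a_i … ⊗ a_n ⊗ f_{1i,k-s}`, and `f_{1ik}` is the coefficient of
  `(v - t_i)^k`. -/
  insertion : ∀ m (z : Cyc Y (m + 2)) (c : Fin (m + 1) → ℤ → Cyc Y (m + 1)),
    (∀ i s, incl (c i s).1 = resid Y 1 i.succ s z.1) →
    ∀ (v : ℂ) (P : Pt (m + 1)), ((Fin.cons v P.1 : Fin (m + 2) → ℂ), P.2) ∈ Conf (m + 2) →
      (S (m + 1) z).1 (Fin.cons v P.1, P.2) =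
        ∑ i : Fin (m + 1), (S m (c i 0)).1 P * zetaW (v - P.1 i) P.2 +
        ∑ i : Fin (m + 1), (S m (c i 1)).1 P * (wp 2 (v - P.1 i) P.2 + eis 1 P.2) +
        ∑ i : Fin (m + 1), ∑ᶠ r : ℕ, (S m (c i (r + 2))).1 P * wp (r + 3) (v - P.1 i) P.2 -
        ∑ i : Fin m, (S m (c i.castSucc 0)).1 P *
          zetaW (P.1 (Fin.last m) - P.1 i.castSucc) P.2 -
        ∑ i : Fin m, (S m (c i.castSucc 1)).1 P *
          (wp 2 (P.1 (Fin.last m) - P.1 i.castSucc) P.2 + eis 1 P.2) -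
        ∑ i : Fin m, ∑ᶠ r : ℕ, (S m (c i.castSucc (r + 2))).1 P *
          wp (r + 3) (P.1 (Fin.last m) - P.1 i.castSucc) P.2 +
        (S m (c (Fin.last m) (-1))).1 P -
        ∑ᶠ r : ℕ, (S m (c (Fin.last m) (2 * r + 1))).1 P * eis (r + 1) P.2

theorem insertion_support {Y : ConformalVertexAlgebra V} {m : ℕ} {z : Cyc Y (m + 2)}
    {c : Fin (m + 1) → ℤ → Cyc Y (m + 1)}
    (h : ∀ i s, incl (c i s).1 = resid Y 1 i.succ s z.1) (i : Fin (m + 1)) (e : ℕ → ℤ)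
    (he : ∀ r : ℕ, (r : ℤ) ≤ e r) (S : Family Y) (P : Pt (m + 1)) (w : ℕ → ℂ) :
    (Function.support fun r : ℕ => (S m (c i (e r))).1 P * w r).Finite := by
  obtain ⟨M, hM⟩ := resid_eventually_zero Y 1 i.succ z.1
  refine (Set.finite_Iio M.toNat).subset fun r hr => ?_
  by_contra hc
  simp only [Set.mem_Iio, not_lt] at hc
  refine hr ?_
  have h0 : c i (e r) = 0 := by
    apply Subtype.ext
    apply incl_injective
    have := he r
    rw [h, hM _ (by omega)]
    simp
  simp [h0]

/-- The space of degree `1` conformal blocks on the torus: the linear space of all systems with the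
genus-one property. -/
def conformalBlocks (Y : ConformalVertexAlgebra V) : Submodule ℂ (Family Y) where
  carrier := {S | GenusOne Y S}
  zero_mem' := by
    constructor <;> intros <;> simp [Finsupp.sum]
  add_mem' := by
    intro S S' h h'
    constructor
    case jacobiLinear =>
      intro m k φ hφ z w e
      have := h.jacobiLinear m k φ hφ z w e
      have := h'.jacobiLinear m k φ hφ z w e
      simp_all
    case relation =>
      intro m y hy z e
      simp [h.relation m y hy z e, h'.relation m y hy z e]
    case boundary =>
      intro m y hy z e
      simp [h.boundary m y hy z e, h'.boundary m y hy z e]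
    case flatPoints =>
      intro m j z w e
      simp [h.flatPoints m j z w e, h'.flatPoints m j z w e]
    case flatTau =>
      intro m z w e
      simp [h.flatTau m z w e, h'.flatTau m z w e, Finsupp.sum, Finset.sum_add_distrib]
    case vacuum =>
      intro m a f k hf z e
      simp [h.vacuum m a f k hf z e, h'.vacuum m a f k hf z e]
    case symmetry =>
      intro m σ z w e P
      simp [h.symmetry m σ z w e P, h'.symmetry m σ z w e P]
    case insertion =>
      intro m z c e v P hP
      have h1 := h.insertion m z c e v P hP
      have h2 := h'.insertion m z c e v P hP
      have f1 : ∀ (i : Fin (m + 1)) (w : ℕ → ℂ),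
          ∑ᶠ r : ℕ, ((S m (c i (r + 2))).1 P + (S' m (c i (r + 2))).1 P) * w r =
          ∑ᶠ r : ℕ, (S m (c i (r + 2))).1 P * w r +
            ∑ᶠ r : ℕ, (S' m (c i (r + 2))).1 P * w r := by
        intro i w
        simp only [add_mul]
        exact finsum_add_distrib (insertion_support e i (fun r => r + 2) (by intro; omega) S P w)
          (insertion_support e i (fun r => r + 2) (by intro; omega) S' P w)
      have f2 : ∀ (i : Fin (m + 1)) (w : ℕ → ℂ),
          ∑ᶠ r : ℕ, ((S m (c i (2 * r + 1))).1 P + (S' m (c i (2 * r + 1))).1 P) * w r =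
          ∑ᶠ r : ℕ, (S m (c i (2 * r + 1))).1 P * w r +
            ∑ᶠ r : ℕ, (S' m (c i (2 * r + 1))).1 P * w r := by
        intro i w
        simp only [add_mul]
        exact finsum_add_distrib
          (insertion_support e i (fun r => 2 * r + 1) (by intro; omega) S P w)
          (insertion_support e i (fun r => 2 * r + 1) (by intro; omega) S' P w)
      simp only [Pi.add_apply, LinearMap.add_apply, Submodule.coe_add, h1, h2, f1, f2]
      simp only [add_mul, Finset.sum_add_distrib]
      ring
  smul_mem' := by
    intro b S h
    constructor
    case jacobiLinear =>
      intro m k φ hφ z w e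
      have := h.jacobiLinear m k φ hφ z w e
      simp_all
    case relation =>
      intro m y hy z e
      simp [h.relation m y hy z e]
    case boundary =>
      intro m y hy z e
      simp [h.boundary m y hy z e]
    case flatPoints =>
      intro m j z w e
      simp [h.flatPoints m j z w e]
    case flatTau =>
      intro m z w e
      simp [h.flatTau m z w e, Finsupp.sum, Finset.smul_sum]
    case vacuum =>
      intro m a f k hf z e
      simp [h.vacuum m a f k hf z e]
    case symmetry =>
      intro m σ z w e P
      simp [h.symmetry m σ z w e P]
    case insertion =>
      intro m z c e v P hP
      have h1 := h.insertion m z c e v P hP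
      simp only [Pi.smul_apply, LinearMap.smul_apply, Submodule.coe_smul, smul_eq_mul, h1,
        mul_assoc, ← Finset.mul_sum, ← mul_finsum]
      ring

/-- `S' = γ(S)` for `γ = (a b; c d)`: on cycles `z` of conformal degree `p`,
`S'(z; t, τ) = (cτ+d)^{1-p} S(z; t/(cτ+d), (aτ+b)/(cτ+d))`. -/
def IsTransform (Y : ConformalVertexAlgebra V) (γ : Matrix.SpecialLinearGroup (Fin 2) ℤ)
    (S S' : Family Y) : Prop :=
  ∀ (m p : ℕ) (z : Cyc Y (m + 1)), z.1 ∈ JChainDeg Y (m + 2) p → ∀ P : Pt (m + 1), 0 < P.2.im →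
    (S' m z).1 P = autFactor γ P.2 ^ (1 - (p : ℤ)) * (S m z).1 (modPt γ P)

end tensor

end ChiralTorus

end

open ChiralTorus

/-!
Conformal degree is built so that each structure map of the theory is covariant for `SL(2,ℤ)`. A
pure tensor `a_1 ⊗ … ⊗ a_m ⊗ f` with `a_i` of `L_0`-weight `Δ_i` and `f` modular of weight `k` has
degree `k + ∑ Δ_i`. The product `a₍ₗ₎b` lowers the weight by `l + 1`, a Laurent coefficient `f_l`
has weight `k + l`, a derivative in `t_i` raises the weight by `1`, and `℘_k`, `g_{2k}` (`k ≥ 2`)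
have weight `k`, `2k`. Hence the coefficients of the genus-one identities shift the degree by a
constant, apart from the anomalies of `g_2` and `ζ`, and each identity for `S` evaluated at
`(t / (cτ+d), (aτ+b) / (cτ+d))` is, after multiplication by the right power of `cτ+d`, the same
identity for the transformed system. Two points need an argument.

**Reduction to homogeneous components.** A cycle is a sum of homogeneous elements, and a relation
such as `∇_τ z = ∑_l g_2^l w_l` has to be split into degrees. It must not happen that components of
different degrees cancel, also not with coefficients that are polynomials in `g_2`. An element
of degree `p` satisfies a transformation law with the factor `(cτ+d)^p`
(`scale_evalAt_modPt`), and over a fixed `τ`, as the matrix varies, the products of the functions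
`(cτ+d)^p` with the powers of `g_2(γτ) = (cτ+d)^2 g_2(τ) - 2πi c (cτ+d)` are linearly independent
(`coeff_eq_zero_of_modular`, `eq_zero_of_sum_eis`). It follows that the degrees are independent
(`ambDeg_iSupIndep`), that homogeneous components of cycles are cycles
(`exists_cycle_decomposition`), that `σ(S)` exists and is unique, and that the equation above forces
`w_1 = -(p - 1) z` for `z` of degree `p`, and `w_l = 0` for `l ≥ 2` (`nabla_components`).

**Cancellation of the anomalies.** The function `ζ(t,τ)` acquires the term `2πi c t` and `g_2(τ)` the
term `-2πi c (cτ+d)`.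
* Applied to `f(t / (cτ+d), (aτ+b) / (cτ+d))`, the operator `D_τ` differs from its transform by the
  anomalies of `ζ(t_n - t_i)`, which contribute `-2πi c ∑_i (t_n - t_i) ∂_{t_i}`, and by
  `-2πi c ∑_i t_i ∂_{t_i}`, which the chain rule produces. The sum vanishes because `∑_i ∂_{t_i}`
  annihilates elliptic functions: these are invariant under simultaneous translation by Liouville's
  theorem (`ell_translate`, `dTau_slash`). What remains is the derivative of the factor
  `(cτ+d)^{1-p}`, which is compensated by the anomaly of the term `-(p - 1) g_2 z` of `∇_τ z`
  (`GenusOne.transform_flatTau`).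
* In the insertion formula the anomalies of `g_2` cancel, and those of `ζ` add up to
  `2πi c (v - t_n) ∑_i S(c_{i,0})`. On a cycle `∑_i c_{i,0}` is a boundary, so this sum vanishes
  (`GenusOne.sum_insertion_eq_zero`, `insertionSum_modular`).

The modularity of the functions `℘_k` is a rearrangement of lattice sums. That of `g_2` and of
`g_{2k}` comes from the transformation laws of the Eisenstein series in Mathlib.
-/

noncomputable section

namespace ChiralTorus

local notation "SL2Z" => Matrix.SpecialLinearGroup (Fin 2) ℤ

/-! ### The action of the modular group -/

theorem det_cast (γ : SL2Z) : (γ 0 0 : ℂ) * γ 1 1 - γ 0 1 * γ 1 0 = 1 := by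
  have h := γ.det_coe
  rw [Matrix.det_fin_two] at h
  exact_mod_cast h

theorem autFactor_ne_zero (γ : SL2Z) {τ : ℂ} (hτ : 0 < τ.im) : autFactor γ τ ≠ 0 := by
  intro h
  have h1 := congrArg Complex.im h
  have h2 := congrArg Complex.re h
  simp [autFactor, hτ.ne'] at h1 h2
  have := det_cast γ
  rw [h1] at h2 this
  simp at h2
  simp [h2] at this

theorem autFactor_eq_denom (γ : SL2Z) (z : UpperHalfPlane) :
    autFactor γ z = UpperHalfPlane.denom γ z := by
  rw [ModularGroup.denom_apply]
  rfl

theorem coe_smul_eq (γ : SL2Z) (z : UpperHalfPlane) :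
    ((γ • z : UpperHalfPlane) : ℂ) = (γ 0 0 * z + γ 0 1) / autFactor γ z := by
  rw [UpperHalfPlane.specialLinearGroup_apply]
  simp [autFactor]

theorem modPt_im {m : ℕ} (γ : SL2Z) {P : Pt m} (hP : 0 < P.2.im) : 0 < (modPt γ P).2.im := by
  have h := coe_smul_eq γ ⟨P.2, hP⟩
  show 0 < ((γ 0 0 * P.2 + γ 0 1) / autFactor γ P.2).im
  rw [show P.2 = ((⟨P.2, hP⟩ : UpperHalfPlane) : ℂ) from rfl, ← h]
  exact (γ • (⟨P.2, hP⟩ : UpperHalfPlane)).2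

theorem autFactor_mul {m : ℕ} (γ δ : SL2Z) {P : Pt m} (hP : 0 < P.2.im) :
    autFactor (γ * δ) P.2 = autFactor γ (modPt δ P).2 * autFactor δ P.2 := by
  have h := autFactor_ne_zero δ hP
  have e : autFactor γ (modPt δ P).2 * autFactor δ P.2 =
      γ 1 0 * (δ 0 0 * P.2 + δ 0 1) + γ 1 1 * autFactor δ P.2 := by
    simp only [modPt]
    rw [autFactor, add_mul, mul_assoc, div_mul_cancel₀ _ h]
  rw [e]
  simp only [autFactor, Matrix.SpecialLinearGroup.coe_mul, Matrix.mul_apply, Fin.sum_univ_two]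
  push_cast
  ring

theorem modPt_mul {m : ℕ} (γ δ : SL2Z) {P : Pt m} (hP : 0 < P.2.im) :
    modPt (γ * δ) P = modPt γ (modPt δ P) := by
  have h := autFactor_ne_zero δ hP
  have h' := autFactor_ne_zero γ (modPt_im δ hP)
  have e := autFactor_mul γ δ hP
  refine Prod.ext (funext fun i => ?_) ?_
  · simp only [modPt] at e ⊢
    rw [e, div_div, mul_comm]
  · show (_ : ℂ) / _ = _ / autFactor γ (modPt δ P).2
    rw [e, div_eq_div_iff (mul_ne_zero h' h) h']
    have e' : (γ 0 0 * (modPt δ P).2 + γ 0 1) * autFactor δ P.2 =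
        γ 0 0 * (δ 0 0 * P.2 + δ 0 1) + γ 0 1 * autFactor δ P.2 := by
      simp only [modPt]
      rw [add_mul, mul_assoc, div_mul_cancel₀ _ h]
    rw [mul_comm (autFactor γ _), ← mul_assoc, e']
    congr 1
    simp only [autFactor, Matrix.SpecialLinearGroup.coe_mul, Matrix.mul_apply, Fin.sum_univ_two]
    push_cast
    ring

theorem autFactor_one (τ : ℂ) : autFactor 1 τ = 1 := by simp [autFactor]

theorem modPt_one {m : ℕ} (P : Pt m) : modPt 1 P = P := by
  simp [modPt, autFactor_one]

/-- The change of basis of `ℤ + ℤτ` which takes the coordinates of `j·w`, `w ∈ ℤ + ℤγτ`, with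
respect to the basis `j, jγτ` to those with respect to `1, τ`, where `j` is the automorphy
factor. -/
def latEquiv (γ : SL2Z) : ℤ × ℤ ≃ ℤ × ℤ where
  toFun w := (w.1 * γ 1 1 + w.2 * γ 0 1, w.1 * γ 1 0 + w.2 * γ 0 0)
  invFun w := (γ 0 0 * w.1 - γ 0 1 * w.2, -γ 1 0 * w.1 + γ 1 1 * w.2)
  left_inv w := by
    have h := γ.det_coe
    rw [Matrix.det_fin_two] at h
    ext
    · simp only; linear_combination w.1 * h
    · simp only; linear_combination w.2 * h
  right_inv w := by
    have h := γ.det_coe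
    rw [Matrix.det_fin_two] at h
    ext
    · simp only; linear_combination w.1 * h
    · simp only; linear_combination w.2 * h

theorem latEquiv_apply {γ : SL2Z} {τ : ℂ} (h : autFactor γ τ ≠ 0) (w : ℤ × ℤ) :
    (w.1 + w.2 * ((γ 0 0 * τ + γ 0 1) / autFactor γ τ) : ℂ) =
      ((latEquiv γ w).1 + (latEquiv γ w).2 * τ) / autFactor γ τ := by
  rw [eq_div_iff h, add_mul, mul_assoc, div_mul_cancel₀ _ h]
  simp only [latEquiv, Equiv.coe_fn_mk, autFactor]
  push_cast
  ring

theorem latEquiv_ne_zero (γ : SL2Z) (w : ℤ × ℤ) : w ≠ 0 ↔ latEquiv γ w ≠ 0 := by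
  have : latEquiv γ 0 = 0 := by simp [latEquiv]
  rw [not_iff_not]
  exact ⟨fun h => h ▸ this, fun h => (latEquiv γ).injective (h.trans this.symm)⟩

theorem div_mem_lat {m : ℕ} (γ : SL2Z) {P : Pt m} (hP : 0 < P.2.im) (z : ℂ) :
    z / autFactor γ P.2 ∈ lat (modPt γ P).2 ↔ z ∈ lat P.2 := by
  have h := autFactor_ne_zero γ hP
  constructor
  · rintro ⟨a, b, e⟩
    have := latEquiv_apply h (a, b)
    refine ⟨(latEquiv γ (a, b)).1, (latEquiv γ (a, b)).2, ?_⟩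
    simp only [modPt] at e
    simp only at this
    rw [this] at e
    exact (div_left_inj' h).1 e
  · rintro ⟨a, b, e⟩
    have := latEquiv_apply h ((latEquiv γ).symm (a, b))
    refine ⟨((latEquiv γ).symm (a, b)).1, ((latEquiv γ).symm (a, b)).2, ?_⟩
    rw [e]
    simp only [modPt]
    rw [this, Equiv.apply_symm_apply]

theorem modPt_mem {m : ℕ} (γ : SL2Z) {P : Pt m} (hP : 0 < P.2.im) :
    modPt γ P ∈ Conf m ↔ P ∈ Conf m := by
  have : ∀ i j, (modPt γ P).1 i - (modPt γ P).1 j = (P.1 i - P.1 j) / autFactor γ P.2 := by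
    intro i j
    simp only [modPt]
    ring
  simp only [Conf, Set.mem_ofPred_eq, this, div_mem_lat γ hP, hP, modPt_im γ hP]

theorem modPt_mem_of_mem {m : ℕ} (γ : SL2Z) {P : Pt m} (hP : P ∈ Conf m) : modPt γ P ∈ Conf m :=
  (modPt_mem γ hP.1).2 hP

/-! ### Modularity of Eisenstein series and Weierstrass functions -/

/-- A rearrangement of the lattice sums by `latEquiv`; it does not require convergence. -/
theorem wp_modular (γ : SL2Z) {τ : ℂ} (hτ : 0 < τ.im) (k : ℕ) (t : ℂ) :
    wp k (t / autFactor γ τ) ((γ 0 0 * τ + γ 0 1) / autFactor γ τ) =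
      autFactor γ τ ^ k * wp k t τ := by
  have h := autFactor_ne_zero γ hτ
  let e : {w : ℤ × ℤ // w ≠ 0} ≃ {w : ℤ × ℤ // w ≠ 0} :=
    (latEquiv γ).subtypeEquiv (latEquiv_ne_zero γ)
  match k with
  | 0 => simp [wp]
  | 1 =>
    simp only [wp]
    rw [mul_add, ← tsum_mul_left]
    congr 1
    · field_simp
    · symm
      rw [← e.tsum_eq]
      refine tsum_congr fun w => Eq.symm ?_
      rw [latEquiv_apply h]
      change _ = autFactor γ τ ^ 1 * (1 / (t - ((latEquiv γ w.1).1 + (latEquiv γ w.1).2 * τ)) +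
        1 / ((latEquiv γ w.1).1 + (latEquiv γ w.1).2 * τ) +
        t / ((latEquiv γ w.1).1 + (latEquiv γ w.1).2 * τ) ^ 2)
      generalize ((latEquiv γ w.1).1 + (latEquiv γ w.1).2 * τ : ℂ) = z
      rw [← sub_div]
      generalize t - z = y
      field_simp
  | 2 =>
    simp only [wp]
    rw [mul_add, ← tsum_mul_left]
    congr 1
    · field_simp
    · symm
      rw [← e.tsum_eq]
      refine tsum_congr fun w => Eq.symm ?_
      rw [latEquiv_apply h]
      change _ = autFactor γ τ ^ 2 * (1 / (t - ((latEquiv γ w.1).1 + (latEquiv γ w.1).2 * τ)) ^ 2 -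
        1 / ((latEquiv γ w.1).1 + (latEquiv γ w.1).2 * τ) ^ 2)
      generalize ((latEquiv γ w.1).1 + (latEquiv γ w.1).2 * τ : ℂ) = z
      rw [← sub_div]
      generalize t - z = y
      field_simp
  | k + 3 =>
    simp only [wp]
    symm
    rw [← tsum_mul_left, ← (latEquiv γ).tsum_eq]
    refine tsum_congr fun w => Eq.symm ?_
    rw [latEquiv_apply h]
    generalize ((latEquiv γ w).1 + (latEquiv γ w).2 * τ : ℂ) = z
    rw [← sub_div, div_pow, one_div_div, div_eq_mul_one_div]

/-- `g_{2k}` in the form of the `q`-expansions of Eisenstein series in Mathlib. -/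
theorem eis_eq_tsum_pnat {k : ℕ} (hk : 1 ≤ k) (τ : ℂ) :
    eis k τ = 2 * riemannZeta (2 * k : ℕ) +
      2 * ((-2 * Real.pi * Complex.I) ^ (2 * k) / (Nat.factorial (2 * k - 1) : ℂ)) *
      ∑' n : ℕ+, (ArithmeticFunction.sigma (2 * k - 1) n : ℂ) *
        Complex.exp (2 * Real.pi * Complex.I * τ) ^ (n : ℕ) := by
  have h1 : riemannZeta (2 * k : ℕ) = ∑' n : ℕ, 1 / ((n : ℂ) + 1) ^ (2 * k) := by
    rw [zeta_eq_tsum_one_div_nat_add_one_cpow]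
    · simp only [Complex.cpow_natCast]
    · rw [Complex.natCast_re]
      exact_mod_cast (by omega : 1 < 2 * k)
  rw [eis, ← h1, tsum_pnat_eq_tsum_succ (f := fun n => (ArithmeticFunction.sigma (2 * k - 1) n : ℂ) *
        Complex.exp (2 * Real.pi * Complex.I * τ) ^ n)]
  have h2 : (-2 * Real.pi * Complex.I : ℂ) ^ (2 * k) = (2 * Real.pi * Complex.I) ^ (2 * k) := by
    rw [pow_mul, pow_mul]; congr 1; ring
  rw [h2, mul_div_assoc]

/-- The quasimodularity of `g_2`, which is the function `EisensteinSeries.G2`. -/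
theorem eis_one_modular (γ : SL2Z) {τ : ℂ} (hτ : 0 < τ.im) :
    eis 1 ((γ 0 0 * τ + γ 0 1) / autFactor γ τ) =
      autFactor γ τ ^ 2 * eis 1 τ - 2 * Real.pi * Complex.I * γ 1 0 * autFactor γ τ := by
  have key : ∀ z : UpperHalfPlane, eis 1 z = EisensteinSeries.G2 z := by
    intro z
    rw [EisensteinSeries.G2_eq_tsum_cexp, eis_eq_tsum_pnat le_rfl]
    have : (-2 * Real.pi * Complex.I : ℂ) ^ (2 * 1) = -4 * Real.pi ^ 2 := by
      rw [mul_one, mul_pow, Complex.I_sq]; ring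
    rw [this]
    simp
    ring
  let z : UpperHalfPlane := ⟨τ, hτ⟩
  have h := congrFun (EisensteinSeries.G2_slash_action γ) z
  have h0 := autFactor_ne_zero γ hτ
  rw [ModularForm.SL_slash_apply, Pi.sub_apply, EisensteinSeries.D2, ← autFactor_eq_denom,
    ← key, ← key, coe_smul_eq] at h
  change eis 1 ((γ 0 0 * τ + γ 0 1) / autFactor γ τ) * autFactor γ τ ^ (-2 : ℤ) =
    eis 1 τ - 2 * Real.pi * Complex.I * γ 1 0 / autFactor γ τ at h
  rw [zpow_neg, ← div_eq_mul_inv, div_eq_iff (by positivity)] at h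
  rw [h]
  field_simp

theorem eis_modular (γ : SL2Z) {τ : ℂ} (hτ : 0 < τ.im) {k : ℕ} (hk : 2 ≤ k) :
    eis k ((γ 0 0 * τ + γ 0 1) / autFactor γ τ) = autFactor γ τ ^ (2 * k) * eis k τ := by
  have key : ∀ z : UpperHalfPlane,
      eis k z = ∑' w : ℤ × ℤ, ((w.1 + w.2 * z : ℂ) ^ (2 * k))⁻¹ := by
    intro z
    rw [eis_eq_tsum_pnat (by omega), ← tsum_eisSummand_eq_tsum_sigma_mul_cexp_pow
      (by omega) (by simp), ← ((Equiv.prodComm ℤ ℤ).trans (finTwoArrowEquiv ℤ).symm).tsum_eq]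
    refine tsum_congr fun w => ?_
    simp only [EisensteinSeries.eisSummand, Equiv.trans_apply, Equiv.prodComm_apply,
      finTwoArrowEquiv_symm_apply, Prod.fst_swap, Prod.snd_swap, Matrix.cons_val_zero,
      Matrix.cons_val_one]
    rw [zpow_neg, zpow_natCast, add_comm]
  have h := autFactor_ne_zero γ hτ
  have h1 := key (γ • ⟨τ, hτ⟩)
  rw [coe_smul_eq] at h1
  change eis k ((γ 0 0 * τ + γ 0 1) / autFactor γ τ) = ∑' w : ℤ × ℤ,
    ((w.1 + w.2 * ((γ 0 0 * τ + γ 0 1) / autFactor γ τ) : ℂ) ^ (2 * k))⁻¹ at h1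
  rw [h1, show eis k τ = _ from key ⟨τ, hτ⟩, ← tsum_mul_left, eq_comm,
    ← (latEquiv γ).tsum_eq]
  refine tsum_congr fun w => Eq.symm ?_
  rw [latEquiv_apply h, div_pow, inv_div, div_eq_mul_inv]

theorem zetaW_modular (γ : SL2Z) {τ : ℂ} (hτ : 0 < τ.im) (t : ℂ) :
    zetaW (t / autFactor γ τ) ((γ 0 0 * τ + γ 0 1) / autFactor γ τ) =
      autFactor γ τ * zetaW t τ + 2 * Real.pi * Complex.I * γ 1 0 * t := by
  have h := autFactor_ne_zero γ hτ
  rw [zetaW, wp_modular γ hτ, eis_one_modular γ hτ, zetaW]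
  field_simp
  ring

/-! ### The slash action on elliptic functions -/

theorem analyticAt_autFactor {m : ℕ} (γ : SL2Z) (P : Pt m) :
    AnalyticAt ℂ (fun Q : Pt m => autFactor γ Q.2) P :=
  (analyticAt_const.mul analyticAt_snd).add analyticAt_const

theorem analyticAt_modPt {m : ℕ} (γ : SL2Z) {P : Pt m} (hP : 0 < P.2.im) :
    AnalyticAt ℂ (modPt γ : Pt m → Pt m) P := by
  have h := autFactor_ne_zero γ hP
  have hj := analyticAt_autFactor γ P
  refine AnalyticAt.prod ?_ ?_
  · rw [analyticAt_pi_iff]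
    exact fun i => (((ContinuousLinearMap.proj (R := ℂ) (φ := fun _ : Fin m => ℂ) i).comp
      (ContinuousLinearMap.fst ℂ (Fin m → ℂ) ℂ)).analyticAt P).div hj h
  · exact ((analyticAt_const.mul analyticAt_snd).add analyticAt_const).div hj h

theorem eventually_im_pos {m : ℕ} {P : Pt m} (hP : 0 < P.2.im) : ∀ᶠ Q in 𝓝 P, 0 < Q.2.im :=
  continuousAt_const.eventually_lt (by fun_prop : Continuous fun Q : Pt m => Q.2.im).continuousAt hP

/-- The function `(cτ+d)^q f(t/(cτ+d), (aτ+b)/(cτ+d))`, extended by zero to `Im τ ≤ 0`. -/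
def slashFun {m : ℕ} (γ : SL2Z) (q : ℤ) (f : Pt m → ℂ) (P : Pt m) : ℂ :=
  open Classical in if 0 < P.2.im then autFactor γ P.2 ^ q * f (modPt γ P) else 0

theorem slashFun_apply {m : ℕ} (γ : SL2Z) (q : ℤ) (f : Pt m → ℂ) {P : Pt m} (hP : 0 < P.2.im) :
    slashFun γ q f P = autFactor γ P.2 ^ q * f (modPt γ P) := if_pos hP

theorem slashFun_mem {m : ℕ} (γ : SL2Z) (q : ℤ) {f : Pt m → ℂ} (hf : f ∈ Ell m) :
    slashFun γ q f ∈ Ell m := by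
  obtain ⟨h1, h2, h3, N, h4⟩ := hf
  refine ⟨fun P hP => ?_, fun P hP => ?_, fun P hP i a b => ?_, N, fun i j hij P hP he ho => ?_⟩
  · by_cases hi : 0 < P.2.im
    · rw [slashFun_apply γ q f hi, h1 _ (mt (modPt_mem γ hi).1 hP), mul_zero]
    · exact if_neg hi
  · have h := autFactor_ne_zero γ hP.1
    have hd : DifferentiableAt ℂ (fun Q : Pt m => autFactor γ Q.2 ^ q * f (modPt γ Q)) P :=
      ((analyticAt_autFactor γ P).zpow h).differentiableAt.mul
        ((h2 _ (modPt_mem_of_mem γ hP)).comp P (analyticAt_modPt γ hP.1).differentiableAt)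
    refine hd.congr_of_eventuallyEq ?_
    filter_upwards [eventually_im_pos hP.1] with Q hQ using slashFun_apply γ q f hQ
  · have h := autFactor_ne_zero γ hP
    rw [slashFun_apply γ q f hP, slashFun_apply γ q f
      (P := (Function.update P.1 i (P.1 i + a + b * P.2), P.2)) hP]
    obtain ⟨a', b', e⟩ := (div_mem_lat γ hP (a + b * P.2)).2 ⟨a, b, rfl⟩
    rw [← h3 (modPt γ P) (modPt_im γ hP) i a' b']
    refine congrArg _ (congrArg f (Prod.ext (funext fun s => ?_) rfl))
    by_cases hs : s = i
    · subst hs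
      simp only [modPt, Function.update_self] at e ⊢
      rw [add_assoc, add_div, e]
      ring
    · simp [modPt, hs]
  · have h := autFactor_ne_zero γ hP
    have hsub : ∀ (Q : Pt m) k l,
        (modPt γ Q).1 k - (modPt γ Q).1 l = (Q.1 k - Q.1 l) / autFactor γ Q.2 := fun Q k l =>
      (sub_div _ _ _).symm
    obtain ⟨g, hg, hg1⟩ := h4 i j hij (modPt γ P) (modPt_im γ hP) (by simp [modPt, he]) (by
      intro k l hk hl hkl
      rw [hsub, div_mem_lat γ hP]
      exact ho k l hk hl hkl)
    have ha := analyticAt_modPt γ hP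
    refine ⟨fun Q => autFactor γ Q.2 ^ (q + N) * g (modPt γ Q),
      ((analyticAt_autFactor γ P).zpow h).mul (hg.comp ha), ?_⟩
    filter_upwards [ha.continuousAt.eventually hg1, eventually_im_pos hP] with Q hQ hQi hc
    have hj := autFactor_ne_zero γ hQi
    rw [slashFun_apply γ q f hQi, ← hQ (modPt_mem_of_mem γ hc), hsub, zpow_add₀ hj,
      zpow_natCast, div_pow]
    field_simp

/-- The operator `f ↦ (cτ+d)^q f(t/(cτ+d), (aτ+b)/(cτ+d))` on `𝓕_m`. -/
def slash {m : ℕ} (γ : SL2Z) (q : ℤ) : Ell m →ₗ[ℂ] Ell m where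
  toFun f := ⟨slashFun γ q f.1, slashFun_mem γ q f.2⟩
  map_add' f g := by
    ext P
    by_cases h : 0 < P.2.im
    · simp [slashFun, h, mul_add]
    · simp [slashFun, h]
  map_smul' c f := by
    ext P
    by_cases h : 0 < P.2.im
    · simp [slashFun, h]; ring
    · simp [slashFun, h]

theorem slash_apply {m : ℕ} (γ : SL2Z) (q : ℤ) (f : Ell m) {P : Pt m} (hP : 0 < P.2.im) :
    (slash γ q f).1 P = autFactor γ P.2 ^ q * f.1 (modPt γ P) := if_pos hP

theorem ell_eq_zero_of_im_nonpos {m : ℕ} (f : Ell m) {P : Pt m} (hP : ¬ 0 < P.2.im) : f.1 P = 0 :=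
  f.2.1 P fun h => hP h.1

theorem IsJacobi.slash_eq {m k : ℕ} {f : Ell m} (hf : IsJacobi k f) (γ : SL2Z) :
    slash γ (-k) f = f := by
  apply Subtype.ext
  funext P
  by_cases h : 0 < P.2.im
  · rw [slash_apply γ _ f h, hf.1 γ P h, ← mul_assoc, zpow_neg, zpow_natCast,
      inv_mul_cancel₀ (pow_ne_zero k (autFactor_ne_zero γ h)), one_mul]
  · rw [ell_eq_zero_of_im_nonpos f h]
    exact if_neg h

/-- The chain rule for the slash action, along a direction in which the tangent vector of the
transformed line is known. -/
theorem fderiv_slash_apply {m : ℕ} (γ : SL2Z) (q : ℤ) (f : Ell m) {P : Pt m} (hP : P ∈ Conf m)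
    (v w : Pt m) (hw : HasDerivAt (fun s : ℂ => modPt γ (P + s • v)) w 0) :
    fderiv ℂ (slash γ q f).1 P v =
      q * autFactor γ P.2 ^ (q - 1) * (γ 1 0 * v.2) * f.1 (modPt γ P) +
        autFactor γ P.2 ^ q * fderiv ℂ f.1 (modPt γ P) w := by
  have h := autFactor_ne_zero γ hP.1
  have hl : HasDerivAt (fun s : ℂ => P + s • v) v 0 := by
    simpa using ((hasDerivAt_id (0 : ℂ)).smul_const v).const_add P
  have h1 : HasDerivAt (fun s : ℂ => (slash γ q f).1 (P + s • v))
      (fderiv ℂ (slash γ q f).1 P v) 0 := by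
    have := ((slash γ q f).2.2.1 P hP).hasFDerivAt
    exact HasFDerivAt.comp_hasDerivAt 0 (by simpa using this) hl
  have h2 : HasDerivAt (fun s : ℂ => f.1 (modPt γ (P + s • v)))
      (fderiv ℂ f.1 (modPt γ P) w) 0 := by
    have := (f.2.2.1 _ (modPt_mem_of_mem γ hP)).hasFDerivAt
    exact HasFDerivAt.comp_hasDerivAt 0 (by simpa using this) hw
  have h3 : HasDerivAt (fun s : ℂ => autFactor γ (P + s • v).2) (γ 1 0 * v.2) 0 := by
    have : HasDerivAt (fun s : ℂ => (γ 1 0 : ℂ) * (P.2 + s * v.2) + γ 1 1) (γ 1 0 * v.2) 0 := by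
      simpa using ((((hasDerivAt_id (0 : ℂ)).mul_const v.2).const_add P.2).const_mul
        (γ 1 0 : ℂ)).add_const (γ 1 1 : ℂ)
    exact this
  have h4 : HasDerivAt (fun s : ℂ => autFactor γ (P + s • v).2 ^ q)
      (q * autFactor γ P.2 ^ (q - 1) * (γ 1 0 * v.2)) 0 := by
    have := (hasDerivAt_zpow q (autFactor γ (P + (0 : ℂ) • v).2) (Or.inl (by simpa using h))).comp
      0 h3
    simp only [zero_smul, add_zero] at this
    exact this
  have h5 := h4.mul h2
  simp only [zero_smul, add_zero] at h5
  refine h1.unique (h5.congr_of_eventuallyEq ?_)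
  have hc : Tendsto (fun s : ℂ => P + s • v) (𝓝 0) (𝓝 P) := by
    simpa using hl.continuousAt.tendsto
  filter_upwards [hc.eventually (eventually_im_pos hP.1)] with s hs
  exact slash_apply γ q f hs

theorem pd_slash {m : ℕ} (γ : SL2Z) (q : ℤ) (j : Fin m) (f : Ell m) {P : Pt m} (hP : P ∈ Conf m) :
    pd j (slash γ q f) P = autFactor γ P.2 ^ (q - 1) * pd j f (modPt γ P) := by
  have h := autFactor_ne_zero γ hP.1
  have hw : HasDerivAt (fun s : ℂ => modPt γ (P + s • ((Pi.single j 1, 0) : Pt m)))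
      ((autFactor γ P.2)⁻¹ • ((Pi.single j 1, 0) : Pt m)) 0 := by
    have e : (fun s : ℂ => modPt γ (P + s • ((Pi.single j 1, 0) : Pt m))) =
        fun s : ℂ => modPt γ P + s • ((autFactor γ P.2)⁻¹ • ((Pi.single j 1, 0) : Pt m)) := by
      funext s
      refine Prod.ext (funext fun i => ?_) ?_
      · simp [modPt]
        ring
      · simp [modPt]
    rw [e]
    simpa using ((hasDerivAt_id (0 : ℂ)).smul_const
      ((autFactor γ P.2)⁻¹ • ((Pi.single j 1, 0) : Pt m))).const_add (modPt γ P)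
  have := fderiv_slash_apply γ q f hP _ _ hw
  simp only [pd, LinearMap.coe_mk, AddHom.coe_mk, Set.indicator_of_mem hP,
    Set.indicator_of_mem (modPt_mem_of_mem γ hP)]
  rw [this, map_smul, zpow_sub_one₀ h]
  simp
  ring

theorem pdTau_slash {m : ℕ} (γ : SL2Z) (q : ℤ) (f : Ell m) {P : Pt m} (hP : P ∈ Conf m) :
    pdTau (slash γ q f) P = q * γ 1 0 * autFactor γ P.2 ^ (q - 1) * f.1 (modPt γ P) +
      autFactor γ P.2 ^ (q - 2) * (pdTau f (modPt γ P) -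
        γ 1 0 * ∑ i, P.1 i * pd i f (modPt γ P)) := by
  have h := autFactor_ne_zero γ hP.1
  let w : Pt m := (fun i => -(γ 1 0 * P.1 i) / autFactor γ P.2 ^ 2, 1 / autFactor γ P.2 ^ 2)
  have hj : HasDerivAt (fun s : ℂ => autFactor γ (P.2 + s)) (γ 1 0) 0 := by
    simpa [autFactor] using (((hasDerivAt_id (0 : ℂ)).const_add P.2).const_mul
      (γ 1 0 : ℂ)).add_const (γ 1 1 : ℂ)
  have hw : HasDerivAt (fun s : ℂ => modPt γ (P + s • ((0, 1) : Pt m))) w 0 := by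
    have e : (fun s : ℂ => modPt γ (P + s • ((0, 1) : Pt m))) =
        fun s : ℂ => (fun i => P.1 i / autFactor γ (P.2 + s),
          (γ 0 0 * (P.2 + s) + γ 0 1) / autFactor γ (P.2 + s)) := by
      funext s
      simp [modPt]
    rw [e]
    refine HasDerivAt.prodMk (hasDerivAt_pi.2 fun i => ?_) ?_
    · refine ((hasDerivAt_const (0 : ℂ) (P.1 i)).div hj (by simpa using h)).congr_deriv ?_
      rw [add_zero]
      ring
    · have h2 : HasDerivAt (fun s : ℂ => (γ 0 0 : ℂ) * (P.2 + s) + γ 0 1) (γ 0 0) 0 := by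
        simpa using (((hasDerivAt_id (0 : ℂ)).const_add P.2).const_mul
          (γ 0 0 : ℂ)).add_const (γ 0 1 : ℂ)
      refine (h2.div hj (by simpa using h)).congr_deriv ?_
      rw [add_zero, ← det_cast γ, autFactor]
      ring
  have hw' : w = (1 / autFactor γ P.2 ^ 2) • (((0, 1) : Pt m) -
      (γ 1 0 : ℂ) • ∑ i, P.1 i • ((Pi.single i 1, 0) : Pt m)) := by
    refine Prod.ext (funext fun i => ?_) ?_
    · simp [w, Prod.fst_sum, Finset.sum_apply, Pi.single_apply]
      ring
    · simp [w, Prod.snd_sum]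
  have := fderiv_slash_apply γ q f hP _ _ hw
  simp only [pd, pdTau, LinearMap.coe_mk, AddHom.coe_mk, Set.indicator_of_mem hP,
    Set.indicator_of_mem (modPt_mem_of_mem γ hP)]
  rw [this, hw', map_smul, map_sub, map_smul, map_sum, zpow_sub₀ h q 2]
  simp only [map_smul, smul_eq_mul, mul_one, zpow_ofNat]
  field_simp

/-! ### Translation invariance of elliptic functions -/

theorem ell_add_lattice {m : ℕ} (f : Ell m) {P : Pt m} (hP : 0 < P.2.im) (a b : ℤ) :
    f.1 (fun i => P.1 i + (a + b * P.2), P.2) = f.1 P := by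
  have key : ∀ A : Finset (Fin m),
      f.1 (fun i => open Classical in if i ∈ A then P.1 i + (a + b * P.2) else P.1 i, P.2) =
        f.1 P := by
    intro A
    induction A using Finset.induction_on with
    | empty => simp
    | insert x A hx ih =>
      rw [← ih]
      refine Eq.trans ?_ (f.2.2.2.1
        (fun i => open Classical in if i ∈ A then P.1 i + (a + b * P.2) else P.1 i, P.2) hP x a b)
      refine congrArg f.1 (Prod.ext (funext fun i => ?_) rfl)
      by_cases hi : i = x
      · subst hi; simp [hx, add_assoc]
      · simp [hi]
  simpa using key Finset.univ

/-- A simultaneous translation of all variables does not change an elliptic function: it has no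
poles in the direction of the diagonal, so Liouville's theorem applies. -/
theorem ell_translate {m : ℕ} (f : Ell m) {P : Pt m} (hP : P ∈ Conf m) (s : ℂ) :
    f.1 (fun i => P.1 i + s, P.2) = f.1 P := by
  let h : ℂ → ℂ := fun s => f.1 (fun i => P.1 i + s, P.2)
  have hmem : ∀ s, ((fun i => P.1 i + s, P.2) : Pt m) ∈ Conf m := fun s =>
    ⟨hP.1, fun i j hij => by simpa using hP.2 i j hij⟩
  have hd : Differentiable ℂ h := fun s =>
    (f.2.2.1 _ (hmem s)).comp s (f := fun s : ℂ => ((fun i => P.1 i + s, P.2) : Pt m))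
      (by fun_prop)
  have him := hP.1
  -- a period parallelogram, to which every `s` is equivalent
  let K : Set ℂ := (fun p : ℝ × ℝ => (p.1 + p.2 * P.2 : ℂ)) '' (Set.Icc 0 1 ×ˢ Set.Icc 0 1)
  have hK : IsCompact K := (isCompact_Icc.prod isCompact_Icc).image (by fun_prop)
  have hb : Bornology.IsBounded (Set.range h) := by
    refine (hK.image hd.continuous).isBounded.subset ?_
    rintro _ ⟨s, rfl⟩
    let y : ℝ := s.im / P.2.im
    let x : ℝ := s.re - y * P.2.re
    have hs : s = x + y * P.2 := by
      apply Complex.ext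
      · simp [x]
      · simp [y, him.ne']
    refine ⟨_, ⟨(Int.fract x, Int.fract y), ⟨⟨Int.fract_nonneg _, (Int.fract_lt_one _).le⟩,
      Int.fract_nonneg _, (Int.fract_lt_one _).le⟩, rfl⟩, ?_⟩
    have := ell_add_lattice f (P := (fun i => P.1 i + (Int.fract x + Int.fract y * P.2), P.2)) hP.1
      ⌊x⌋ ⌊y⌋
    simp only [h]
    rw [← this]
    refine congrArg f.1 (Prod.ext (funext fun i => ?_) rfl)
    simp only
    rw [hs]
    have hx : (x : ℂ) = ⌊x⌋ + Int.fract x := by exact_mod_cast (Int.floor_add_fract x).symm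
    have hy : (y : ℂ) = ⌊y⌋ + Int.fract y := by exact_mod_cast (Int.floor_add_fract y).symm
    conv_rhs => rw [hx, hy]
    ring
  have := hd.apply_eq_apply_of_bounded hb s 0
  simpa [h] using this

theorem ell_sum_pd {m : ℕ} (f : Ell m) (P : Pt m) : ∑ i, pd i f P = 0 := by
  by_cases hP : P ∈ Conf m
  · have hl : HasDerivAt (fun s : ℂ => ((fun i => P.1 i + s, P.2) : Pt m)) ((fun _ => 1), 0) 0 :=
      HasDerivAt.prodMk (hasDerivAt_pi.2 fun i => (hasDerivAt_id 0).const_add _)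
        (hasDerivAt_const _ _)
    have h1 := HasFDerivAt.comp_hasDerivAt (f := fun s : ℂ => ((fun i => P.1 i + s, P.2) : Pt m)) 0
      (l := f.1) (l' := fderiv ℂ f.1 P) (by simpa using (f.2.2.1 P hP).hasFDerivAt) hl
    have h2 : (f.1 ∘ fun s : ℂ => ((fun i => P.1 i + s, P.2) : Pt m)) = fun _ => f.1 P :=
      funext fun s => ell_translate f hP s
    rw [h2] at h1
    have h3 := h1.unique (hasDerivAt_const _ _)
    have e : ((fun _ => 1, 0) : Pt m) = ∑ i, ((Pi.single i 1, 0) : Pt m) := by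
      refine Prod.ext (funext fun i => ?_) ?_
      · simp [Prod.fst_sum, Finset.sum_apply, Pi.single_apply]
      · simp [Prod.snd_sum]
    rw [e, map_sum] at h3
    simpa [pd, hP] using h3
  · simp [pd, hP]

theorem pd_of_notMem {m : ℕ} (j : Fin m) (f : Ell m) {P : Pt m} (hP : P ∉ Conf m) :
    pd j f P = 0 := by simp [pd, hP]

theorem dTau_apply {m : ℕ} (f : Ell (m + 1)) (P : Pt (m + 1)) :
    dTau f P = 2 * Real.pi * Complex.I * pdTau f P +
      ∑ i : Fin m, zetaW (P.1 (Fin.last m) - P.1 i.castSucc) P.2 * pd i.castSucc f P := by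
  simp [dTau, mulFun, Finset.sum_apply]

theorem dTau_of_notMem {m : ℕ} (f : Ell (m + 1)) {P : Pt (m + 1)} (hP : P ∉ Conf (m + 1)) :
    dTau f P = 0 := by
  rw [dTau_apply]
  simp [pd_of_notMem _ f hP, pdTau, hP]

/-- The derivation `D_τ` is covariant up to a multiple of `f`: the anomaly of the functions
`ζ(t_n - t_i)` cancels against the derivatives of `t/(cτ+d)` by translation invariance. -/
theorem dTau_slash {m : ℕ} (γ : SL2Z) (q : ℤ) (f : Ell (m + 1)) {P : Pt (m + 1)}
    (hP : P ∈ Conf (m + 1)) :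
    dTau (slash γ q f) P = autFactor γ P.2 ^ (q - 2) * dTau f (modPt γ P) +
      2 * Real.pi * Complex.I * q * γ 1 0 * autFactor γ P.2 ^ (q - 1) * f.1 (modPt γ P) := by
  have h := autFactor_ne_zero γ hP.1
  have hz : ∀ i : Fin m, zetaW ((modPt γ P).1 (Fin.last m) - (modPt γ P).1 i.castSucc)
      (modPt γ P).2 = autFactor γ P.2 * zetaW (P.1 (Fin.last m) - P.1 i.castSucc) P.2 +
        2 * Real.pi * Complex.I * γ 1 0 * (P.1 (Fin.last m) - P.1 i.castSucc) := by
    intro i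
    rw [← zetaW_modular γ hP.1]
    simp only [modPt]
    congr 1
    ring
  have hs := ell_sum_pd f (modPt γ P)
  rw [Fin.sum_univ_castSucc] at hs
  rw [dTau_apply, dTau_apply, pdTau_slash γ q f hP, Fin.sum_univ_castSucc]
  simp only [pd_slash γ q _ f hP, hz]
  set Z := fun i : Fin m => zetaW (P.1 (Fin.last m) - P.1 i.castSucc) P.2
  set D := fun i : Fin m => pd i.castSucc f (modPt γ P)
  set t := P.1 (Fin.last m)
  change (∑ i, D i) + _ = 0 at hs
  change _ * (_ + _ * (_ - _ * ((∑ i : Fin m, P.1 i.castSucc * D i) + _))) +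
    (∑ i, Z i * (_ * D i)) = _ * (_ + ∑ i, (_ * Z i + _ * (t - _)) * D i) + _
  have e1 : ∑ i, Z i * (autFactor γ P.2 ^ (q - 1) * D i) =
      autFactor γ P.2 ^ (q - 1) * ∑ i, Z i * D i := by
    rw [Finset.mul_sum]
    exact Finset.sum_congr rfl fun i _ => by ring
  have e2 : ∑ i : Fin m, (autFactor γ P.2 * Z i +
      2 * Real.pi * Complex.I * γ 1 0 * (t - P.1 i.castSucc)) * D i =
      autFactor γ P.2 * ∑ i, Z i * D i + 2 * Real.pi * Complex.I * γ 1 0 *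
        (t * ∑ i, D i - ∑ i : Fin m, P.1 i.castSucc * D i) := by
    simp only [Finset.mul_sum, ← Finset.sum_sub_distrib, ← Finset.sum_add_distrib]
    exact Finset.sum_congr rfl fun i _ => by ring
  have e3 : autFactor γ P.2 ^ (q - 1) = autFactor γ P.2 ^ (q - 2) * autFactor γ P.2 := by
    rw [← zpow_add_one₀ h]; congr 1; ring
  rw [e1, e2, e3, eq_neg_of_add_eq_zero_left hs]
  ring

/-! ### Modular functions of integral weight -/

/-- Functions on `ℂᵐ × ℍ`, extended by zero, with `f(γP) = (cτ+d)^w f(P)`. In contrast to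
`IsJacobi`, no regularity is imposed and the weight may be negative, as it happens for Laurent
coefficients of Jacobi forms. -/
def IsModular {m : ℕ} (w : ℤ) (f : Pt m → ℂ) : Prop :=
  (∀ P : Pt m, ¬ 0 < P.2.im → f P = 0) ∧
    ∀ (γ : SL2Z) (P : Pt m), 0 < P.2.im → f (modPt γ P) = autFactor γ P.2 ^ w * f P

theorem IsJacobi.isModular {m k : ℕ} {f : Ell m} (hf : IsJacobi k f) : IsModular k f.1 :=
  ⟨fun _ hP => ell_eq_zero_of_im_nonpos f hP, fun γ P hP => by
    rw [hf.1 γ P hP, zpow_natCast]⟩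

theorem IsModular.mul {m : ℕ} {v w : ℤ} {f g : Pt m → ℂ}
    (hg : ∀ (γ : SL2Z) (P : Pt m), 0 < P.2.im → g (modPt γ P) = autFactor γ P.2 ^ v * g P)
    (hf : IsModular w f) : IsModular (w + v) (g * f) :=
  ⟨fun P hP => by simp [hf.1 P hP], fun γ P hP => by
    rw [Pi.mul_apply, hg γ P hP, hf.2 γ P hP, zpow_add₀ (autFactor_ne_zero γ hP), Pi.mul_apply]
    ring⟩

theorem isModular_of_conf {m : ℕ} {w : ℤ} {f : Pt m → ℂ} (h0 : ∀ P ∉ Conf m, f P = 0)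
    (h : ∀ (γ : SL2Z), ∀ P ∈ Conf m, f (modPt γ P) = autFactor γ P.2 ^ w * f P) :
    IsModular w f := by
  refine ⟨fun P hP => h0 P fun hc => hP hc.1, fun γ P hP => ?_⟩
  by_cases hc : P ∈ Conf m
  · exact h γ P hc
  · rw [h0 P hc, h0 _ (mt (modPt_mem γ hP).1 hc), mul_zero]

theorem IsJacobi.pd_isModular {m k : ℕ} {f : Ell m} (hf : IsJacobi k f) (j : Fin m) :
    IsModular (k + 1) (pd j f) := by
  refine isModular_of_conf (fun P hP => pd_of_notMem j f hP) fun γ P hP => ?_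
  have h := pd_slash γ (-k) j f hP
  have h0 := autFactor_ne_zero γ hP.1
  rw [hf.slash_eq γ] at h
  rw [h, ← mul_assoc, ← zpow_add₀ h0, show (k : ℤ) + 1 + (-k - 1) = 0 by ring, zpow_zero, one_mul]

/-- The analogue of the Serre derivative for `D_τ`. -/
theorem IsJacobi.dTau_isModular {m k : ℕ} {f : Ell (m + 1)} (hf : IsJacobi k f) :
    IsModular (k + 2) (dTau f + (k : ℂ) • mulFun (fun P => eis 1 P.2) f.1) := by
  refine isModular_of_conf (fun P hP => ?_) fun γ P hP => ?_
  · simp [dTau_of_notMem f hP, mulFun, f.2.1 P hP]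
  have h := dTau_slash γ (-k) f hP
  have h0 := autFactor_ne_zero γ hP.1
  have he : eis 1 (modPt γ P).2 = _ := eis_one_modular γ hP.1
  rw [hf.slash_eq γ] at h
  simp only [mulFun, Pi.add_apply, Pi.smul_apply, LinearMap.mulLeft_apply, Pi.mul_apply,
    smul_eq_mul, he, h, hf.1 γ P hP.1]
  rw [zpow_add₀ h0, zpow_sub₀ h0, zpow_sub₀ h0, zpow_neg, zpow_natCast]
  push_cast
  have := pow_ne_zero k h0
  generalize autFactor γ P.2 ^ k = A at *
  simp only [zpow_ofNat]
  field_simp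
  ring

/-! ### Laurent coefficients of modular functions -/

theorem iteratedDeriv_comp_mul_left (c : ℂ) (g : ℂ → ℂ) (n : ℕ) :
    iteratedDeriv n (fun x => g (c * x)) = fun x => c ^ n * iteratedDeriv n g (c * x) := by
  induction n with
  | zero => simp
  | succ n ih =>
    funext x
    rw [iteratedDeriv_succ, ih, deriv_const_mul_field, deriv_comp_mul_left, iteratedDeriv_succ,
      smul_eq_mul, pow_succ, mul_assoc]

theorem laurentCoeff_scale {φ g : ℂ → ℂ} {N : ℕ} (hg : AnalyticAt ℂ g 0)
    (h : ∀ᶠ x in 𝓝[≠] (0 : ℂ), x ^ N * φ x = g x) (k : ℤ) (A : ℂ) {c : ℂ} (hc : c ≠ 0) :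
    laurentCoeff (fun x => A * φ (c * x)) k = A * c ^ k * laurentCoeff φ k := by
  have ht : Tendsto (fun x : ℂ => c * x) (𝓝[≠] 0) (𝓝[≠] 0) := by
    refine tendsto_nhdsWithin_of_tendsto_nhds_of_eventually_within _ ?_ ?_
    · have : Continuous fun x : ℂ => c * x := by fun_prop
      simpa using (this.tendsto 0).mono_left nhdsWithin_le_nhds
    · filter_upwards [self_mem_nhdsWithin] with x hx
      exact mul_ne_zero hc hx
  have hG : AnalyticAt ℂ (fun x => A * c ^ (-N : ℤ) * g (c * x)) 0 :=
    analyticAt_const.mul (AnalyticAt.comp (g := g) (f := fun x => c * x) (by simpa using hg)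
      (by fun_prop))
  have h' : ∀ᶠ x in 𝓝[≠] (0 : ℂ), x ^ N * (A * φ (c * x)) = A * c ^ (-N : ℤ) * g (c * x) := by
    filter_upwards [ht.eventually h] with x hx
    rw [← hx, mul_pow, zpow_neg, zpow_natCast]
    field_simp
  rw [laurentCoeff_eq hG h', laurentCoeff_eq hg h]
  split_ifs with hk
  · obtain ⟨n, hn⟩ := Int.eq_ofNat_of_zero_le hk
    rw [iteratedDeriv_const_mul_field, iteratedDeriv_comp_mul_left, hn, Int.toNat_natCast,
      show k = -N + n by omega, zpow_add₀ hc, zpow_natCast]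
    simp only [mul_zero]
    ring
  · simp

theorem insertAt_modPt {m : ℕ} (γ : SL2Z) (p : Fin (m + 1)) (q : Fin m) {P : Pt m}
    (hP : 0 < P.2.im) (x : ℂ) :
    insertAt p q (modPt γ P) x = modPt γ (insertAt p q P (autFactor γ P.2 * x)) := by
  have h := autFactor_ne_zero γ hP
  refine Prod.ext (funext fun i => ?_) rfl
  cases i using p.succAboveCases with
  | x =>
    simp only [insertAt, modPt, Fin.insertNth_apply_same]
    field_simp
  | p r => simp only [insertAt, modPt, Fin.insertNth_apply_succAbove]

theorem IsJacobi.laurent_isModular {m k : ℕ} {f : Ell (m + 1)} (hf : IsJacobi k f)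
    (p : Fin (m + 1)) (q : Fin m) (r : ℤ) : IsModular (k + r) (laurent p q r f) := by
  refine isModular_of_conf (fun P hP => ?_) fun γ P hP => ?_
  · simp [laurent, hP]
  have h0 := autFactor_ne_zero γ hP.1
  obtain ⟨N, hN⟩ := f.2.2.2.2
  obtain ⟨g, hg, h⟩ := slice_order p q hN hP
  simp only [laurent, LinearMap.coe_mk, AddHom.coe_mk, Set.indicator_of_mem hP,
    Set.indicator_of_mem (modPt_mem_of_mem γ hP)]
  rw [zpow_add₀ h0, ← laurentCoeff_scale hg h r _ h0]
  congr 1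
  funext x
  rw [insertAt_modPt γ p q hP.1, zpow_natCast]
  exact hf.1 γ _ hP.1

/-! ### The grading of a conformal vertex algebra -/

section tensor

variable {V : Type*} [AddCommGroup V] [Module ℂ V] (Y : ConformalVertexAlgebra V)

theorem neg_one_pow_mul_choose_neg_two (j : ℕ) :
    (-1 : ℂ) ^ j * ((Ring.choose (-2 : ℤ) j : ℤ) : ℂ) = j + 1 := by
  have h1 : ∀ j : ℕ, Ring.choose (-1 : ℤ) j = (-1) ^ j := by
    intro j
    induction j with
    | zero => simp
    | succ j ih =>
      have := Ring.choose_succ_succ (-1 : ℤ) j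
      rw [neg_add_cancel, Ring.choose_zero_succ, ih] at this
      rw [pow_succ]
      linarith
  have h2 : ∀ j : ℕ, Ring.choose (-2 : ℤ) j = (-1) ^ j * (j + 1) := by
    intro j
    induction j with
    | zero => simp
    | succ j ih =>
      have := Ring.choose_succ_succ (-2 : ℤ) j
      rw [show (-2 + 1 : ℤ) = -1 by norm_num, h1, ih] at this
      push_cast
      rw [pow_succ] at this ⊢
      linarith
  rw [h2]
  push_cast
  rw [← mul_assoc, ← mul_pow]
  simp

/-- `(L_{-1}a)₍ₙ₎ = -n a₍ₙ₋₁₎`. -/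
theorem nprod_translation (n : ℤ) (a c : V) :
    Y.nprod n (Y.nprod 0 Y.conf a) c = (-n : ℂ) • Y.nprod (n - 1) a c := by
  have h := Y.borcherds (-2) 0 n a Y.vac c
  have hl : ∑ᶠ j : ℕ, ((Ring.choose (0 : ℤ) j : ℤ) : ℂ) •
      Y.nprod (0 + n - j) (Y.nprod (-2 + j) a Y.vac) c = Y.nprod n (Y.nprod (-2) a Y.vac) c := by
    rw [finsum_eq_single _ 0]
    · simp
    · intro j hj
      simp [Ring.choose_zero_pos _ (Nat.pos_of_ne_zero hj)]
  rw [hl] at h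
  rw [Y.translation, h]
  simp only [neg_one_pow_mul_choose_neg_two, Y.vacuum]
  rcases lt_trichotomy n 0 with hn | rfl | hn
  · obtain ⟨N, hN⟩ := Int.eq_ofNat_of_zero_le (show 0 ≤ -1 - n by omega)
    rw [finsum_eq_single _ N]
    · rw [if_pos (by omega), if_neg (by omega), smul_zero, sub_zero,
        show (0 + -2 - N : ℤ) = n - 1 by omega]
      congr 1
      have : (n : ℂ) = -1 - N := by
        rw [show n = -1 - N by omega]; push_cast; ring
      rw [this]; ring
    · intro j hj
      rw [if_neg (by omega), if_neg (by omega)]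
      simp
  · rw [finsum_eq_zero_of_forall_eq_zero]
    · simp
    · intro j
      rw [if_neg (by omega), if_neg (by omega)]
      simp
  · obtain ⟨N, hN⟩ := Int.eq_ofNat_of_zero_le (show 0 ≤ n - 1 by omega)
    rw [finsum_eq_single _ N]
    · rw [if_neg (by omega), if_pos (by omega), map_zero, zero_sub,
        show (0 + N : ℤ) = n - 1 by omega]
      have : (n : ℂ) = N + 1 := by
        rw [show n = N + 1 by omega]; push_cast; ring
      rw [this]
      simp
      module
    · intro j hj
      rw [if_neg (by omega), if_neg (by omega)]
      simp

/-- `[L_0, b₍ₙ₎] = (L_{-1}b)₍ₙ₊₁₎ + (L_0 b)₍ₙ₎`. -/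
theorem weight_commutator (n : ℤ) (b c : V) :
    Y.nprod 1 Y.conf (Y.nprod n b c) - Y.nprod n b (Y.nprod 1 Y.conf c) =
      Y.nprod (n + 1) (Y.nprod 0 Y.conf b) c + Y.nprod n (Y.nprod 1 Y.conf b) c := by
  have h := Y.borcherds 0 1 n Y.conf b c
  have hr : ∑ᶠ j : ℕ, ((-1 : ℂ) ^ j * ((Ring.choose (0 : ℤ) j : ℤ) : ℂ)) •
      (Y.nprod (1 + 0 - j) Y.conf (Y.nprod (n + j) b c) -
          (-1 : ℂ) ^ (0 : ℤ) • Y.nprod (n + 0 - j) b (Y.nprod (1 + j) Y.conf c)) =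
      Y.nprod 1 Y.conf (Y.nprod n b c) - Y.nprod n b (Y.nprod 1 Y.conf c) := by
    rw [finsum_eq_single _ 0]
    · simp
    · intro j hj
      simp [Ring.choose_zero_pos _ (Nat.pos_of_ne_zero hj)]
  rw [hr] at h
  rw [← h, finsum_eq_sum_of_support_subset (s := Finset.range 2)]
  · simp [Finset.sum_range_succ, add_comm]
  · intro j hj
    simp only [Finset.coe_range, Set.mem_Iio]
    by_contra hc
    refine hj ?_
    have : Ring.choose (1 : ℤ) j = 0 := by
      have := Ring.choose_natCast (R := ℤ) 1 j
      rw [Nat.cast_one] at this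
      rw [this, Nat.choose_eq_zero_of_lt (by omega), Nat.cast_zero]
    simp [this]

/-- The vectors of weight `d`, for arbitrary integers `d`. -/
def wt (d : ℤ) : Submodule ℂ V := Module.End.eigenspace (Y.nprod 1 Y.conf) (d : ℂ)

theorem mem_wt {d : ℤ} {v : V} : v ∈ wt Y d ↔ Y.nprod 1 Y.conf v = (d : ℂ) • v :=
  Module.End.mem_eigenspace_iff

theorem piece_le_wt (n : ℕ) : Y.piece n ≤ wt Y n := fun v hv => by
  rw [mem_wt, Y.weight n v hv, Int.cast_natCast]

theorem nprod_mem_wt {p q : ℤ} {a b : V} (ha : a ∈ wt Y p) (hb : b ∈ wt Y q) (n : ℤ) :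
    Y.nprod n a b ∈ wt Y (p + q - n - 1) := by
  have h := weight_commutator Y n a b
  rw [nprod_translation, (mem_wt Y).1 ha, (mem_wt Y).1 hb, map_smul, map_smul,
    LinearMap.smul_apply, add_sub_cancel_right] at h
  rw [mem_wt, eq_add_of_sub_eq h]
  push_cast
  module

theorem conf_mem_wt : Y.conf ∈ wt Y 2 := by
  have h0 := Y.creation 0 Y.conf
  have h2 := Y.creation 2 Y.conf
  have h := Y.virasoro 0 (-2) Y.vac
  norm_num at h0 h2 h
  rw [h0, h2, map_zero, sub_zero] at h
  rw [mem_wt, h]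
  simp

theorem vac_mem_wt : Y.vac ∈ wt Y 0 := by
  simpa [mem_wt] using Y.creation 2 Y.conf

theorem exists_pieces (v : V) : ∃ u : ℕ →₀ V, (∀ n, u n ∈ Y.piece n) ∧ (u.sum fun _ x => x) = v := by
  have h : v ∈ ⨆ n, Y.piece n := by
    rw [Y.decomposition.submodule_iSup_eq_top]; trivial
  exact (Submodule.mem_iSup_iff_exists_finsupp _ _).1 h

/-- Scaling of the vectors of weight `d` by `c^d`. -/
def scale (c : ℂ) : V →ₗ[ℂ] V :=
  (DirectSum.toModule ℂ ℕ V fun n => c ^ n • (Y.piece n).subtype) ∘ₗ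
    (LinearEquiv.ofBijective (DirectSum.coeLinearMap Y.piece) Y.decomposition).symm.toLinearMap

theorem scale_of_mem_piece (c : ℂ) {n : ℕ} {v : V} (hv : v ∈ Y.piece n) :
    scale Y c v = c ^ n • v := by
  have : (LinearEquiv.ofBijective (DirectSum.coeLinearMap Y.piece) Y.decomposition).symm v =
      DirectSum.lof ℂ ℕ (fun n => Y.piece n) n ⟨v, hv⟩ := by
    rw [LinearEquiv.symm_apply_eq]
    exact (DirectSum.coeLinearMap_lof Y.piece n ⟨v, hv⟩).symm
  simp [scale, this]

variable {Y} in
theorem exists_pieces_of_mem_wt {d : ℤ} {v : V} (hv : v ∈ wt Y d) : ∃ u : ℕ →₀ V,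
    (∀ n, u n ∈ Y.piece n) ∧ (u.sum fun _ x => x) = v ∧ ∀ n : ℕ, (n : ℤ) = d ∨ u n = 0 := by
  rw [mem_wt] at hv
  obtain ⟨u, hu, rfl⟩ := exists_pieces Y v
  refine ⟨u, hu, rfl, fun n => ?_⟩
  have key : ((n : ℂ) - d) • u n = 0 := by
    have hind := (iSupIndep_iff_finsetSum_eq_zero_imp_eq_zero _).1
      Y.decomposition.submodule_iSupIndep
    have hs : (∑ n ∈ u.support, ((n : ℂ) - d) • u n) = 0 := by
      simp only [sub_smul, Finset.sum_sub_distrib]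
      rw [sub_eq_zero, ← Finset.smul_sum]
      rw [Finsupp.sum, map_sum] at hv
      rw [← hv]
      exact Finset.sum_congr rfl fun n _ => (Y.weight n _ (hu n)).symm
    by_cases hn : n ∈ u.support
    · exact hind u.support _ (fun n _ => Submodule.smul_mem _ _ (hu n)) hs n hn
    · rw [Finsupp.notMem_support_iff.1 hn, smul_zero]
  refine (smul_eq_zero.1 key).imp_left fun h => ?_
  exact_mod_cast sub_eq_zero.1 h

theorem mem_piece_of_mem_wt {n : ℕ} {v : V} (hv : v ∈ wt Y n) : v ∈ Y.piece n := by
  obtain ⟨u, hu, rfl, h⟩ := exists_pieces_of_mem_wt hv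
  refine Submodule.sum_mem _ fun k _ => ?_
  rcases h k with h | h
  · rw [← Int.natCast_inj.1 h]
    exact hu k
  · rw [h]
    exact zero_mem _

theorem scale_of_mem_wt (c : ℂ) {d : ℤ} {v : V} (hv : v ∈ wt Y d) :
    scale Y c v = c ^ d • v := by
  obtain ⟨u, hu, rfl, h⟩ := exists_pieces_of_mem_wt hv
  rw [Finsupp.sum, map_sum, Finset.smul_sum]
  refine Finset.sum_congr rfl fun n _ => ?_
  rcases h n with h | h
  · rw [scale_of_mem_piece Y c (hu n), ← h, zpow_natCast]
  · simp [h]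

end tensor

section tensor
variable {V : Type*} [AddCommGroup V] [Module ℂ V] (Y : ConformalVertexAlgebra V)

/-! ### Conformal degree -/

/-- The elements of conformal degree `p` in `V^{⊗m} ⊗ {functions}`: the span of the tensors
`a_1 ⊗ … ⊗ a_m ⊗ f` with `a_i` of weight `Δ_i`, `f` modular of weight `w` and `w + ∑ Δ_i = p`. -/
def AmbDeg (m : ℕ) (p : ℤ) : Submodule ℂ (Amb V m) :=
  Submodule.span ℂ {z | ∃ (a : Fin m → V) (Δ : Fin m → ℤ) (f : Pt m → ℂ) (w : ℤ),
    (∀ i, a i ∈ wt Y (Δ i)) ∧ IsModular w f ∧ w + ∑ i, Δ i = p ∧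
      z = PiTensorProduct.tprod ℂ a ⊗ₜ f}

variable {Y} in
theorem tprod_tmul_mem {m : ℕ} {p : ℤ} {a : Fin m → V} {Δ : Fin m → ℤ} {f : Pt m → ℂ} {w : ℤ}
    (ha : ∀ i, a i ∈ wt Y (Δ i)) (hf : IsModular w f) (hp : w + ∑ i, Δ i = p) :
    (PiTensorProduct.tprod ℂ a ⊗ₜ f : Amb V m) ∈ AmbDeg Y m p :=
  Submodule.subset_span ⟨a, Δ, f, w, ha, hf, hp, rfl⟩

/-- A linear map on chains shifts conformal degrees by `d` if it does so on pure tensors. -/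
theorem map_mem_ambDeg {m n p : ℕ} (d : ℤ) (T : Chain V m →ₗ[ℂ] Amb V n)
    (hT : ∀ (a : Fin m → V) (Δ : Fin m → ℤ) (f : Ell m) (k : ℕ), (∀ i, a i ∈ wt Y (Δ i)) →
      IsJacobi k f → k + ∑ i, Δ i = (p : ℤ) →
      T (PiTensorProduct.tprod ℂ a ⊗ₜ f) ∈ AmbDeg Y n (k + ∑ i, Δ i + d))
    {z : Chain V m} (hz : z ∈ JChainDeg Y m p) : T z ∈ AmbDeg Y n (p + d) := by
  have : JChainDeg Y m p ≤ (AmbDeg Y n (p + d)).comap T := by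
    refine Submodule.span_le.2 ?_
    rintro _ ⟨a, Δ, f, k, ha, hf, rfl, rfl⟩
    have := hT a (fun i => Δ i) f k (fun i => piece_le_wt Y _ (ha i)) hf (by push_cast; rfl)
    simpa using this
  exact this hz

theorem actAt_tprod {m : ℕ} (i : Fin m) (φ : V →ₗ[ℂ] V) (a : Fin m → V) :
    actAt i φ (PiTensorProduct.tprod ℂ a) =
      PiTensorProduct.tprod ℂ (Function.update a i (φ (a i))) := by
  rw [actAt, PiTensorProduct.map_tprod]
  congr 1
  funext r
  by_cases h : r = i
  · subst h; simp
  · simp [h]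

variable {Y} in
theorem update_mem_wt {m : ℕ} {a : Fin m → V} {Δ : Fin m → ℤ} (ha : ∀ i, a i ∈ wt Y (Δ i))
    (i : Fin m) {x : V} {d : ℤ} (hx : x ∈ wt Y d) (r : Fin m) :
    Function.update a i x r ∈ wt Y (Function.update Δ i d r) := by
  by_cases h : r = i
  · subst h; simpa using hx
  · simpa [h] using ha r

theorem sum_update_add {m : ℕ} (Δ : Fin m → ℤ) (i : Fin m) (x : ℤ) :
    ∑ r, Function.update Δ i (Δ i + x) r = ∑ r, Δ r + x := by
  rw [Finset.sum_update_of_mem (Finset.mem_univ i), ← Finset.add_sum_erase _ Δ (Finset.mem_univ i),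
    Finset.sdiff_singleton_eq_erase]
  ring

theorem incl_mem_ambDeg {m p : ℕ} {z : Chain V m} (hz : z ∈ JChainDeg Y m p) :
    incl z ∈ AmbDeg Y m p := by
  have := map_mem_ambDeg Y 0 incl (fun a Δ f k ha hf _ => by
    rw [incl, LinearMap.lTensor_tmul]
    exact tprod_tmul_mem ha hf.isModular (by ring)) hz
  simpa using this

theorem resid_mem_ambDeg {m p : ℕ} (r : Fin (m + 1)) (q : Fin m) (s : ℤ) {z : Chain V (m + 1)}
    (hz : z ∈ JChainDeg Y (m + 1) p) : resid Y r q s z ∈ AmbDeg Y m (p + (-1 - s)) := by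
  refine map_mem_ambDeg Y _ _ (fun a Δ f k ha hf _ => ?_) hz
  simp only [resid, locSum, LinearMap.coe_mk, AddHom.coe_mk, TensorProduct.map_tmul]
  refine finsum_induction (· ∈ AmbDeg Y m _) (zero_mem _) (fun _ _ => add_mem) fun l => ?_
  rw [contract_tprod]
  have hx := nprod_mem_wt Y (ha r) (ha (r.succAbove q)) l
  rw [show Δ r + Δ (r.succAbove q) - l - 1 = Δ (r.succAbove q) + (Δ r - l - 1) by ring] at hx
  refine tprod_tmul_mem (update_mem_wt (fun i => ha (r.succAbove i)) q hx)
    (hf.laurent_isModular r q (l - s)) ?_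
  rw [sum_update_add (fun i => Δ (r.succAbove i)), Fin.sum_univ_succAbove Δ r]
  ring

theorem d1_mem_ambDeg {n p : ℕ} {z : Chain V (n + 1)} (hz : z ∈ JChainDeg Y (n + 1) p) :
    d1 Y n z ∈ AmbDeg Y n (p + -1) := by
  rw [d1, LinearMap.sum_apply]
  exact Submodule.sum_mem _ fun i _ => by simpa using resid_mem_ambDeg Y 0 i 0 hz

theorem d2_mem_ambDeg {n p : ℕ} {z : Chain V (n + 2)} (hz : z ∈ JChainDeg Y (n + 2) p) :
    d2 Y n z ∈ AmbDeg Y (n + 1) (p + -1) := by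
  rw [d2, LinearMap.sub_apply, LinearMap.sum_apply, LinearMap.sum_apply]
  exact sub_mem (Submodule.sum_mem _ fun i _ => by simpa using resid_mem_ambDeg Y 1 i.succ 0 hz)
    (Submodule.sum_mem _ fun i _ => by simpa using resid_mem_ambDeg Y 0 i 0 hz)

theorem transl_mem_ambDeg {m p : ℕ} (j : Fin m) {z : Chain V m} (hz : z ∈ JChainDeg Y m p) :
    transl Y j z ∈ AmbDeg Y m (p + 1) := by
  refine map_mem_ambDeg Y _ _ (fun a Δ f k ha hf _ => ?_) hz
  rw [transl, LinearMap.add_apply, TensorProduct.map_tmul, LinearMap.lTensor_tmul, actAt_tprod]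
  have hx := nprod_mem_wt Y (conf_mem_wt Y) (ha j) 0
  rw [show 2 + Δ j - 0 - 1 = Δ j + 1 by ring] at hx
  refine add_mem (tprod_tmul_mem (update_mem_wt ha j hx) hf.isModular ?_)
    (tprod_tmul_mem ha (hf.pd_isModular j) (by ring))
  rw [sum_update_add]
  ring

theorem permChain_mem_ambDeg {n p : ℕ} (σ : Equiv.Perm (Fin n)) {z : Chain V (n + 1)}
    (hz : z ∈ JChainDeg Y (n + 1) p) : permChain σ z ∈ AmbDeg Y (n + 1) p := by
  have := map_mem_ambDeg Y 0 (permChain σ) (fun a Δ f k ha hf _ => by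
    rw [permChain_tmul]
    refine tprod_tmul_mem (Δ := fun i => Δ (fixZero σ i)) (w := k) (fun i => ha _) ⟨?_, ?_⟩ ?_
    · exact fun P hP => ell_eq_zero_of_im_nonpos f hP
    · exact fun γ P hP => hf.isModular.2 γ (fun i => P.1 ((fixZero σ).symm i), P.2) hP
    · rw [Equiv.sum_comp (fixZero σ) Δ, add_zero]) hz
  simpa using this

theorem mulTail_mem_ambDeg {n p k : ℕ} {φ : Ell n} (hφ : IsJacobi k φ) {z : Chain V (n + 1)}
    (hz : z ∈ JChainDeg Y (n + 1) p) : mulTail φ.1 (incl z) ∈ AmbDeg Y (n + 1) (p + k) := by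
  refine map_mem_ambDeg Y _ (mulTail φ.1 ∘ₗ incl) (fun a Δ f l ha hf _ => ?_) hz
  rw [LinearMap.comp_apply, incl, LinearMap.lTensor_tmul, mulTail, LinearMap.lTensor_tmul]
  refine tprod_tmul_mem ha (IsModular.mul (v := k) (fun γ P hP => ?_) hf.isModular) (by ring)
  exact hφ.isModular.2 γ (Fin.tail P.1, P.2) hP

/-! ### The connection on homogeneous cycles -/

theorem finsum_sub_mem {M : Type*} [AddCommGroup M] [Module ℂ M] (S : Submodule ℂ M) {F : ℕ → M}
    (hF : (Function.support F).Finite) {g : M} (h0 : F 0 - g ∈ S) (h : ∀ k, F (k + 1) ∈ S) :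
    ∑ᶠ k, F k - g ∈ S := by
  obtain ⟨N, hN⟩ := hF.bddAbove
  rw [finsum_eq_sum_of_support_subset (s := Finset.range (N + 1)), Finset.sum_range_succ',
    add_sub_assoc]
  · exact add_mem (Submodule.sum_mem _ fun k _ => h k) h0
  · intro k hk
    simpa [Nat.lt_succ_iff] using hN hk

/-- If all but the first of the functions `h_k` are modular of weight `e(k) + 1`, and the first one
is so up to `ε g_2`, then a sum of modes of `ω` at the `i`-th factor is homogeneous up to the operator
`ε L_0 g_2`. -/
theorem modeSum_mem_ambDeg {m : ℕ} (i : Fin m) (e : ℕ → ℕ) (he : StrictMono e)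
    (h : ℕ → Pt m → ℂ) (e0 : e 0 = 1) (ε : ℂ)
    (h0 : ∀ (γ : SL2Z) (P : Pt m), 0 < P.2.im → h 0 (modPt γ P) - ε * eis 1 (modPt γ P).2 =
      autFactor γ P.2 ^ (2 : ℤ) * (h 0 P - ε * eis 1 P.2))
    (hk : ∀ (k : ℕ) (γ : SL2Z) (P : Pt m), 0 < P.2.im →
      h (k + 1) (modPt γ P) = autFactor γ P.2 ^ (e (k + 1) + 1 : ℤ) * h (k + 1) P)
    {a : Fin m → V} {Δ : Fin m → ℤ} (ha : ∀ i, a i ∈ wt Y (Δ i)) {f : Ell m} {k : ℕ}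
    (hf : IsJacobi k f) :
    modeSum Y Y.conf i e he h (PiTensorProduct.tprod ℂ a ⊗ₜ f) -
      (Δ i * ε : ℂ) • (PiTensorProduct.tprod ℂ a ⊗ₜ[ℂ] mulFun (fun P => eis 1 P.2) f.1) ∈
      AmbDeg Y m (k + ∑ i, Δ i + 2) := by
  obtain ⟨K, hK⟩ := actAt_eventually_zero Y i Y.conf (PiTensorProduct.tprod ℂ a)
  simp only [modeSum, locSum, LinearMap.coe_mk, AddHom.coe_mk, TensorProduct.map_tmul,
    LinearMap.comp_apply, Submodule.subtype_apply]
  refine finsum_sub_mem _ ?_ ?_ fun l => ?_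
  · refine (Set.finite_Iio K.toNat).subset fun l hl => ?_
    rw [Function.mem_support] at hl
    by_contra hc
    have := he.le_apply (x := l)
    exact hl (by rw [hK _ (by simp at hc; omega), TensorProduct.zero_tmul])
  · have h1 : IsModular (k + 2) (mulFun (h 0) f.1 - ε • mulFun (fun P => eis 1 P.2) f.1) := by
      convert IsModular.mul (v := 2) (g := fun P => h 0 P - ε * eis 1 P.2)
        (fun γ P hP => h0 γ P hP) hf.isModular using 1
      funext P
      simp [mulFun]
      ring
    have h2 := tprod_tmul_mem ha h1 (p := k + ∑ i, Δ i + 2) (by ring)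
    convert Submodule.smul_mem _ (Δ i : ℂ) h2 using 1
    rw [e0, Nat.cast_one, actAt_tprod, (mem_wt Y).1 (ha i), MultilinearMap.map_update_smul,
      Function.update_eq_self, TensorProduct.tmul_sub, TensorProduct.tmul_smul, smul_sub, smul_smul]
    rfl
  · rw [actAt_tprod]
    have hx := nprod_mem_wt Y (conf_mem_wt Y) (ha i) (e (l + 1))
    rw [show 2 + Δ i - e (l + 1) - 1 = Δ i + (1 - e (l + 1)) by ring] at hx
    refine tprod_tmul_mem (update_mem_wt ha i hx)
      (IsModular.mul (fun γ P hP => hk l γ P hP) hf.isModular) ?_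
    rw [sum_update_add]
    ring

theorem wpBar_two_modular {m : ℕ} (γ : SL2Z) {P : Pt m} (hP : 0 < P.2.im) (i j : Fin m) :
    wpBar 2 ((modPt γ P).1 i - (modPt γ P).1 j) (modPt γ P).2 - 1 * eis 1 (modPt γ P).2 =
      autFactor γ P.2 ^ (2 : ℤ) * (wpBar 2 (P.1 i - P.1 j) P.2 - 1 * eis 1 P.2) := by
  have := wp_modular γ hP 2 (P.1 i - P.1 j)
  simp only [wpBar, if_true, one_mul, add_sub_cancel_right]
  rw [zpow_ofNat, ← this, sub_div]
  rfl

theorem wp_modular_sub {m : ℕ} (γ : SL2Z) {P : Pt m} (hP : 0 < P.2.im) (k : ℕ) (i j : Fin m) :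
    wp k ((modPt γ P).1 i - (modPt γ P).1 j) (modPt γ P).2 =
      autFactor γ P.2 ^ k * wp k (P.1 i - P.1 j) P.2 := by
  have := wp_modular γ hP k (P.1 i - P.1 j)
  rw [← this, sub_div]
  rfl

/-- Multiplication by `g_2`. -/
def mulEis (m : ℕ) : Amb V m →ₗ[ℂ] Amb V m := LinearMap.lTensor _ (mulFun fun P => eis 1 P.2)

/-- On a cycle of degree `p`, the connection `∇_τ` is homogeneous of degree `2` up to the
anomalous term `-(p - 1) g_2`. In terms of the weight `k` of `f` and the weights `Δ_i` of the `a_i`,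
the contributions to this term are `-k` from `D_τ`, `1` from `℘_2(t_n - t_0) + g_2`, and `-Δ_i` from
the modes of `ω` at the factor `a_i`. -/
theorem nabla_mem_ambDeg {m p : ℕ} {z : Chain V (m + 2)} (hz : z ∈ JChainDeg Y (m + 2) p)
    (hd : d1 Y (m + 1) z = 0) :
    nabla Y m z + ((p : ℂ) - 1) • mulEis (m + 2) (incl z) ∈ AmbDeg Y (m + 2) (p + 2) := by
  -- `∇_τ + (p - 1) g_2` without the term that vanishes on cycles; it can be treated tensor by
  -- tensor
  let N : Chain V (m + 2) →ₗ[ℂ] Amb V (m + 2) := nabla Y m + TensorProduct.map (prepend Y.conf)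
    (mulFun (fun P : Pt (m + 2) => zetaW (P.1 0 - P.1 (Fin.last (m + 1))) P.2) ∘ₗ
      LinearMap.funLeft ℂ ℂ (fun P : Pt (m + 2) => ((Fin.tail P.1, P.2) : Pt (m + 1)))) ∘ₗ
    d1 Y (m + 1) + ((p : ℂ) - 1) • mulEis (m + 2) ∘ₗ incl
  have hN : N z = nabla Y m z + ((p : ℂ) - 1) • mulEis (m + 2) (incl z) := by
    simp [N, hd]
  rw [← hN]
  refine map_mem_ambDeg Y 2 N (fun a Δ f k ha hf hp => ?_) hz
  have hpc : (p : ℂ) = k + ∑ i, (Δ i : ℂ) := by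
    have := congrArg (Int.cast (R := ℂ)) hp
    push_cast at this
    exact this.symm
  set x : Amb V (m + 2) := PiTensorProduct.tprod ℂ a ⊗ₜ[ℂ] mulFun (fun P => eis 1 P.2) f.1 with hx
  have h1 : LinearMap.lTensor _ dTau (PiTensorProduct.tprod ℂ a ⊗ₜ f) + (k : ℂ) • x ∈
      AmbDeg Y (m + 2) (k + ∑ i, Δ i + 2) := by
    rw [LinearMap.lTensor_tmul, hx, ← TensorProduct.tmul_smul, ← TensorProduct.tmul_add]
    exact tprod_tmul_mem ha hf.dTau_isModular (by ring)
  have h2 : TensorProduct.map (actAt (Fin.last (m + 1)) (Y.nprod (-1) Y.conf))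
      (Ell (m + 2)).subtype (PiTensorProduct.tprod ℂ a ⊗ₜ f) ∈
      AmbDeg Y (m + 2) (k + ∑ i, Δ i + 2) := by
    rw [TensorProduct.map_tmul, actAt_tprod]
    have hx := nprod_mem_wt Y (conf_mem_wt Y) (ha (Fin.last (m + 1))) (-1)
    rw [show 2 + Δ (Fin.last (m + 1)) - -1 - 1 = Δ (Fin.last (m + 1)) + 2 by ring] at hx
    refine tprod_tmul_mem (update_mem_wt ha _ hx) hf.isModular ?_
    rw [sum_update_add]
    ring
  have h3 := modeSum_mem_ambDeg Y (Fin.last (m + 1)) (fun k => 2 * k + 1)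
    (fun _ _ h => by simpa using h) (fun k P => eis (k + 1) P.2) rfl 1
    (fun γ P hP => by simp) (fun l γ P hP => by
      have := eis_modular γ hP (k := l + 1 + 1) (by omega)
      refine this.trans ?_
      rw [← zpow_natCast]
      congr 2) ha hf
  have h4 : LinearMap.lTensor _
      (mulFun (fun P => wpBar 2 (P.1 (Fin.last (m + 1)) - P.1 0) P.2) ∘ₗ (Ell (m + 2)).subtype)
      (PiTensorProduct.tprod ℂ a ⊗ₜ f) - x ∈ AmbDeg Y (m + 2) (k + ∑ i, Δ i + 2) := by
    rw [LinearMap.lTensor_tmul, hx, ← TensorProduct.tmul_sub]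
    refine tprod_tmul_mem ha (w := k + 2) ?_ (by ring)
    convert IsModular.mul (v := 2)
      (g := fun P => wpBar 2 (P.1 (Fin.last (m + 1)) - P.1 0) P.2 - 1 * eis 1 P.2)
      (fun γ P hP => wpBar_two_modular γ hP (Fin.last (m + 1)) 0)
      hf.isModular using 1
    funext P
    simp [mulFun]
    ring
  have h5 : ∀ i : Fin (m + 1), _ := fun i => modeSum_mem_ambDeg Y i.castSucc (fun k => k + 1)
    (fun _ _ h => by simpa using h)
    (fun k P => wpBar (k + 2) (P.1 (Fin.last (m + 1)) - P.1 i.castSucc) P.2) rfl 1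
    (fun γ P hP => wpBar_two_modular γ hP _ _) (fun l γ P hP => by
      simp only [wpBar, if_neg (show l + 1 + 2 ≠ 2 by omega)]
      rw [wp_modular_sub γ hP, ← zpow_natCast]
      congr 2) ha hf
  have h6 := Submodule.sum_mem _ fun i (_ : i ∈ Finset.univ) => h5 i
  rw [Finset.sum_sub_distrib, ← Finset.sum_smul] at h6
  have h := sub_mem (add_mem (sub_mem (add_mem h1 h2) h3) h4) h6
  convert h using 1
  have hs : ∑ i : Fin (m + 2), (Δ i : ℂ) = ∑ i : Fin (m + 1), (Δ i.castSucc : ℂ) +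
      Δ (Fin.last (m + 1)) := Fin.sum_univ_castSucc _
  simp only [N, nabla, LinearMap.add_apply, LinearMap.sub_apply, LinearMap.smul_apply,
    LinearMap.sum_apply, LinearMap.comp_apply, sub_add_cancel, mulEis, incl,
    LinearMap.lTensor_tmul, Submodule.subtype_apply, mul_one]
  rw [← hx, hpc, hs]
  module

end tensor

/-! ### Algebraic independence of the automorphy factors -/

theorem coeff_eq_zero_of_infinite {ι : Type*} {s : Finset ι} {e : ι → ℕ} (he : Set.InjOn e s)
    (a : ι → ℂ) {S : Set ℂ} (hS : S.Infinite) (h : ∀ x ∈ S, ∑ i ∈ s, a i * x ^ e i = 0) :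
    ∀ i ∈ s, a i = 0 := by
  have h0 : (∑ i ∈ s, Polynomial.monomial (e i) (a i)) = 0 := by
    refine Polynomial.eq_zero_of_infinite_isRoot _ (hS.mono fun x hx => ?_)
    simpa [Polynomial.IsRoot, Polynomial.eval_finsetSum] using h x hx
  intro i hi
  have h1 := congrArg (fun f => Polynomial.coeff f (e i)) h0
  simp only [Polynomial.finsetSum_coeff, Polynomial.coeff_monomial, Polynomial.coeff_zero] at h1
  rwa [Finset.sum_eq_single_of_mem i hi fun j hj hji => if_neg fun hh => hji (he hj hi hh),
    if_pos rfl] at h1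

/-- The quantities `j = cτ+d` and `j² g - κ c j`, for `(c, d)` the lower row of a matrix in
`SL(2, ℤ)`, satisfy no polynomial relation. -/
theorem coeff_eq_zero_of_modular {τ : ℂ} (hτ : 0 < τ.im) (g : ℂ) {κ : ℂ} (hκ : κ ≠ 0)
    (L : Finset ℕ) (Q : Finset ℤ) (y : ℕ → ℤ → ℂ)
    (h : ∀ γ : SL2Z, ∑ l ∈ L, ∑ q ∈ Q, (autFactor γ τ ^ 2 * g - κ * γ 1 0 * autFactor γ τ) ^ l *
      autFactor γ τ ^ q * y l q = 0) :
    ∀ l ∈ L, ∀ q ∈ Q, y l q = 0 := by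
  obtain ⟨M, hM⟩ : ∃ M : ℤ, ∀ q ∈ Q, 0 ≤ q + M := by
    obtain ⟨B, hB⟩ := Q.bddBelow
    exact ⟨-B, fun q hq => by have := hB hq; omega⟩
  have hpow : ∀ q ∈ Q, ∀ x : ℂ, x ≠ 0 → x ^ (q + M).toNat = x ^ q * x ^ M := by
    intro q hq x hx
    rw [← zpow_add₀ hx, ← zpow_natCast, Int.toNat_of_nonneg (hM q hq)]
  -- for fixed `c`, the relation holds for infinitely many `j`, hence for all
  have h1 : ∀ (c : ℕ) (x : ℂ), c ≠ 0 →
      ∑ l ∈ L, ∑ q ∈ Q, (x ^ 2 * g - κ * c * x) ^ l * x ^ (q + M).toNat * y l q = 0 := by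
    intro c x hc
    let F : Polynomial ℂ := ∑ l ∈ L, ∑ q ∈ Q,
      (Polynomial.X ^ 2 * Polynomial.C g - Polynomial.C (κ * c) * Polynomial.X) ^ l *
        Polynomial.X ^ (q + M).toNat * Polynomial.C (y l q)
    have hF : ∀ x, F.eval x =
        ∑ l ∈ L, ∑ q ∈ Q, (x ^ 2 * g - κ * c * x) ^ l * x ^ (q + M).toNat * y l q := by
      intro x
      simp only [F, Polynomial.eval_finsetSum, Polynomial.eval_mul, Polynomial.eval_pow,
        Polynomial.eval_sub, Polynomial.eval_X, Polynomial.eval_C]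
    have hF0 : F = 0 := by
      refine Polynomial.eq_zero_of_infinite_isRoot _ ((Set.infinite_range_of_injective
        (f := fun n : ℕ => c * τ + (1 + n * c)) fun n n' hn => ?_).mono ?_)
      · have hc' : (c : ℂ) ≠ 0 := by exact_mod_cast hc
        simpa [hc'] using hn
      · rintro _ ⟨n, rfl⟩
        let γ : SL2Z := ⟨!![1, n; c, 1 + n * c], by rw [Matrix.det_fin_two_of]; ring⟩
        have hj : autFactor γ τ = c * τ + (1 + n * c) := by simp [autFactor, γ]
        have hc1 : ((γ 1 0 : ℤ) : ℂ) = c := by simp [γ]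
        have hx := autFactor_ne_zero γ hτ
        have := h γ
        rw [hc1, hj] at this
        rw [hj] at hx
        change F.eval _ = 0
        rw [hF]
        calc _ = (∑ l ∈ L, ∑ q ∈ Q, ((c * τ + (1 + n * c)) ^ 2 * g -
              κ * c * (c * τ + (1 + n * c))) ^ l * (c * τ + (1 + n * c)) ^ q * y l q) *
                (c * τ + (1 + n * c)) ^ M := by
              rw [Finset.sum_mul]
              refine Finset.sum_congr rfl fun l _ => ?_
              rw [Finset.sum_mul]
              refine Finset.sum_congr rfl fun q hq => ?_
              rw [hpow q hq _ hx]
              ring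
          _ = 0 := by rw [this, zero_mul]
    rw [← hF, hF0, Polynomial.eval_zero]
  -- for fixed `j`, it is polynomial in `j² g - κ c j`, which takes infinitely many values
  have h2 : ∀ (x : ℂ), x ≠ 0 → ∀ l ∈ L, ∑ q ∈ Q, y l q * x ^ (q + M).toNat = 0 := by
    intro x hx
    refine coeff_eq_zero_of_infinite (e := id) (Set.injOn_id _) _ (Set.infinite_range_of_injective
      (f := fun c : ℕ => x ^ 2 * g - κ * ((c + 1 : ℕ) : ℂ) * x) fun n n' hn => ?_) ?_
    · simpa [hκ, hx] using hn
    · rintro _ ⟨c, rfl⟩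
      rw [← h1 (c + 1) x (by omega)]
      refine Finset.sum_congr rfl fun l _ => ?_
      rw [Finset.sum_mul]
      exact Finset.sum_congr rfl fun q _ => by simp only [id]; ring
  intro l hl
  refine coeff_eq_zero_of_infinite (e := fun q => (q + M).toNat) (fun q hq q' hq' hh => ?_) _
    (Set.infinite_range_of_injective (f := fun n : ℕ => ((n + 1 : ℕ) : ℂ)) fun n n' hn => ?_) ?_
  · have := hM q hq
    have := hM q' hq'
    simp only at hh
    omega
  · simpa using hn
  · rintro _ ⟨n, rfl⟩
    exact h2 _ (Nat.cast_ne_zero.2 n.succ_ne_zero) l hl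

section tensor
variable {V : Type*} [AddCommGroup V] [Module ℂ V] (Y : ConformalVertexAlgebra V)

/-! ### Independence of the conformal degrees -/

/-- The value at `P` of an element of `V^{⊗m} ⊗ {functions}`. -/
def evalAt {m : ℕ} (P : Pt m) : Amb V m →ₗ[ℂ] ⨂[ℂ]^m V :=
  (TensorProduct.rid ℂ _).toLinearMap ∘ₗ LinearMap.lTensor _ (LinearMap.proj P)

theorem evalAt_tmul {m : ℕ} (P : Pt m) (x : ⨂[ℂ]^m V) (f : Pt m → ℂ) :
    evalAt P (x ⊗ₜ[ℂ] f) = f P • x := by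
  simp [evalAt]

theorem evalAt_lTensor_mulFun {m : ℕ} (P : Pt m) (h : Pt m → ℂ) (z : Amb V m) :
    evalAt P (LinearMap.lTensor _ (mulFun h) z) = h P • evalAt P z := by
  induction z using TensorProduct.induction_on with
  | zero => simp
  | tmul x f =>
    rw [LinearMap.lTensor_tmul, evalAt_tmul, evalAt_tmul, smul_smul]
    rfl
  | add x y hx hy => simp only [map_add, hx, hy, smul_add]

theorem eq_zero_of_evalAt {m : ℕ} {z : Amb V m} (h : ∀ P, evalAt P z = 0) : z = 0 := by
  let b := Module.Free.chooseBasis ℂ (⨂[ℂ]^m V)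
  have key : ∀ (z : Amb V m) i P,
      (TensorProduct.equivFinsuppOfBasisLeft b z) i P = b.repr (evalAt P z) i := by
    intro z i P
    induction z using TensorProduct.induction_on with
    | zero => simp
    | tmul x f =>
      rw [evalAt_tmul, TensorProduct.equivFinsuppOfBasisLeft_apply_tmul_apply]
      simp [mul_comm]
    | add x y hx hy => simp only [map_add, Finsupp.add_apply, Pi.add_apply, hx, hy]
  refine (TensorProduct.equivFinsuppOfBasisLeft b).injective (Finsupp.ext fun i => funext fun P => ?_)
  rw [key, h P]
  simp

theorem evalAt_of_mem_ambDeg {m : ℕ} {p : ℤ} {z : Amb V m} (hz : z ∈ AmbDeg Y m p) {P : Pt m}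
    (hP : ¬ 0 < P.2.im) : evalAt P z = 0 := by
  have : AmbDeg Y m p ≤ LinearMap.ker (evalAt P) := by
    refine Submodule.span_le.2 ?_
    rintro _ ⟨a, Δ, f, w, ha, hf, -, rfl⟩
    simp [evalAt_tmul, hf.1 P hP]
  exact this hz

/-- The transformation law of elements of conformal degree `p`. -/
theorem scale_evalAt_modPt {m : ℕ} {p : ℤ} {z : Amb V m} (hz : z ∈ AmbDeg Y m p) (γ : SL2Z)
    {P : Pt m} (hP : 0 < P.2.im) :
    PiTensorProduct.map (fun _ => scale Y (autFactor γ P.2)) (evalAt (modPt γ P) z) =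
      autFactor γ P.2 ^ p • evalAt P z := by
  have h0 := autFactor_ne_zero γ hP
  have : AmbDeg Y m p ≤ LinearMap.eqLocus
      (PiTensorProduct.map (fun _ => scale Y (autFactor γ P.2)) ∘ₗ evalAt (modPt γ P))
      (autFactor γ P.2 ^ p • evalAt P) := by
    refine Submodule.span_le.2 ?_
    rintro _ ⟨a, Δ, f, w, ha, hf, rfl, rfl⟩
    simp only [SetLike.mem_coe, LinearMap.mem_eqLocus, LinearMap.comp_apply, LinearMap.smul_apply,
      evalAt_tmul, map_smul, PiTensorProduct.map_tprod, scale_of_mem_wt Y _ (ha _), hf.2 γ P hP]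
    rw [MultilinearMap.map_smul_univ, smul_smul, smul_smul, zpow_add₀ h0]
    congr 1
    rw [show autFactor γ P.2 ^ (∑ i, Δ i) = ∏ i, autFactor γ P.2 ^ Δ i from ?_]
    · ring
    · induction (Finset.univ : Finset (Fin m)) using Finset.induction_on with
      | empty => simp
      | insert x s hx ih => rw [Finset.sum_insert hx, Finset.prod_insert hx, zpow_add₀ h0, ih]
  exact this hz

/-- Homogeneous elements are linearly independent over the polynomials in `g_2`. -/
theorem eq_zero_of_sum_eis {m : ℕ} (L : Finset ℕ) (Q : Finset ℤ) (u : ℕ → ℤ → Amb V m)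
    (hu : ∀ l q, u l q ∈ AmbDeg Y m q)
    (h : ∑ l ∈ L, ∑ q ∈ Q, LinearMap.lTensor _ (mulFun fun P => eis 1 P.2 ^ l) (u l q) = 0) :
    ∀ l ∈ L, ∀ q ∈ Q, u l q = 0 := by
  intro l hl q hq
  refine eq_zero_of_evalAt fun P => ?_
  by_cases hP : 0 < P.2.im
  · rw [← Module.forall_dual_apply_eq_zero_iff ℂ]
    intro φ
    refine coeff_eq_zero_of_modular hP (eis 1 P.2) Complex.two_pi_I_ne_zero L Q
      (fun l q => φ (evalAt P (u l q))) (fun γ => ?_) l hl q hq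
    have h1 := congrArg (fun x => φ (PiTensorProduct.map (fun _ => scale Y (autFactor γ P.2))
      (evalAt (modPt γ P) x))) h
    simp only [map_sum, evalAt_lTensor_mulFun, map_smul, map_zero,
      scale_evalAt_modPt Y (hu _ _) γ hP] at h1
    rw [← h1]
    refine Finset.sum_congr rfl fun l _ => Finset.sum_congr rfl fun q _ => ?_
    have he : eis 1 (modPt γ P).2 = _ := eis_one_modular γ hP
    rw [he, smul_eq_mul, smul_eq_mul]
    ring
  · exact evalAt_of_mem_ambDeg Y (hu l q) hP

theorem mulFun_eis_pow_zero {m : ℕ} :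
    (mulFun fun P : Pt m => eis 1 P.2 ^ 0) = LinearMap.id := by
  ext f P
  simp [mulFun]

theorem eq_zero_of_sum_eis_finsum {m : ℕ} (L : Finset ℕ) (u : ℕ → ℤ → Amb V m)
    (hu : ∀ l q, u l q ∈ AmbDeg Y m q) (fu : ∀ l, (Function.support (u l)).Finite)
    (h : ∑ l ∈ L, LinearMap.lTensor _ (mulFun fun P => eis 1 P.2 ^ l) (∑ᶠ q, u l q) = 0) :
    ∀ l ∈ L, ∀ q, u l q = 0 := by
  intro l hl q
  let Q : Finset ℤ := L.biUnion fun l => (fu l).toFinset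
  by_cases hq : q ∈ Q
  · refine eq_zero_of_sum_eis Y L Q u hu ?_ l hl q hq
    rw [← h]
    refine Finset.sum_congr rfl fun l hl => ?_
    rw [finsum_eq_sum_of_support_subset (s := Q), map_sum]
    intro q hq
    simp only [Q, Finset.coe_biUnion, Set.mem_iUnion, Set.Finite.coe_toFinset]
    exact ⟨l, hl, hq⟩
  · simp only [Q, Finset.mem_biUnion, Set.Finite.mem_toFinset, not_exists, not_and,
      Function.mem_support, not_not] at hq
    exact hq l hl

theorem ambDeg_iSupIndep (m : ℕ) : iSupIndep (AmbDeg Y m) := by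
  rw [iSupIndep_iff_finsetSum_eq_zero_imp_eq_zero]
  intro s v hv h0 i hi
  have := eq_zero_of_sum_eis Y {0} s (fun _ q => open Classical in if q ∈ s then v q else 0)
    (fun _ q => by
      split_ifs with hq
      · exact hv q hq
      · exact zero_mem _) ?_ 0 (by simp) i hi
  · simpa [hi] using this
  · rw [Finset.sum_singleton, mulFun_eis_pow_zero, ← h0]
    exact Finset.sum_congr rfl fun q hq => by simp [hq]

/-- Comparison of homogeneous components, for two families with finite support. -/
theorem component_eq {m : ℕ} (d : ℤ) {x y : ℤ → Amb V m} (hx : ∀ q, x q ∈ AmbDeg Y m q)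
    (hy : ∀ q, y q ∈ AmbDeg Y m (q + d)) (fx : (Function.support x).Finite)
    (fy : (Function.support y).Finite) (h : ∑ᶠ q, x q = ∑ᶠ q, y q) (q : ℤ) : x (q + d) = y q := by
  have hy' : ∀ q, y (q - d) ∈ AmbDeg Y m q := fun q => by simpa using hy (q - d)
  have fy' : (Function.support fun q => y (q - d)).Finite :=
    fy.preimage (f := fun q => q - d) (sub_left_injective.injOn)
  have h' : ∑ᶠ q, x q = ∑ᶠ q, y (q - d) := by
    rw [h]
    exact (finsum_comp_equiv (Equiv.subRight d)).symm
  let s := fx.toFinset ∪ fy'.toFinset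
  rw [finsum_eq_sum_of_support_subset (s := s) _ (by simp [s]),
    finsum_eq_sum_of_support_subset (s := s) _ (by simp [s])] at h'
  have key := (iSupIndep_iff_finsetSum_eq_imp_eq _).1 (ambDeg_iSupIndep Y m) s _ _
    (fun i _ => ⟨hx i, hy' i⟩) h'
  have := key (q + d)
  rw [add_sub_cancel_right] at this
  by_cases hs : q + d ∈ s
  · exact this hs
  · simp only [s, Finset.mem_union, Set.Finite.mem_toFinset, Function.mem_support, not_or,
      not_not, add_sub_cancel_right] at hs
    rw [hs.1, hs.2]

/-! ### Decomposition into homogeneous components -/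

theorem tprod_eq_sum_pieces {m : ℕ} (a : Fin m → V) : ∃ (u : Fin m → ℕ → V)
    (A : Finset (Fin m → ℕ)), (∀ i n, u i n ∈ Y.piece n) ∧
      PiTensorProduct.tprod ℂ a = ∑ r ∈ A, PiTensorProduct.tprod ℂ fun i => u i (r i) := by
  choose u hu hs using fun i => exists_pieces Y (a i)
  refine ⟨fun i n => u i n, Fintype.piFinset fun i => (u i).support, hu, ?_⟩
  rw [← MultilinearMap.map_sum_finset]
  congr 1
  funext i
  exact (hs i).symm

theorem jChain_le_iSup (m : ℕ) : JChain V m ≤ ⨆ p, JChainDeg Y m p := by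
  refine Submodule.span_le.2 ?_
  rintro _ ⟨x, f, k, hf, rfl⟩
  induction x using PiTensorProduct.induction_on with
  | smul_tprod r a =>
    obtain ⟨u, A, hu, e⟩ := tprod_eq_sum_pieces Y a
    rw [e, ← TensorProduct.smul_tmul', TensorProduct.sum_tmul]
    refine Submodule.smul_mem _ _ (Submodule.sum_mem _ fun r _ => ?_)
    exact Submodule.mem_iSup_of_mem (k + ∑ i, r i)
      (Submodule.subset_span ⟨_, r, f, k, fun i => hu i _, hf, rfl, rfl⟩)
  | add x y hx hy =>
    rw [TensorProduct.add_tmul]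
    exact add_mem hx hy

theorem jChainDeg_le_jChain (m p : ℕ) : JChainDeg Y m p ≤ JChain V m := by
  refine Submodule.span_mono ?_
  rintro _ ⟨a, Δ, f, k, ha, hf, rfl, rfl⟩
  exact ⟨_, f, k, hf, rfl⟩

/-- A chain of conformal degree `q ∈ ℤ`, which is zero if `q < 0`. -/
def Homogeneous {m : ℕ} (q : ℤ) (z : Chain V m) : Prop :=
  z = 0 ∨ ∃ p : ℕ, (p : ℤ) = q ∧ z ∈ JChainDeg Y m p

variable {Y} in
theorem Homogeneous.map_mem {m n : ℕ} {q d : ℤ} {T : Chain V m →ₗ[ℂ] Amb V n}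
    (hT : ∀ (p : ℕ) (z : Chain V m), z ∈ JChainDeg Y m p → T z ∈ AmbDeg Y n (p + d))
    {z : Chain V m} (hz : Homogeneous Y q z) : T z ∈ AmbDeg Y n (q + d) := by
  rcases hz with rfl | ⟨p, rfl, hz⟩
  · simp
  · exact hT p z hz

variable {Y} in
theorem Homogeneous.incl_mem {m : ℕ} {q : ℤ} {z : Chain V m} (hz : Homogeneous Y q z) :
    incl z ∈ AmbDeg Y m q := by
  simpa using hz.map_mem (d := 0) fun p z hz => by simpa using incl_mem_ambDeg Y hz

variable {Y} in
theorem Homogeneous.mem_jChain {m : ℕ} {q : ℤ} {z : Chain V m} (hz : Homogeneous Y q z) :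
    z ∈ JChain V m := by
  rcases hz with rfl | ⟨p, -, hz⟩
  · simp
  · exact jChainDeg_le_jChain Y m p hz

/-- `u` is the family of the homogeneous components of `z`. -/
structure IsDecomposition {m : ℕ} (u : ℤ → Chain V m) (z : Chain V m) : Prop where
  finite : (Function.support u).Finite
  sum_eq : ∑ᶠ q, u q = z
  homogeneous : ∀ q, Homogeneous Y q (u q)

theorem exists_decomposition {m : ℕ} {z : Chain V m} (hz : z ∈ JChain V m) :
    ∃ u : ℤ → Chain V m, IsDecomposition Y u z := by
  obtain ⟨v, hv, rfl⟩ := (Submodule.mem_iSup_iff_exists_finsupp _ _).1 (jChain_le_iSup Y m hz)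
  let u : ℤ →₀ Chain V m := v.embDomain Nat.castEmbedding
  refine ⟨u, u.hasFiniteSupport, ?_, fun q => ?_⟩
  · rw [finsum_eq_sum_of_support_subset (s := u.support) _ (by simp)]
    exact Finsupp.sum_embDomain (f := Nat.castEmbedding) (v := v) (g := fun _ x => x)
  · by_cases hq : q ∈ Set.range (Nat.castEmbedding : ℕ ↪ ℤ)
    · obtain ⟨p, rfl⟩ := hq
      refine Or.inr ⟨p, rfl, ?_⟩
      simp only [u]
      rw [Finsupp.embDomain_apply_self]
      exact hv p
    · exact Or.inl (Finsupp.embDomain_of_notMem_range _ _ _ hq)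

variable {Y} in
theorem IsDecomposition.map_finite {m : ℕ} {M : Type*} [AddCommGroup M] [Module ℂ M]
    {u : ℤ → Chain V m} {z : Chain V m} (hu : IsDecomposition Y u z) (T : Chain V m →ₗ[ℂ] M) :
    (Function.support fun q => T (u q)).Finite :=
  hu.finite.subset fun q hq h0 => hq (by simp only [h0, map_zero])

variable {Y} in
theorem IsDecomposition.map_sum {m : ℕ} {M : Type*} [AddCommGroup M] [Module ℂ M]
    {u : ℤ → Chain V m} {z : Chain V m} (hu : IsDecomposition Y u z) (T : Chain V m →ₗ[ℂ] M) :
    ∑ᶠ q, T (u q) = T z := by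
  rw [← hu.sum_eq, map_finsum T hu.finite]

variable {Y} in
/-- A linear relation between two chains which shifts the degree by `d` holds between their
components. -/
theorem IsDecomposition.component_eq {m n : ℕ} {d : ℤ} {T : Chain V m →ₗ[ℂ] Amb V n}
    (hT : ∀ (p : ℕ) (z : Chain V m), z ∈ JChainDeg Y m p → T z ∈ AmbDeg Y n (p + d))
    {u : ℤ → Chain V m} {z : Chain V m} (hu : IsDecomposition Y u z)
    {v : ℤ → Chain V n} {w : Chain V n} (hv : IsDecomposition Y v w) (h : incl w = T z) (q : ℤ) :
    incl (v (q + d)) = T (u q) :=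
  ChiralTorus.component_eq Y d (fun q => (hv.homogeneous q).incl_mem)
    (fun q => (hu.homogeneous q).map_mem hT) (hv.map_finite incl) (hu.map_finite T)
    (by rw [hv.map_sum incl, hu.map_sum T, h]) q

/-- The homogeneous components of a cycle are cycles. -/
theorem exists_cycle_decomposition {n : ℕ} (z : Cyc Y n) :
    ∃ u : ℤ → Cyc Y n, IsDecomposition Y (fun q => (u q).1) z.1 := by
  obtain ⟨v, hv⟩ := exists_decomposition Y z.2.1
  have h0 : IsDecomposition Y (fun _ => (0 : Chain V n)) (0 : Chain V n) :=
    ⟨by simp, by simp, fun q => Or.inl rfl⟩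
  have hd : ∀ q, d1 Y n (v q) = 0 := fun q => by
    have := hv.component_eq (d := -1) (T := d1 Y n) (fun p z hz => d1_mem_ambDeg Y hz) h0
      (by rw [map_zero, LinearMap.mem_ker.1 z.2.2]) q
    rw [← this, map_zero]
  exact ⟨fun q => ⟨v q, (hv.homogeneous q).mem_jChain, hd q⟩, hv⟩

end tensor

section tensor
variable {V : Type*} [AddCommGroup V] [Module ℂ V] (Y : ConformalVertexAlgebra V)

/-! ### Existence and uniqueness of the transform -/

/-- The cycles of conformal degree `p`. -/
def cycDeg (n p : ℕ) : Submodule ℂ (Cyc Y n) := (JChainDeg Y (n + 1) p).comap (Cyc Y n).subtype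

/-- A criterion for internal direct sums in which the independence is stated elementwise, so that no
negation is needed. -/
theorem isInternal_of_sum_unique {M : Type*} [AddCommMonoid M] [Module ℂ M]
    (A : ℕ → Submodule ℂ M)
    (h₁ : ∀ (s : Finset ℕ) (v w : ℕ → M), (∀ i, v i ∈ A i ∧ w i ∈ A i) →
      ∑ i ∈ s, v i = ∑ i ∈ s, w i → ∀ i ∈ s, v i = w i)
    (h₂ : ∀ z, z ∈ ⨆ p, A p) : DirectSum.IsInternal A := by
  classical
  constructor
  · intro x y hxy
    have e : ∀ (x : DirectSum ℕ fun i => A i) (s : Finset ℕ), DFinsupp.support x ⊆ s →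
        DirectSum.coeAddMonoidHom A x = ∑ i ∈ s, (x i : M) := by
      intro x s hs
      rw [DirectSum.coeAddMonoidHom_eq_dfinsuppSum, DFinsupp.sum]
      exact Finset.sum_subset hs fun i _ hi => by simpa using hi
    rw [e x (DFinsupp.support x ∪ DFinsupp.support y) Finset.subset_union_left,
      e y (DFinsupp.support x ∪ DFinsupp.support y) Finset.subset_union_right] at hxy
    have h := h₁ _ _ _ (fun i => ⟨(x i).2, (y i).2⟩) hxy
    refine DFinsupp.ext fun i => Subtype.ext ?_
    by_cases hi : i ∈ DFinsupp.support x ∪ DFinsupp.support y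
    · exact h i hi
    · simp only [Finset.mem_union, DFinsupp.mem_support_toFun, not_or, not_not] at hi
      rw [hi.1, hi.2]
  · intro z
    obtain ⟨f, hf⟩ := (Submodule.mem_iSup_iff_exists_dfinsupp' A z).1 (h₂ z)
    exact ⟨f, by rw [DirectSum.coeAddMonoidHom_eq_dfinsuppSum, hf]⟩

theorem cycDeg_isInternal (n : ℕ) : DirectSum.IsInternal (cycDeg Y n) := by
  refine isInternal_of_sum_unique _ (fun s v w hvw h i hi => ?_) fun z => ?_
  · have hind := (iSupIndep_iff_finsetSum_eq_imp_eq _).1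
      ((ambDeg_iSupIndep Y (n + 1)).comp Nat.cast_injective)
    have := hind s (fun i => incl (v i).1) (fun i => incl (w i).1)
      (fun i _ => ⟨incl_mem_ambDeg Y (hvw i).1, incl_mem_ambDeg Y (hvw i).2⟩) (by
        rw [← map_sum, ← map_sum, ← Submodule.coe_sum, ← Submodule.coe_sum, h]) i hi
    exact Subtype.ext (incl_injective this)
  · obtain ⟨u, hu⟩ := exists_cycle_decomposition Y z
    have hz : z = ∑ᶠ q, u q := by
      apply Subtype.ext
      rw [← hu.sum_eq]
      exact (map_finsum (Cyc Y n).subtype (hu.finite.subset fun q hq h0 => hq (by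
        rwa [Submodule.coe_eq_zero] at h0))).symm
    rw [hz]
    refine finsum_induction (· ∈ ⨆ p, cycDeg Y n p) (zero_mem _) (fun _ _ => add_mem) fun q => ?_
    rcases hu.homogeneous q with h | ⟨p, -, hp⟩
    · rw [Submodule.coe_eq_zero.1 h]
      exact zero_mem _
    · exact Submodule.mem_iSup_of_mem p hp

/-- The system `γ(S)`, which is defined by the slash action of weight `p - 1` on cycles of conformal
degree `p`. -/
def transform (γ : SL2Z) (S : Family Y) : Family Y := fun m =>
  (DirectSum.toModule ℂ ℕ _ fun p : ℕ =>
      slash γ (1 - (p : ℤ)) ∘ₗ S m ∘ₗ (cycDeg Y (m + 1) p).subtype) ∘ₗ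
    (LinearEquiv.ofBijective (DirectSum.coeLinearMap (cycDeg Y (m + 1)))
      (cycDeg_isInternal Y (m + 1))).symm.toLinearMap

theorem transform_isTransform (γ : SL2Z) (S : Family Y) : IsTransform Y γ S (transform Y γ S) := by
  intro m p z hz P hP
  have : (LinearEquiv.ofBijective (DirectSum.coeLinearMap (cycDeg Y (m + 1)))
      (cycDeg_isInternal Y (m + 1))).symm z =
        DirectSum.lof ℂ ℕ (fun p => cycDeg Y (m + 1) p) p ⟨z, hz⟩ := by
    rw [LinearEquiv.symm_apply_eq]
    exact (DirectSum.coeLinearMap_lof (cycDeg Y (m + 1)) p ⟨z, hz⟩).symm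
  simp only [transform, LinearMap.comp_apply, LinearEquiv.coe_coe, this, DirectSum.toModule_lof,
    Submodule.subtype_apply]
  exact slash_apply γ _ _ hP

variable {Y}

theorem IsTransform.apply_homogeneous {γ : SL2Z} {S S' : Family Y} (h : IsTransform Y γ S S')
    {m : ℕ} {q : ℤ} {z : Cyc Y (m + 1)} (hz : Homogeneous Y q z.1) :
    S' m z = slash γ (1 - q) (S m z) := by
  rcases hz with hz | ⟨p, rfl, hz⟩
  · rw [Submodule.coe_eq_zero.1 hz]
    simp
  · apply Subtype.ext
    funext P
    by_cases hP : 0 < P.2.im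
    · rw [h m p z hz P hP, slash_apply γ _ _ hP]
    · rw [ell_eq_zero_of_im_nonpos _ hP, ell_eq_zero_of_im_nonpos _ hP]

theorem IsDecomposition.cyc_finite {n : ℕ} {u : ℤ → Cyc Y n} {z : Cyc Y n}
    (hu : IsDecomposition Y (fun q => (u q).1) z.1) : (Function.support u).Finite :=
  hu.finite.subset fun q hq h0 => hq (by rwa [Submodule.coe_eq_zero] at h0)

theorem IsDecomposition.map_cyc_sum {n : ℕ} {M : Type*} [AddCommGroup M] [Module ℂ M]
    {u : ℤ → Cyc Y n} {z : Cyc Y n}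
    (hu : IsDecomposition Y (fun q => (u q).1) z.1) (F : Cyc Y n →ₗ[ℂ] M) :
    ∑ᶠ q, F (u q) = F z := by
  rw [← map_finsum F hu.cyc_finite]
  congr 1
  apply Subtype.ext
  rw [← hu.sum_eq]
  exact map_finsum (Cyc Y n).subtype hu.cyc_finite

/-- A linear functional of `S'(z)` in terms of the components of `z`. -/
theorem IsTransform.map_apply {γ : SL2Z} {S S' : Family Y} (h : IsTransform Y γ S S') {m : ℕ}
    {u : ℤ → Cyc Y (m + 1)} {z : Cyc Y (m + 1)}
    (hu : IsDecomposition Y (fun q => (u q).1) z.1) (F : Ell (m + 1) →ₗ[ℂ] Pt (m + 1) → ℂ)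
    (P : Pt (m + 1)) :
    F (S' m z) P = ∑ᶠ q, F (slash γ (1 - q) (S m (u q))) P := by
  refine (hu.map_cyc_sum (LinearMap.proj P ∘ₗ F ∘ₗ S' m)).symm.trans (finsum_congr fun q => ?_)
  simp only [LinearMap.comp_apply, LinearMap.proj_apply]
  rw [h.apply_homogeneous (hu.homogeneous q)]

theorem IsTransform.eval {γ : SL2Z} {S S' : Family Y} (h : IsTransform Y γ S S') {m : ℕ}
    {u : ℤ → Cyc Y (m + 1)} {z : Cyc Y (m + 1)}
    (hu : IsDecomposition Y (fun q => (u q).1) z.1) {P : Pt (m + 1)} (hP : 0 < P.2.im) :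
    (S' m z).1 P = ∑ᶠ q : ℤ, autFactor γ P.2 ^ (1 - q) * (S m (u q)).1 (modPt γ P) := by
  refine (h.map_apply hu (Ell (m + 1)).subtype P).trans (finsum_congr fun q => ?_)
  exact slash_apply γ _ _ hP

/-- `IsTransform.eval` with the summation index shifted by `d`. -/
theorem IsTransform.eval_shift {γ : SL2Z} {S S' : Family Y} (h : IsTransform Y γ S S') {m : ℕ}
    {u : ℤ → Cyc Y (m + 1)} {z : Cyc Y (m + 1)}
    (hu : IsDecomposition Y (fun q => (u q).1) z.1) {P : Pt (m + 1)} (hP : 0 < P.2.im) (d : ℤ) :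
    (S' m z).1 P =
      ∑ᶠ q : ℤ, autFactor γ P.2 ^ (1 - (q + d)) * (S m (u (q + d))).1 (modPt γ P) := by
  rw [h.eval hu hP]
  exact (finsum_comp_equiv (Equiv.addRight d)).symm

theorem IsTransform.eq_zero {γ : SL2Z} {S S' : Family Y} (h : IsTransform Y γ S S') {m : ℕ}
    {u : ℤ → Cyc Y (m + 1)} {z : Cyc Y (m + 1)}
    (hu : IsDecomposition Y (fun q => (u q).1) z.1) (h0 : ∀ q, S m (u q) = 0) : S' m z = 0 := by
  rw [← hu.map_cyc_sum (S' m)]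
  refine finsum_eq_zero_of_forall_eq_zero fun q => ?_
  rw [h.apply_homogeneous (hu.homogeneous q), h0, map_zero]

theorem IsTransform.unique {γ : SL2Z} {S S₁ S₂ : Family Y} (h₁ : IsTransform Y γ S S₁)
    (h₂ : IsTransform Y γ S S₂) : S₁ = S₂ := by
  funext m
  ext z : 1
  obtain ⟨u, hu⟩ := exists_cycle_decomposition Y z
  rw [← hu.map_cyc_sum (S₁ m), ← hu.map_cyc_sum (S₂ m)]
  refine finsum_congr fun q => ?_
  rw [h₁.apply_homogeneous (hu.homogeneous q), h₂.apply_homogeneous (hu.homogeneous q)]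

theorem IsTransform.add {γ : SL2Z} {S T S' T' : Family Y} (h : IsTransform Y γ S S')
    (h' : IsTransform Y γ T T') : IsTransform Y γ (S + T) (S' + T') := by
  intro m p z hz P hP
  simp only [Pi.add_apply, LinearMap.add_apply, Submodule.coe_add, h m p z hz P hP,
    h' m p z hz P hP]
  ring

theorem IsTransform.smul {γ : SL2Z} {S S' : Family Y} (h : IsTransform Y γ S S') (b : ℂ) :
    IsTransform Y γ (b • S) (b • S') := by
  intro m p z hz P hP
  simp only [Pi.smul_apply, LinearMap.smul_apply, Submodule.coe_smul, h m p z hz P hP, smul_eq_mul]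
  ring

theorem isTransform_one (S : Family Y) : IsTransform Y 1 S S := by
  intro m p z hz P hP
  rw [autFactor_one, one_zpow, one_mul, modPt_one]

theorem IsTransform.comp {γ δ : SL2Z} {S S' S'' : Family Y} (h : IsTransform Y γ S S')
    (h' : IsTransform Y δ S' S'') : IsTransform Y (γ * δ) S S'' := by
  intro m p z hz P hP
  rw [h' m p z hz P hP, h m p z hz _ (modPt_im δ hP), autFactor_mul γ δ hP, mul_zpow,
    modPt_mul γ δ hP]
  ring

/-! ### Invariance of the genus-one property -/

theorem GenusOne.transform_jacobiLinear {γ : SL2Z} {S S' : Family Y} (hS : GenusOne Y S)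
    (h : IsTransform Y γ S S') (m k : ℕ) (φ : Ell (m + 1)) (hφ : IsJacobi k φ)
    (z w : Cyc Y (m + 1)) (e : incl w.1 = mulTail φ.1 (incl z.1)) :
    (S' m w).1 = mulFun φ.1 (S' m z).1 := by
  obtain ⟨u, hu⟩ := exists_cycle_decomposition Y z
  obtain ⟨v, hv⟩ := exists_cycle_decomposition Y w
  have key := hu.component_eq (T := mulTail φ.1 ∘ₗ incl) (d := k)
    (fun p z hz => mulTail_mem_ambDeg Y hφ hz) hv e
  funext P
  by_cases hP : 0 < P.2.im
  · have hj := autFactor_ne_zero γ hP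
    change _ = φ.1 P * (S' m z).1 P
    rw [h.eval_shift hv hP k, h.eval hu hP, mul_finsum]
    refine finsum_congr fun q => ?_
    rw [hS.jacobiLinear m k φ hφ _ _ (key q)]
    change _ * (φ.1 _ * _) = _
    rw [hφ.isModular.2 γ P hP, ← sub_sub, zpow_sub₀ hj _ (k : ℤ)]
    have := zpow_ne_zero (k : ℤ) hj
    field_simp
  · rw [ell_eq_zero_of_im_nonpos _ hP]
    change _ = φ.1 P * (S' m z).1 P
    rw [ell_eq_zero_of_im_nonpos _ hP, zero_mul]

theorem GenusOne.transform_relation {γ : SL2Z} {S S' : Family Y} (hS : GenusOne Y S)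
    (h : IsTransform Y γ S S') (m : ℕ) (y : Chain V (m + 2)) (hy : y ∈ JChain V (m + 2))
    (z : Cyc Y (m + 1)) (e : incl z.1 = transl Y 0 y) : S' m z = 0 := by
  obtain ⟨u, hu⟩ := exists_decomposition Y hy
  obtain ⟨v, hv⟩ := exists_cycle_decomposition Y z
  have key := hu.component_eq (fun p z hz => transl_mem_ambDeg Y 0 hz) hv e
  refine h.eq_zero hv fun q => hS.relation m (u (q - 1)) (hu.homogeneous _).mem_jChain _ ?_
  rw [← key, sub_add_cancel]

theorem GenusOne.transform_boundary {γ : SL2Z} {S S' : Family Y} (hS : GenusOne Y S)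
    (h : IsTransform Y γ S S') (m : ℕ) (y : Chain V (m + 3)) (hy : y ∈ JChain V (m + 3))
    (z : Cyc Y (m + 1)) (e : incl z.1 = d2 Y (m + 1) y) : S' m z = 0 := by
  obtain ⟨u, hu⟩ := exists_decomposition Y hy
  obtain ⟨v, hv⟩ := exists_cycle_decomposition Y z
  have key := hu.component_eq (fun p z hz => d2_mem_ambDeg Y hz) hv e
  refine h.eq_zero hv fun q => hS.boundary m (u (q - -1)) (hu.homogeneous _).mem_jChain _ ?_
  rw [← key, sub_add_cancel]

theorem GenusOne.transform_flatPoints {γ : SL2Z} {S S' : Family Y} (hS : GenusOne Y S)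
    (h : IsTransform Y γ S S') (m : ℕ) (j : Fin (m + 1)) (z w : Cyc Y (m + 1))
    (e : incl w.1 = transl Y j.succ z.1) : pd j (S' m z) = (S' m w).1 := by
  obtain ⟨u, hu⟩ := exists_cycle_decomposition Y z
  obtain ⟨v, hv⟩ := exists_cycle_decomposition Y w
  have key := hu.component_eq (fun p z hz => transl_mem_ambDeg Y j.succ hz) hv e
  funext P
  by_cases hP : P ∈ Conf (m + 1)
  · rw [h.map_apply hu, h.eval_shift hv hP.1 1]
    refine finsum_congr fun q => ?_
    rw [pd_slash γ _ j _ hP, hS.flatPoints m j _ _ (key q)]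
    congr 2
    ring
  · rw [pd_of_notMem _ _ hP, (S' m w).2.1 P hP]

theorem GenusOne.transform_symmetry {γ : SL2Z} {S S' : Family Y} (hS : GenusOne Y S)
    (h : IsTransform Y γ S S') (m : ℕ) (σ : Equiv.Perm (Fin (m + 1))) (z w : Cyc Y (m + 1))
    (e : incl w.1 = permChain σ z.1) (P : Pt (m + 1)) :
    (S' m w).1 (fun i => P.1 (σ i), P.2) = (S' m z).1 P := by
  obtain ⟨u, hu⟩ := exists_cycle_decomposition Y z
  obtain ⟨v, hv⟩ := exists_cycle_decomposition Y w
  have key := hu.component_eq (d := 0)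
    (fun p z hz => by simpa using permChain_mem_ambDeg Y σ hz) hv e
  by_cases hP : 0 < P.2.im
  · rw [h.eval hu hP, h.eval hv (P := (fun i => P.1 (σ i), P.2)) hP]
    refine finsum_congr fun q => congrArg _ ?_
    exact hS.symmetry m σ (u q) (v q) (by simpa using key q) (modPt γ P)
  · rw [ell_eq_zero_of_im_nonpos _ hP,
      ell_eq_zero_of_im_nonpos _ (P := (fun i => P.1 (σ i), P.2)) hP]

end tensor

section tensor
variable {V : Type*} [AddCommGroup V] [Module ℂ V] {Y : ConformalVertexAlgebra V}

theorem prepend_tprod {m : ℕ} (v : V) (a : Fin m → V) :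
    prepend v (PiTensorProduct.tprod ℂ a) = PiTensorProduct.tprod ℂ (Fin.cons v a : Fin (m + 1) → V) := by
  simp [prepend]

variable (Y) in
/-- On chains with the vacuum as first factor, `d_1` takes the sum of the residues. -/
theorem d1_vac {m : ℕ} (a : Fin m → V) (f : Ell (m + 1)) :
    d1 Y m (PiTensorProduct.tprod ℂ (Fin.cons Y.vac a : Fin (m + 1) → V) ⊗ₜ f) =
      PiTensorProduct.tprod ℂ a ⊗ₜ ∑ i, laurent 0 i (-1) f := by
  rw [d1, LinearMap.sum_apply, TensorProduct.tmul_sum]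
  refine Finset.sum_congr rfl fun i _ => ?_
  simp only [resid, locSum, LinearMap.coe_mk, AddHom.coe_mk, TensorProduct.map_tmul,
    contract_tprod, Fin.cons_zero, Y.vacuum]
  rw [finsum_eq_single _ (-1)]
  · congr 2
    funext r
    by_cases hr : r = i
    · subst hr; simp
    · simp [hr]
  · intro k hk
    rw [if_neg hk, MultilinearMap.map_coord_zero _ i (by simp), TensorProduct.zero_tmul]

/-- The vacuum property is stated for single tensors `1 ⊗ a_1 ⊗ … ⊗ a_n ⊗ f`, so these have to be
split into homogeneous tensors which are again cycles. -/
theorem GenusOne.transform_vacuum {γ : SL2Z} {S S' : Family Y} (hS : GenusOne Y S)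
    (h : IsTransform Y γ S S') (m : ℕ) (a : Fin (m + 1) → V) (f : Ell (m + 2)) (k : ℕ)
    (hf : IsJacobi k f) (z : Cyc Y (m + 1))
    (e : z.1 = PiTensorProduct.tprod ℂ (Fin.cons Y.vac a : Fin (m + 2) → V) ⊗ₜ f) :
    S' m z = 0 := by
  by_cases ha : PiTensorProduct.tprod ℂ a = 0
  · have : z = 0 := by
      apply Subtype.ext
      rw [e, ← prepend_tprod, ha, map_zero, TensorProduct.zero_tmul]
      rfl
    rw [this, map_zero]
  -- as `z` is a cycle, the sum of the residues of `f` vanishes, whence the tensors in the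
  -- homogeneous components of `a` also define cycles
  have hd := LinearMap.mem_ker.1 z.2.2
  rw [e, d1_vac] at hd
  have hres : ∑ i, laurent 0 i (-1) f = 0 := by
    funext P
    have := congrArg (evalAt P) hd
    rw [evalAt_tmul, map_zero, smul_eq_zero] at this
    exact this.resolve_right ha
  obtain ⟨u, A, hu, eA⟩ := tprod_eq_sum_pieces Y a
  let y : (Fin (m + 1) → ℕ) → Cyc Y (m + 1) := fun r =>
    ⟨PiTensorProduct.tprod ℂ (Fin.cons Y.vac fun i => u i (r i) : Fin (m + 2) → V) ⊗ₜ f,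
      Submodule.subset_span ⟨_, f, k, hf, rfl⟩, by
        change d1 Y (m + 1) _ = 0
        rw [d1_vac, hres, TensorProduct.tmul_zero]⟩
  have hz : z = ∑ r ∈ A, y r := by
    apply Subtype.ext
    rw [e, ← prepend_tprod, eA, map_sum, TensorProduct.sum_tmul, Submodule.coe_sum]
    exact Finset.sum_congr rfl fun r _ => by rw [prepend_tprod]
  rw [hz, map_sum]
  refine Finset.sum_eq_zero fun r _ => ?_
  have hy : (y r).1 ∈ JChainDeg Y (m + 2) (k + ∑ i, (Fin.cons 0 r : Fin (m + 2) → ℕ) i) := by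
    refine Submodule.subset_span ⟨_, _, f, k, fun i => ?_, hf, rfl, rfl⟩
    cases i using Fin.cases with
    | zero => exact mem_piece_of_mem_wt Y (vac_mem_wt Y)
    | succ i => exact hu i _
  rw [h.apply_homogeneous (Or.inr ⟨_, rfl, hy⟩),
    hS.vacuum m (fun i => u i (r i)) f k hf (y r) rfl, map_zero]

theorem IsDecomposition.eval_finite {n m : ℕ} {u : ℤ → Cyc Y n} {z : Cyc Y n}
    (hu : IsDecomposition Y (fun q => (u q).1) z.1) (F : Cyc Y n →ₗ[ℂ] Ell m) (d : ℤ) (c : ℤ → ℂ)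
    (P : Pt m) : (Function.support fun q => c q * (F (u (q + d))).1 P).Finite := by
  refine (hu.cyc_finite.preimage (f := fun q => q + d) (add_left_injective d).injOn).subset
    fun q hq h0 => hq ?_
  have h0 : u (q + d) = 0 := h0
  simp [h0]

/-- The equation `∇_τ z = ∑_l g_2^l w_l` determines `w`: for `l ≥ 2` the cycle `w_l` vanishes, and in
degree `q` the cycle `w_1` is `-(q - 1) z`. -/
theorem nabla_components {m : ℕ} {z : Cyc Y (m + 1)} {w : ℕ →₀ Cyc Y (m + 1)}
    (e : nabla Y m z.1 = (w.sum fun j y =>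
      LinearMap.lTensor _ (mulFun fun P : Pt (m + 2) => eis 1 P.2 ^ j) (incl y.1)))
    {u : ℤ → Cyc Y (m + 1)} (hu : IsDecomposition Y (fun q => (u q).1) z.1)
    {v : ℕ → ℤ → Cyc Y (m + 1)}
    (hv : ∀ l, IsDecomposition Y (fun q => (v l q).1) (w l).1) :
    (∀ q, nabla Y m (u q).1 + ((q : ℂ) - 1) • mulEis (m + 2) (incl (u q).1) =
      incl (v 0 (q + 2)).1) ∧
    (∀ q, v 1 q = (1 - (q : ℂ)) • u q) ∧ ∀ l, 2 ≤ l → w l = 0 := by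
  let W : ℤ → Amb V (m + 2) := fun q =>
    nabla Y m (u q).1 + ((q : ℂ) - 1) • mulEis (m + 2) (incl (u q).1)
  have hW : ∀ q, W q ∈ AmbDeg Y (m + 2) (q + 2) := by
    intro q
    rcases hu.homogeneous q with h | ⟨p, rfl, hp⟩
    · have h : (u q).1 = 0 := h
      simp [W, h]
    · exact nabla_mem_ambDeg Y hp (LinearMap.mem_ker.1 (u p).2.2)
  have fW : (Function.support W).Finite := by
    refine hu.finite.subset fun q hq h0 => hq ?_
    have h0 : (u q).1 = 0 := h0
    simp [W, h0]
  let W' : ℤ → Amb V (m + 2) := fun q => W (q - 2)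
  have fW' : (Function.support W').Finite :=
    fW.preimage (f := fun q => q - 2) sub_left_injective.injOn
  let B : ℤ → Amb V (m + 2) := fun q => ((q : ℂ) - 1) • incl (u q).1
  have fB : (Function.support B).Finite := by
    refine hu.finite.subset fun q hq h0 => hq ?_
    have h0 : (u q).1 = 0 := h0
    simp [B, h0]
  have hB : ∀ q, B q ∈ AmbDeg Y (m + 2) q := fun q =>
    Submodule.smul_mem _ _ (hu.homogeneous q).incl_mem
  have fv : ∀ l, (Function.support fun q => incl (v l q).1).Finite := fun l =>
    (hv l).map_finite incl
  have fMB : (Function.support fun q => mulEis (m + 2) (B q)).Finite := by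
    refine fB.subset fun q hq h0 => hq ?_
    have h0 : B q = 0 := h0
    simp only [h0, map_zero]
  have sumW : ∑ᶠ q, W' q = nabla Y m z.1 + mulEis (m + 2) (∑ᶠ q, B q) := by
    have h1 : ∑ᶠ q, W' q = ∑ᶠ q, W q := finsum_comp_equiv (f := W) (Equiv.subRight (2 : ℤ))
    rw [h1, ← hu.map_sum (nabla Y m), map_finsum _ fB,
      ← finsum_add_distrib (hu.map_finite (nabla Y m)) fMB]
    exact finsum_congr fun q => by simp only [W, B, map_smul]
  -- the component of degree `q` of the coefficient of `g_2^l` in the difference of both sides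
  let U : ℕ → ℤ → Amb V (m + 2) := fun l q =>
    incl (v l q).1 - (if l = 0 then W' q else 0) + (if l = 1 then B q else 0)
  have hU : ∀ l q, U l q ∈ AmbDeg Y (m + 2) q := by
    intro l q
    refine add_mem (sub_mem ((hv l).homogeneous q).incl_mem ?_) ?_
    · split_ifs
      · simpa [W'] using hW (q - 2)
      · exact zero_mem _
    · split_ifs
      · exact hB q
      · exact zero_mem _
  have fU : ∀ l, (Function.support (U l)).Finite := by
    intro l
    refine (((fv l).union fW').union fB).subset fun q hq => ?_
    by_contra hc
    simp only [Set.mem_union, Function.mem_support, not_or, not_not] at hc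
    exact hq (by simp [U, hc.1.1, hc.1.2, hc.2])
  have sumU : ∀ l, ∑ᶠ q, U l q = incl (w l).1 - (if l = 0 then ∑ᶠ q, W' q else 0) +
      (if l = 1 then ∑ᶠ q, B q else 0) := by
    intro l
    have f1 : (Function.support fun q => if l = 0 then W' q else 0).Finite := by
      split_ifs
      · exact fW'
      · simp
    have f2 : (Function.support fun q => if l = 1 then B q else 0).Finite := by
      split_ifs
      · exact fB
      · simp
    have f3 : (Function.support fun q => incl (v l q).1 - if l = 0 then W' q else 0).Finite := by
      refine ((fv l).union f1).subset fun q hq => ?_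
      by_contra hc
      simp only [Set.mem_union, Function.mem_support, not_or, not_not] at hc
      exact hq (by simp only [hc.1, hc.2, sub_zero])
    simp only [U]
    rw [finsum_add_distrib f3 f2, finsum_sub_distrib (fv l) f1, (hv l).map_sum incl]
    congr 2
    · split_ifs <;> simp
    · split_ifs <;> simp
  let L : Finset ℕ := w.support ∪ {0, 1}
  have key := eq_zero_of_sum_eis_finsum Y L U hU fU (by
    simp only [sumU, map_add, map_sub, Finset.sum_add_distrib, Finset.sum_sub_distrib]
    have h1 : ∑ l ∈ L, LinearMap.lTensor _ (mulFun fun P : Pt (m + 2) => eis 1 P.2 ^ l)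
        (incl (w l).1) = nabla Y m z.1 := by
      rw [e, Finsupp.sum]
      refine (Finset.sum_subset Finset.subset_union_left fun l _ hl => ?_).symm
      rw [Finsupp.notMem_support_iff.1 hl]
      simp
    rw [h1, Finset.sum_eq_single_of_mem 0 (by simp [L]) (fun l _ hl => by simp [hl]),
      Finset.sum_eq_single_of_mem 1 (by simp [L]) (fun l _ hl => by simp [hl]), if_pos rfl,
      if_pos rfl, mulFun_eis_pow_zero, sumW]
    simp [mulEis])
  refine ⟨fun q => ?_, fun q => ?_, fun l hl => ?_⟩
  · have := key 0 (by simp [L]) (q + 2)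
    simp only [U, W', if_true, zero_ne_one, if_false, add_zero, add_sub_cancel_right] at this
    exact (sub_eq_zero.1 this).symm
  · have := key 1 (by simp [L]) q
    simp only [U, one_ne_zero, if_true, if_false, sub_zero, B] at this
    apply Subtype.ext
    apply incl_injective
    rw [eq_neg_of_add_eq_zero_left this]
    simp only [Submodule.coe_smul, map_smul]
    module
  · by_cases hl' : l ∈ L
    · apply Subtype.ext
      rw [← (hv l).sum_eq]
      refine finsum_eq_zero_of_forall_eq_zero fun q => incl_injective ?_
      have := key l hl' q
      simp only [U, if_neg (show l ≠ 0 by omega), if_neg (show l ≠ 1 by omega)] at this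
      simpa using this
    · simp only [L, Finset.mem_union, not_or] at hl'
      exact Finsupp.notMem_support_iff.1 hl'.1

theorem sum_eq_of_two_le {M : Type*} [AddCommMonoid M] {A : Type*} [Zero A]
    {w : ℕ →₀ A} (hw : ∀ l, 2 ≤ l → w l = 0) (F : ℕ → A → M) (hF : ∀ l, F l 0 = 0) :
    w.sum F = F 0 (w 0) + F 1 (w 1) := by
  rw [Finsupp.sum_of_support_subset w (s := Finset.range 2) (fun l hl => ?_) F fun l _ => hF l]
  · simp [Finset.sum_range_succ]
  · rw [Finset.mem_range]
    by_contra hc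
    exact Finsupp.mem_support_iff.1 hl (hw l (by omega))

theorem GenusOne.transform_flatTau {γ : SL2Z} {S S' : Family Y} (hS : GenusOne Y S)
    (h : IsTransform Y γ S S') (m : ℕ) (z : Cyc Y (m + 1)) (w : ℕ →₀ Cyc Y (m + 1))
    (e : nabla Y m z.1 = (w.sum fun j y =>
      LinearMap.lTensor _ (mulFun fun P : Pt (m + 2) => eis 1 P.2 ^ j) (incl y.1))) :
    dTau (S' m z) = w.sum fun j y => mulFun (fun P => eis 1 P.2 ^ j) (S' m y).1 := by
  obtain ⟨u, hu⟩ := exists_cycle_decomposition Y z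
  choose v hv using fun l => exists_cycle_decomposition Y (w l)
  obtain ⟨h0, h1, h2⟩ := nabla_components e hu hv
  -- the components of `z` satisfy an equation with only two terms
  have hflat : ∀ q, dTau (S m (u q)) = (S m (v 0 (q + 2))).1 +
      ((1 - (q : ℂ)) • mulFun (fun P => eis 1 P.2) (S m (u q)).1) := by
    intro q
    let w' : ℕ →₀ Cyc Y (m + 1) :=
      Finsupp.single 0 (v 0 (q + 2)) + Finsupp.single 1 ((1 - (q : ℂ)) • u q)
    have hw' : ∀ l, 2 ≤ l → w' l = 0 := by
      intro l hl
      simp [w', show (0 : ℕ) ≠ l by omega, show (1 : ℕ) ≠ l by omega]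
    have e0 : w' 0 = v 0 (q + 2) := by simp [w']
    have e1 : w' 1 = (1 - (q : ℂ)) • u q := by simp [w']
    have := hS.flatTau m (u q) w' (by
      rw [sum_eq_of_two_le hw' _ (by simp), e0, e1, ← h0 q]
      simp only [mulFun_eis_pow_zero, pow_one, LinearMap.lTensor_id, LinearMap.id_apply,
        Submodule.coe_smul, map_smul, mulEis]
      module)
    rw [this, sum_eq_of_two_le hw' _ (by simp), e0, e1]
    simp only [mulFun_eis_pow_zero, pow_one, LinearMap.id_apply, map_smul, Submodule.coe_smul]
  rw [sum_eq_of_two_le h2 _ (by simp)]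
  funext P
  by_cases hP : P ∈ Conf (m + 1)
  · have hj := autFactor_ne_zero γ hP.1
    rw [h.map_apply hu]
    simp only [mulFun, Pi.add_apply, LinearMap.mulLeft_apply, Pi.mul_apply, pow_zero, one_mul,
      pow_one]
    have hw1 : (S' m (w 1)).1 P = ∑ᶠ q : ℤ, (1 - (q : ℂ)) *
        (autFactor γ P.2 ^ (1 - q) * (S m (u q)).1 (modPt γ P)) := by
      rw [h.eval (hv 1) hP.1]
      refine finsum_congr fun q => ?_
      rw [h1 q, map_smul, Submodule.coe_smul, Pi.smul_apply, smul_eq_mul]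
      ring
    rw [h.eval_shift (hv 0) hP.1 2, hw1, mul_finsum, ← finsum_add_distrib]
    · refine finsum_congr fun q => ?_
      have he : eis 1 (modPt γ P).2 = _ := eis_one_modular γ hP.1
      rw [dTau_slash γ _ _ hP, hflat q]
      simp only [mulFun, Pi.add_apply, Pi.smul_apply, LinearMap.mulLeft_apply, Pi.mul_apply,
        smul_eq_mul, he]
      rw [show (1 - (q + 2) : ℤ) = 1 - q - 2 by ring, show (1 - q - 1 : ℤ) = 1 - q - 2 + 1 by ring,
        zpow_add₀ hj, show autFactor γ P.2 ^ (1 - q) = autFactor γ P.2 ^ (1 - q - 2) *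
          autFactor γ P.2 ^ 2 by rw [← zpow_natCast, ← zpow_add₀ hj]; congr 1; push_cast; ring]
      push_cast
      rw [zpow_one]
      ring
    · exact (hv 0).eval_finite (S m) 2 _ _
    · refine ((hu.eval_finite (S m) 0 (fun q => eis 1 P.2 * ((1 - (q : ℂ)) *
        autFactor γ P.2 ^ (1 - q))) (modPt γ P))).subset fun q hq h0 => hq ?_
      simp only [add_zero] at h0 ⊢
      rw [← h0]
      ring
  · rw [dTau_of_notMem _ hP]
    simp [mulFun, (S' m (w 0)).2.1 P hP, (S' m (w 1)).2.1 P hP]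

end tensor

/-! ### The insertion formula -/

theorem finsum_eq_sum_range {F : ℕ → ℂ} {M : ℕ} (h : ∀ r, M ≤ r → F r = 0) :
    ∑ᶠ r, F r = ∑ r ∈ Finset.range M, F r := by
  refine finsum_eq_sum_of_support_subset _ fun r hr => ?_
  rw [Finset.coe_range, Set.mem_Iio]
  by_contra hc
  exact hr (h r (not_lt.1 hc))

/-- The right hand side of the insertion formula as a function of the numbers
`x i s = S(c i s)(t, τ)`. The sums over the modes are cut off at `M`. -/
def insertionSum (M : ℕ) {m : ℕ} (v : ℂ) (P : Pt (m + 1)) : (Fin (m + 1) → ℤ → ℂ) →ₗ[ℂ] ℂ where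
  toFun x :=
    ∑ i : Fin (m + 1), x i 0 * zetaW (v - P.1 i) P.2 +
    ∑ i : Fin (m + 1), x i 1 * (wp 2 (v - P.1 i) P.2 + eis 1 P.2) +
    ∑ i : Fin (m + 1), ∑ r ∈ Finset.range M, x i (r + 2) * wp (r + 3) (v - P.1 i) P.2 -
    ∑ i : Fin m, x i.castSucc 0 * zetaW (P.1 (Fin.last m) - P.1 i.castSucc) P.2 -
    ∑ i : Fin m, x i.castSucc 1 *
      (wp 2 (P.1 (Fin.last m) - P.1 i.castSucc) P.2 + eis 1 P.2) -
    ∑ i : Fin m, ∑ r ∈ Finset.range M, x i.castSucc (r + 2) *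
      wp (r + 3) (P.1 (Fin.last m) - P.1 i.castSucc) P.2 +
    x (Fin.last m) (-1) -
    ∑ r ∈ Finset.range M, x (Fin.last m) (2 * r + 1) * eis (r + 1) P.2
  map_add' x y := by
    simp only [Pi.add_apply, add_mul, Finset.sum_add_distrib]
    ring
  map_smul' b x := by
    simp only [Pi.smul_apply, smul_eq_mul, mul_assoc, ← Finset.mul_sum, RingHom.id_apply]
    ring

theorem insertionSum_eq {M m : ℕ} (v : ℂ) (P : Pt (m + 1)) {x : Fin (m + 1) → ℤ → ℂ}
    (hx : ∀ i s, (M : ℤ) ≤ s → x i s = 0) : insertionSum M v P x =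
      ∑ i : Fin (m + 1), x i 0 * zetaW (v - P.1 i) P.2 +
      ∑ i : Fin (m + 1), x i 1 * (wp 2 (v - P.1 i) P.2 + eis 1 P.2) +
      ∑ i : Fin (m + 1), ∑ᶠ r : ℕ, x i (r + 2) * wp (r + 3) (v - P.1 i) P.2 -
      ∑ i : Fin m, x i.castSucc 0 * zetaW (P.1 (Fin.last m) - P.1 i.castSucc) P.2 -
      ∑ i : Fin m, x i.castSucc 1 *
        (wp 2 (P.1 (Fin.last m) - P.1 i.castSucc) P.2 + eis 1 P.2) -
      ∑ i : Fin m, ∑ᶠ r : ℕ, x i.castSucc (r + 2) *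
        wp (r + 3) (P.1 (Fin.last m) - P.1 i.castSucc) P.2 +
      x (Fin.last m) (-1) -
      ∑ᶠ r : ℕ, x (Fin.last m) (2 * r + 1) * eis (r + 1) P.2 := by
  have e1 : ∀ (i : Fin (m + 1)) (t : ℂ), ∑ᶠ r : ℕ, x i (r + 2) * wp (r + 3) t P.2 =
      ∑ r ∈ Finset.range M, x i (r + 2) * wp (r + 3) t P.2 := fun i t =>
    finsum_eq_sum_range fun r hr => by rw [hx i _ (by omega), zero_mul]
  have e2 : ∑ᶠ r : ℕ, x (Fin.last m) (2 * r + 1) * eis (r + 1) P.2 =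
      ∑ r ∈ Finset.range M, x (Fin.last m) (2 * r + 1) * eis (r + 1) P.2 :=
    finsum_eq_sum_range fun r hr => by rw [hx _ _ (by omega), zero_mul]
  simp only [e1, e2]
  rfl

/-- The insertion formula is covariant. The anomalies of `ζ` add up to a multiple of `∑_i x i 0`,
and those of the occurrences of `g_2` cancel. A positive cutoff ensures that the last sum contains its
term with `g_2`. -/
theorem insertionSum_modular (γ : SL2Z) (M : ℕ) {m : ℕ} (v : ℂ) {P : Pt (m + 1)}
    (hP : 0 < P.2.im) {x : Fin (m + 1) → ℤ → ℂ} (hx : ∑ i, x i 0 = 0) :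
    insertionSum (M + 1) (v / autFactor γ P.2) (modPt γ P) x =
      insertionSum (M + 1) v P fun i s => autFactor γ P.2 ^ (1 + s) * x i s := by
  have hz : ∀ s t : ℂ, zetaW (s / autFactor γ P.2 - t / autFactor γ P.2) (modPt γ P).2 =
      autFactor γ P.2 * zetaW (s - t) P.2 + 2 * Real.pi * Complex.I * γ 1 0 * (s - t) := by
    intro s t
    rw [← sub_div]
    exact zetaW_modular γ hP _
  have hw : ∀ (k : ℕ) (s t : ℂ), wp k (s / autFactor γ P.2 - t / autFactor γ P.2) (modPt γ P).2 =
      autFactor γ P.2 ^ k * wp k (s - t) P.2 := by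
    intro k s t
    rw [← sub_div]
    exact wp_modular γ hP k _
  have hg : eis 1 (modPt γ P).2 = _ := eis_one_modular γ hP
  have hg' : ∀ k, 2 ≤ k → eis k (modPt γ P).2 = _ := fun k hk => eis_modular γ hP hk
  have hm : ∀ i, (modPt γ P).1 i = P.1 i / autFactor γ P.2 := fun _ => rfl
  set j := autFactor γ P.2
  have p0 : j ^ (1 + 0 : ℤ) = j := by simp
  have p1 : j ^ (1 + 1 : ℤ) = j ^ 2 := by norm_cast
  have p2 : ∀ r : ℕ, j ^ (1 + (r + 2) : ℤ) = j ^ (r + 3) := by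
    intro r
    rw [← zpow_natCast]
    congr 1
    push_cast
    ring
  have p3 : ∀ r : ℕ, j ^ (1 + (2 * r + 1) : ℤ) = j ^ (2 * (r + 1)) := by
    intro r
    rw [← zpow_natCast]
    congr 1
    push_cast
    ring
  have e3 : ∀ (i : Fin (m + 1)) (s t : ℂ),
      ∑ r ∈ Finset.range (M + 1), j ^ (r + 3) * x i (r + 2) * wp (r + 3) (s - t) P.2 =
        ∑ r ∈ Finset.range (M + 1), x i (r + 2) * (j ^ (r + 3) * wp (r + 3) (s - t) P.2) :=
    fun i s t => Finset.sum_congr rfl fun r _ => by ring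
  have e8 : ∑ r ∈ Finset.range (M + 1), x (Fin.last m) (2 * r + 1) * eis (r + 1) (modPt γ P).2 =
      ∑ r ∈ Finset.range (M + 1), j ^ (2 * (r + 1)) * x (Fin.last m) (2 * r + 1) *
        eis (r + 1) P.2 - 2 * Real.pi * Complex.I * γ 1 0 * j * x (Fin.last m) 1 := by
    rw [Finset.sum_range_succ', Finset.sum_range_succ',
      Finset.sum_congr rfl fun r _ => by rw [hg' (r + 1 + 1) (by omega)]]
    simp only [Nat.cast_zero, mul_zero, zero_add, hg]
    rw [Finset.sum_congr rfl fun r _ => (by ring : x (Fin.last m) (2 * ((r + 1 : ℕ) : ℤ) + 1) *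
      (j ^ (2 * (r + 1 + 1)) * eis (r + 1 + 1) P.2) = j ^ (2 * (r + 1 + 1)) *
        x (Fin.last m) (2 * ((r + 1 : ℕ) : ℤ) + 1) * eis (r + 1 + 1) P.2)]
    ring
  simp only [insertionSum, LinearMap.coe_mk, AddHom.coe_mk, hm, hz, hw, e8, p0, p1, p2, p3, e3]
  rw [hg]
  rw [Fin.sum_univ_castSucc] at hx
  simp only [Fin.sum_univ_castSucc, add_neg_cancel, zpow_zero]
  have c1 : ∀ (t : Fin m → ℂ) (s : ℂ), ∑ i : Fin m, x i.castSucc 0 * (j * zetaW (s - t i) P.2 +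
      2 * Real.pi * Complex.I * γ 1 0 * (s - t i)) =
      ∑ i : Fin m, j * x i.castSucc 0 * zetaW (s - t i) P.2 + 2 * Real.pi * Complex.I * γ 1 0 *
        (s * ∑ i : Fin m, x i.castSucc 0 - ∑ i : Fin m, x i.castSucc 0 * t i) := by
    intro t s
    simp only [Finset.mul_sum, ← Finset.sum_sub_distrib, ← Finset.sum_add_distrib]
    exact Finset.sum_congr rfl fun i _ => by ring
  have c2 : ∀ (t : Fin m → ℂ) (s : ℂ), ∑ i : Fin m, x i.castSucc 1 * (j ^ 2 * wp 2 (s - t i) P.2 +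
      (j ^ 2 * eis 1 P.2 - 2 * Real.pi * Complex.I * γ 1 0 * j)) =
      ∑ i : Fin m, j ^ 2 * x i.castSucc 1 * (wp 2 (s - t i) P.2 + eis 1 P.2) -
        2 * Real.pi * Complex.I * γ 1 0 * j * ∑ i : Fin m, x i.castSucc 1 := by
    intro t s
    simp only [Finset.mul_sum, ← Finset.sum_sub_distrib]
    exact Finset.sum_congr rfl fun i _ => by ring
  simp only [c1 (fun i => P.1 i.castSucc), c2 (fun i => P.1 i.castSucc)]
  linear_combination 2 * Real.pi * Complex.I * γ 1 0 * (v - P.1 (Fin.last m)) * hx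

section tensor
variable {V : Type*} [AddCommGroup V] [Module ℂ V] {Y : ConformalVertexAlgebra V}

/-- On a cycle, the insertion cycles of index `0` add up to a boundary. -/
theorem GenusOne.sum_insertion_eq_zero {S : Family Y} (hS : GenusOne Y S) {m : ℕ}
    {z : Cyc Y (m + 2)} {c : Fin (m + 1) → Cyc Y (m + 1)}
    (hc : ∀ i, incl (c i).1 = resid Y 1 i.succ 0 z.1) : ∑ i, S m (c i) = 0 := by
  rw [← map_sum]
  refine hS.boundary m z.1 z.2.1 _ ?_
  have h1 : (∑ q : Fin (m + 2), resid Y 0 q 0) z.1 = 0 := LinearMap.mem_ker.1 z.2.2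
  rw [d2, LinearMap.sub_apply, h1, sub_zero, LinearMap.sum_apply, Submodule.coe_sum, map_sum]
  exact Finset.sum_congr rfl fun i _ => hc i

theorem exists_insertion_bound {m : ℕ} (z : Chain V (m + 3)) : ∃ M : ℕ,
    ∀ (i : Fin (m + 1)) (s : ℤ), M ≤ s → resid Y 1 i.succ s z = 0 := by
  choose M hM using fun i : Fin (m + 1) => resid_eventually_zero Y 1 i.succ z
  refine ⟨∑ i, (M i).toNat, fun i s hs => hM i s ?_⟩
  have := Finset.single_le_sum (f := fun i => (M i).toNat) (fun _ _ => Nat.zero_le _)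
    (Finset.mem_univ i)
  omega

theorem insertion_eval_eq_zero {S : Family Y} {m M : ℕ} {z : Cyc Y (m + 2)}
    {c : Fin (m + 1) → ℤ → Cyc Y (m + 1)}
    (hc : ∀ i s, incl (c i s).1 = resid Y 1 i.succ s z.1)
    (hM : ∀ (i : Fin (m + 1)) (s : ℤ), M ≤ s → resid Y 1 i.succ s z.1 = 0)
    (P : Pt (m + 1)) (i : Fin (m + 1)) (s : ℤ) (hs : M ≤ s) : (S m (c i s)).1 P = 0 := by
  have : c i s = 0 := Subtype.ext (incl_injective (by rw [hc, hM i s hs]; simp))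
  simp [this]

/-- The insertion formula for `S` at a transformed point, with the automorphy factors moved to the
insertion cycles. -/
theorem GenusOne.eval_modPt_eq_insertionSum (γ : SL2Z) {S : Family Y} (hS : GenusOne Y S)
    {m M : ℕ} {z : Cyc Y (m + 2)} {c : Fin (m + 1) → ℤ → Cyc Y (m + 1)}
    (hc : ∀ i s, incl (c i s).1 = resid Y 1 i.succ s z.1)
    (hM : ∀ (i : Fin (m + 1)) (s : ℤ), (M + 1 : ℕ) ≤ s → resid Y 1 i.succ s z.1 = 0) {v : ℂ}
    {P : Pt (m + 1)} (hP : ((Fin.cons v P.1 : Fin (m + 2) → ℂ), P.2) ∈ Conf (m + 2)) :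
    (S (m + 1) z).1 (modPt γ (Fin.cons v P.1, P.2)) = insertionSum (M + 1) v P fun i s =>
      autFactor γ P.2 ^ (1 + s) * (S m (c i s)).1 (modPt γ P) := by
  have him : 0 < P.2.im := hP.1
  have hcons : modPt γ ((Fin.cons v P.1, P.2) : Pt (m + 2)) =
      (Fin.cons (v / autFactor γ P.2) (modPt γ P).1, (modPt γ P).2) := by
    refine Prod.ext (funext fun i => ?_) rfl
    cases i using Fin.cases <;> rfl
  have h0 : ∑ i, (S m (c i 0)).1 (modPt γ P) = 0 := by
    have := congrArg (fun f : Ell (m + 1) => f.1 (modPt γ P))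
      (hS.sum_insertion_eq_zero fun i => hc i 0)
    simpa [Finset.sum_apply] using this
  have hmem := modPt_mem_of_mem γ hP
  rw [hcons] at hmem ⊢
  rw [← insertionSum_modular γ M v him (x := fun i s => (S m (c i s)).1 (modPt γ P)) h0,
    insertionSum_eq (M := M + 1) _ _ (insertion_eval_eq_zero hc hM _)]
  exact hS.insertion m z c hc _ _ hmem

theorem GenusOne.transform_insertion {γ : SL2Z} {S S' : Family Y} (hS : GenusOne Y S)
    (h : IsTransform Y γ S S') (m : ℕ) (z : Cyc Y (m + 2)) (c : Fin (m + 1) → ℤ → Cyc Y (m + 1))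
    (e : ∀ i s, incl (c i s).1 = resid Y 1 i.succ s z.1) (v : ℂ) (P : Pt (m + 1))
    (hP : ((Fin.cons v P.1 : Fin (m + 2) → ℂ), P.2) ∈ Conf (m + 2)) :
    (S' (m + 1) z).1 (Fin.cons v P.1, P.2) =
        ∑ i : Fin (m + 1), (S' m (c i 0)).1 P * zetaW (v - P.1 i) P.2 +
        ∑ i : Fin (m + 1), (S' m (c i 1)).1 P * (wp 2 (v - P.1 i) P.2 + eis 1 P.2) +
        ∑ i : Fin (m + 1), ∑ᶠ r : ℕ, (S' m (c i (r + 2))).1 P * wp (r + 3) (v - P.1 i) P.2 -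
        ∑ i : Fin m, (S' m (c i.castSucc 0)).1 P *
          zetaW (P.1 (Fin.last m) - P.1 i.castSucc) P.2 -
        ∑ i : Fin m, (S' m (c i.castSucc 1)).1 P *
          (wp 2 (P.1 (Fin.last m) - P.1 i.castSucc) P.2 + eis 1 P.2) -
        ∑ i : Fin m, ∑ᶠ r : ℕ, (S' m (c i.castSucc (r + 2))).1 P *
          wp (r + 3) (P.1 (Fin.last m) - P.1 i.castSucc) P.2 +
        (S' m (c (Fin.last m) (-1))).1 P -
        ∑ᶠ r : ℕ, (S' m (c (Fin.last m) (2 * r + 1))).1 P * eis (r + 1) P.2 := by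
  obtain ⟨u, hu⟩ := exists_cycle_decomposition Y z
  choose w hw using fun i s => exists_cycle_decomposition Y (c i s)
  -- the insertion cycles of the component of degree `q`
  have key : ∀ q i s, incl (w i s (q + (-1 - s))).1 = resid Y 1 i.succ s (u q).1 := fun q i s =>
    hu.component_eq (fun p z hz => resid_mem_ambDeg Y 1 i.succ s hz) (hw i s) (e i s) q
  -- a common bound for the modes of `z` and of its components
  obtain ⟨M₀, hM₀⟩ := exists_insertion_bound (Y := Y) z.1
  choose M₁ hM₁ using fun q => exists_insertion_bound (Y := Y) (u q).1
  let A := hu.cyc_finite.toFinset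
  let M := M₀ + ∑ q ∈ A, M₁ q
  have hz : ∀ (i : Fin (m + 1)) (s : ℤ), (M + 1 : ℕ) ≤ s → (S' m (c i s)).1 P = 0 :=
    insertion_eval_eq_zero e (fun i s hs => hM₀ i s (by omega)) P
  have hA : ∀ q, q ∉ A → u q = 0 := fun q hq => by simpa [A] using hq
  have hM : ∀ (q : ℤ) (i : Fin (m + 1)) (s : ℤ), (M + 1 : ℕ) ≤ s →
      resid Y 1 i.succ s (u q).1 = 0 := by
    intro q i s hs
    by_cases hq : q ∈ A
    · have := Finset.single_le_sum (f := M₁) (fun _ _ => Nat.zero_le _) hq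
      exact hM₁ q i s (by omega)
    · simp [hA q hq]
  let x : ℤ → Fin (m + 1) → ℤ → ℂ := fun q i s => (S m (w i s (q + (-1 - s)))).1 (modPt γ P)
  have him : 0 < P.2.im := hP.1
  have hj := autFactor_ne_zero γ him
  have hcomp : ∀ q, (S (m + 1) (u q)).1 (modPt γ (Fin.cons v P.1, P.2)) =
      insertionSum (M + 1) v P fun i s => autFactor γ P.2 ^ (1 + s) * x q i s :=
    fun q => hS.eval_modPt_eq_insertionSum γ (key q) (hM q) hP
  have hx : ∀ i s, (S' m (c i s)).1 P =
      ∑ q ∈ A, autFactor γ P.2 ^ (1 - q) * (autFactor γ P.2 ^ (1 + s) * x q i s) := by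
    intro i s
    rw [h.eval_shift (hw i s) him (-1 - s)]
    rw [finsum_eq_sum_of_support_subset (s := A)]
    · refine Finset.sum_congr rfl fun q _ => ?_
      rw [← mul_assoc, ← zpow_add₀ hj]
      congr 2
      ring
    · intro q hq
      by_contra hc
      have : w i s (q + (-1 - s)) = 0 :=
        Subtype.ext (incl_injective (by rw [key, hA q hc]; simp))
      exact hq (by simp [this])
  refine Eq.trans ?_ (insertionSum_eq (x := fun i s => (S' m (c i s)).1 P) v P hz)
  rw [h.eval hu hP.1, finsum_eq_sum_of_support_subset (s := A)]
  · have : (fun i s => (S' m (c i s)).1 P) = ∑ q ∈ A, fun i s =>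
        autFactor γ P.2 ^ (1 - q) * (autFactor γ P.2 ^ (1 + s) * x q i s) := by
      funext i s
      simp [hx, Finset.sum_apply]
    rw [this, map_sum]
    refine Finset.sum_congr rfl fun q _ => ?_
    rw [hcomp]
    exact (map_smul (insertionSum (M + 1) v P) (autFactor γ P.2 ^ (1 - q))
      fun i s => autFactor γ P.2 ^ (1 + s) * x q i s).symm
  · intro q hq
    by_contra hc
    exact hq (by simp [hA q hc])

end tensor

section tensor
variable {V : Type*} [AddCommGroup V] [Module ℂ V] {Y : ConformalVertexAlgebra V}

/-! ### The right action on conformal blocks -/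

theorem IsTransform.genusOne {γ : SL2Z} {S S' : Family Y} (h : IsTransform Y γ S S')
    (hS : GenusOne Y S) : GenusOne Y S' where
  jacobiLinear := hS.transform_jacobiLinear h
  relation := hS.transform_relation h
  boundary := hS.transform_boundary h
  flatPoints := hS.transform_flatPoints h
  flatTau := hS.transform_flatTau h
  vacuum := hS.transform_vacuum h
  symmetry := hS.transform_symmetry h
  insertion := hS.transform_insertion h

variable (Y) in
/-- The right action of `SL(2,ℤ)` on conformal blocks of degree `1`, as a representation of the
opposite group. -/
def modularRepresentation : Representation ℂ SL2Zᵐᵒᵖ (conformalBlocks Y) where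
  toFun γ :=
    { toFun := fun S => ⟨transform Y γ.unop S.1, (transform_isTransform Y γ.unop S.1).genusOne S.2⟩
      map_add' := fun S T => Subtype.ext <| (transform_isTransform Y γ.unop _).unique
        ((transform_isTransform Y γ.unop S.1).add (transform_isTransform Y γ.unop T.1))
      map_smul' := fun b S => Subtype.ext <| (transform_isTransform Y γ.unop _).unique
        ((transform_isTransform Y γ.unop S.1).smul b) }
  map_one' := LinearMap.ext fun S => Subtype.ext <|
    (transform_isTransform Y 1 S.1).unique (isTransform_one S.1)
  map_mul' γ δ := LinearMap.ext fun S => Subtype.ext <|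
    (transform_isTransform Y (γ * δ).unop S.1).unique
      ((transform_isTransform Y δ.unop S.1).comp (transform_isTransform Y γ.unop _))

end tensor

end ChiralTorus

end

theorem mainTheorem7 {V : Type*} [AddCommGroup V] [Module ℂ V] (Y : ConformalVertexAlgebra V) :
    (∀ (γ : Matrix.SpecialLinearGroup (Fin 2) ℤ) (S : Family Y), GenusOne Y S →
      (∃! S' : Family Y, IsTransform Y γ S S') ∧
      ∀ S' : Family Y, IsTransform Y γ S S' → GenusOne Y S') ∧
    ∃ ρ : Representation ℂ (Matrix.SpecialLinearGroup (Fin 2) ℤ)ᵐᵒᵖ (conformalBlocks Y),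
      ∀ (γ : Matrix.SpecialLinearGroup (Fin 2) ℤ) (S : conformalBlocks Y),
        IsTransform Y γ S.1 (ρ (MulOpposite.op γ) S).1 :=
  ⟨fun γ S hS => ⟨⟨transform Y γ S, transform_isTransform Y γ S,
      fun _ h => h.unique (transform_isTransform Y γ S)⟩, fun _ h => h.genusOne hS⟩,
    modularRepresentation Y, fun γ S => transform_isTransform Y γ S.1⟩
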